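/- **Setting and notation.** Let $(M,g)$ be a connected oriented spacetime: a connected smooth (Hausdorff) 4-manifold with a smooth metric $g$ of signature $(-+++)$ and smooth metric volume element $\eta$; $\nabla$ is the Levi-Civita connection and all tensor fields are smooth. For 2-tensors put $(A\times B)_{\alpha\beta}=A_{\alpha\mu}g^{\mu\nu}B_{\nu\beta}$, $A^2=A\times A$, $\operatorname{tr}T=g^{\alpha\beta}T_{\alpha\beta}$. The Hodge dual of a 2-form is $(*A)_{\alpha\beta}=\frac12A^{\mu\nu}\eta_{\mu\nu\alpha\beta}$. A Killing–Yano (KY) tensor is a 2-form $A$ with $\nabla_{(\alpha}A_{\beta)\mu}=0$; a 2-form is regular if at every point $A_{\alpha\beta}A^{\alpha\beta}$ and $A_{\alpha\beta}(*A)^{\alpha\beta}$ are not both zero. A symmetric tensor $K$ is a Killing tensor if $\nabla_{(\alpha}K_{\beta\mu)}=0$. For a symmetric tensor $K$ set $P=K-\frac14(\operatorname{tr}K)\,g$, $a=\operatorname{tr}K$, $b=\operatorname{tr}K^2$ and $$\psi[K]=\arctan\frac{\sqrt{4b-a^2}-a}{\sqrt{2(2b-a^2)}} ,\qquad \Psi[P]_\delta=\frac1{\operatorname{tr}P^2}\,t^{\alpha\beta\gamma}\eta_{\alpha\beta\gamma\delta},\quad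 t_{\alpha\beta\gamma}=\nabla_\alpha P_{\beta\mu}\,g^{\mu\nu}P_{\nu\gamma}.$$ For a symmetric tensor $T$ set $Q=T\wedge g-\frac{1}{\sqrt{\operatorname{tr}T^2}}(T\wedge g)^2$, where $(A\wedge B)_{\alpha\beta\mu\nu}=A_{\alpha\mu}B_{\beta\nu}+A_{\beta\nu}B_{\alpha\mu}-A_{\alpha\nu}B_{\beta\mu}-A_{\beta\mu}B_{\alpha\nu}$, a double 2-form $R$ acts on 2-forms by $R(X)_{\alpha\beta}=\frac12R_{\alpha\beta\mu\nu}X^{\mu\nu}$, and the square is that of endomorphisms; put $Q(X,X)=\frac14Q_{\alpha\beta\mu\nu}X^{\alpha\beta}X^{\mu\nu}$. For a 2-form $X$ on an open set $W$ with $Q(X,X)\neq0$ on $W$, let $F^\circ[T]=Q(X)/\sqrt{2Q(X,X)}$; call such an $X$ admissible for $T$ on $W$. **Theorem.** Let $K$ be a symmetric tensor on $M$ for which the index $\psi[K]$ is well defined, in the sense that either $2b-a^2>0$ everywhere, or $2b-a^2=0$ and $a>0$ everywhere (in which case $\psi[K]:=0$). Consider the conditions * (algebraic) $4P^2=\operatorname{tr}(P^2)\,g$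 and $\operatorname{tr}(P^2)\neq0$ at every point, and $K(x,x)<0$ for every time-like vector $x$; * (differential) $K$ is a Killing tensor and, for $\epsilon=1$ or $\epsilon=-1$, $\;-2\,d\psi[K]=\epsilon\,\Psi[P]$ on $M$. 1. $K$ is the square $K=A^2$ of a regular KY tensor $A$ on $M$ if and only if $K$ satisfies the algebraic and differential conditions and there is a 2-form admissible for $-P$ on all of $M$. 2. If $M$ is simply connected, then $K$ is the square of a regular KY tensor on $M$ if and only if $K$ satisfies the algebraic and differential conditions. 3. If $K$ satisfies the conditions, every point of $M$ has an open neighbourhood on which there is a 2-form admissible for $-P$. 4. If $K$ satisfies the conditions with the sign $\epsilon$, then for every open $W\subseteq M$ and every 2-form $X$ admissible for $-P$ on $W$, with $A^\circ=F^\circ[-P]=Q(X)/\sqrt{2Q(X,X)}$ (where $Q$ is formed with $T=-P$), $$A=\cos\psi[K]\,A^\circ+\epsilon\,\sin\psi[K]\,{*A^\circ}$$ is a regular KY tensor on $W$ with $A^2=K$. -/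

import Mathlib

open scoped Manifold ContDiff

noncomputable section

namespace Rainich

/-- The model space of a four-dimensional manifold. -/
abbrev E4 : Type := EuclideanSpace ℝ (Fin 4)

/-- Components `T_{αβ}` of a covariant 2-tensor in some frame. -/
abbrev Mat4 : Type := Matrix (Fin 4) (Fin 4) ℝ

/-- Components of a covariant 4-tensor in some frame (volume element, double 2-forms). -/
abbrev Ten4 : Type := Fin 4 → Fin 4 → Fin 4 → Fin 4 → ℝ

/-! ### Tensor algebra at a point, in components

`g` holds the components `g_{αβ}` of the metric and `η` those of the metric volume element, in the
same (arbitrary) frame; `g⁻¹` is the matrix of the `g^{αβ}`. -/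

/-- `(A × B)_{αβ} = A_{αμ} g^{μν} B_{νβ}`. -/
def cross (g A B : Mat4) : Mat4 := A * g⁻¹ * B

/-- The square `A² = A × A` of a 2-tensor. -/
def sq (g A : Mat4) : Mat4 := cross g A A

/-- The trace `g^{αβ} T_{βα}`. -/
def tr (g T : Mat4) : ℝ := (g⁻¹ * T).trace

/-- `X^{αβ} = g^{αμ} X_{μν} g^{νβ}`. -/
def raise (g X : Mat4) : Mat4 := g⁻¹ * X * g⁻¹

/-- The Hodge dual of a 2-form, `(*A)_{αβ} = ½ A^{μν} η_{μναβ}`. -/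
def hodge (g : Mat4) (η : Ten4) (A : Mat4) : Mat4 :=
  Matrix.of fun α β => (1 / 2 : ℝ) * ∑ μ, ∑ ν, raise g A μ ν * η μ ν α β

/-- The traceless part `P = K - ¼ (tr K) g`. -/
def tracelessPart (g K : Mat4) : Mat4 := K - (tr g K / 4) • g

/-- The Rainich index `ψ[K] = arctan ((√(4b - a²) - a) / √(2(2b - a²)))`, with `a = tr K` and
`b = tr K²`. (For `2b = a²`, `a > 0` the quotient is `0/0`, and `0/0 = 0` makes the value `0`,
which is the continuous extension.) -/
def rainichIndex (g K : Mat4) : ℝ :=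
  let a := tr g K
  let b := tr g (sq g K)
  Real.arctan ((√(4 * b - a ^ 2) - a) / √(2 * (2 * b - a ^ 2)))

/-- The exterior product of double forms:
`(A ∧ B)_{αβμν} = A_{αμ} B_{βν} + A_{βν} B_{αμ} - A_{αν} B_{βμ} - A_{βμ} B_{αν}`. -/
def doubleWedge (A B : Mat4) : Ten4 := fun α β μ ν =>
  A α μ * B β ν + A β ν * B α μ - A α ν * B β μ - A β μ * B α ν

/-- A double 2-form as an endomorphism of the space of 2-forms, `R(X)_{αβ} = ½ R_{αβμν} X^{μν}`
(so that `½ g ∧ g` acts as the identity). -/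
def act (g : Mat4) (R : Ten4) (X : Mat4) : Mat4 :=
  Matrix.of fun α β => (1 / 2 : ℝ) * ∑ μ, ∑ ν, R α β μ ν * raise g X μ ν

/-- The square of a double 2-form, as an endomorphism of the space of 2-forms:
`(R²)_{αβμν} = ½ R_{αβρσ} R^{ρσ}_{μν}`. -/
def doubleSq (g : Mat4) (R : Ten4) : Ten4 := fun α β μ ν =>
  (1 / 2 : ℝ) * ∑ ρ, ∑ σ, ∑ κ, ∑ τ, R α β ρ σ * g⁻¹ ρ κ * g⁻¹ σ τ * R κ τ μ ν

/-- `Q = T ∧ g - (tr T²)^{-1/2} (T ∧ g)²`. -/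
def Qten (g T : Mat4) : Ten4 := fun α β μ ν =>
  doubleWedge T g α β μ ν - (√(tr g (sq g T)))⁻¹ * doubleSq g (doubleWedge T g) α β μ ν

/-- `Q(X, X) = ¼ Q_{αβμν} X^{αβ} X^{μν}`. -/
def Qform (g T X : Mat4) : ℝ :=
  (1 / 4 : ℝ) * ∑ α, ∑ β, ∑ μ, ∑ ν, Qten g T α β μ ν * raise g X α β * raise g X μ ν

/-- The simple 2-form `F°[T] = Q(X) / √(2 Q(X, X))`. -/
def Fzero (g T X : Mat4) : Mat4 := (√(2 * Qform g T X))⁻¹ • act g (Qten g T) X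

/-- `A = cos ψ[K] A° + ε sin ψ[K] *A°` with `A° = F°[-P]`. -/
def kyForm (g : Mat4) (η : Ten4) (K : Mat4) (ε : ℝ) (X : Mat4) : Mat4 :=
  Real.cos (rainichIndex g K) • Fzero g (-tracelessPart g K) X +
    (ε * Real.sin (rainichIndex g K)) • hodge g η (Fzero g (-tracelessPart g K) X)

/-! ### First-order differential concomitants in a coordinate domain

Here `G`, `T` are the component functions of the metric and of a 2-tensor. -/

/-- The partial derivative `∂_α f` at `y`. -/
def pd (f : E4 → ℝ) (α : Fin 4) (y : E4) : ℝ := fderiv ℝ f y (EuclideanSpace.single α 1)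

/-- The Christoffel symbols `Γ^σ_{αβ}` of the Levi-Civita connection. -/
def christoffel (G : E4 → Mat4) (y : E4) (σ α β : Fin 4) : ℝ :=
  (1 / 2 : ℝ) * ∑ ρ, (G y)⁻¹ σ ρ *
    (pd (fun z => G z ρ β) α y + pd (fun z => G z α ρ) β y - pd (fun z => G z α β) ρ y)

/-- The covariant derivative `∇_α T_{βμ}`. -/
def covDeriv (G T : E4 → Mat4) (y : E4) (α β μ : Fin 4) : ℝ :=
  pd (fun z => T z β μ) α y - ∑ σ, christoffel G y σ α β * T y σ μ
    - ∑ σ, christoffel G y σ α μ * T y β σ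

/-- The Rainich 1-form `Ψ[T] = (tr T²)⁻¹ *(∇T × T)`. With
`t_{αβγ} = (∇T × T)_{αβγ} = ∇_α T_{βμ} g^{μν} T_{νγ}`, the dual of its skew-symmetric part
`∑_σ sign(σ) t_{σ(αβγ)}` is `(*t)_δ = t^{αβγ} η_{αβγδ}`. -/
def rainichForm (G : E4 → Mat4) (η : Ten4) (T : E4 → Mat4) (y : E4) (δ : Fin 4) : ℝ :=
  let h := (G y)⁻¹
  let t : Fin 4 → Fin 4 → Fin 4 → ℝ := fun α β γ =>
    ∑ μ, ∑ ν, covDeriv G T y α β μ * h μ ν * T y ν γ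
  (tr (G y) (sq (G y) (T y)))⁻¹ *
    ∑ α, ∑ β, ∑ γ, (∑ α', ∑ β', ∑ γ', h α α' * h β β' * h γ γ' * t α' β' γ') * η α β γ δ

/-! ### Tensor fields on a four-dimensional manifold -/

section Fields

variable (M : Type*) [TopologicalSpace M] [ChartedSpace E4 M]

/-- Fields (of no regularity) of covariant 2-tensors. -/
abbrev TensorField : Type _ := ∀ p : M, LinearMap.BilinForm ℝ (TangentSpace (𝓡 4) p)

/-- Fields (of no regularity) of 4-forms. -/
abbrev FourForm : Type _ := ∀ p : M, (TangentSpace (𝓡 4) p) [⋀^Fin 4]→ₗ[ℝ] ℝ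

variable {M}

/-- A basis of `T_pM`, used to evaluate frame-independent algebraic expressions at `p`. -/
def basisAt (p : M) : Module.Basis (Fin 4) ℝ (TangentSpace (𝓡 4) p) :=
  (EuclideanSpace.basisFun (Fin 4) ℝ).toBasis

/-- Components of `T` at `p` in the basis `basisAt p`. -/
def matAt (T : TensorField M) (p : M) : Mat4 :=
  Matrix.of fun i j => T p (basisAt p i) (basisAt p j)

/-- Components of `η` at `p` in the basis `basisAt p`. -/
def volAt (η : FourForm M) (p : M) : Ten4 := fun i j k l =>
  η p ![basisAt p i, basisAt p j, basisAt p k, basisAt p l]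

/-- The coordinate vector field `∂_i` of the chart `e`, at the point with coordinates `y`. -/
def coordVec (e : OpenPartialHomeomorph M E4) (y : E4) (i : Fin 4) :
    TangentSpace (𝓡 4) (e.symm y) :=
  mfderiv 𝓘(ℝ, E4) (𝓡 4) e.symm y (EuclideanSpace.single i 1 : E4)

/-- Components of `T` in the chart `e`, as functions of the coordinates. -/
def comp (e : OpenPartialHomeomorph M E4) (T : TensorField M) (y : E4) : Mat4 :=
  Matrix.of fun i j => T (e.symm y) (coordVec e y i) (coordVec e y j)

/-- Components of `η` in the chart `e`, as functions of the coordinates. -/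
def volComp (e : OpenPartialHomeomorph M E4) (η : FourForm M) (y : E4) : Ten4 := fun i j k l =>
  η (e.symm y) ![coordVec e y i, coordVec e y j, coordVec e y k, coordVec e y l]

/-- The part of the coordinate domain of `e` that corresponds to `W`. -/
def coordDom (e : OpenPartialHomeomorph M E4) (W : Set M) : Set E4 := e.target ∩ e.symm ⁻¹' W

/-- `T` is smooth on the open set `W`: its components in all smooth charts are. -/
def SmoothOn (T : TensorField M) (W : Set M) : Prop :=
  ∀ e ∈ IsManifold.maximalAtlas (𝓡 4) ∞ M, ∀ i j,
    ContDiffOn ℝ ∞ (fun y => comp e T y i j) (coordDom e W)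

/-- `A` is skew-symmetric on `W`. -/
def SkewOn (A : TensorField M) (W : Set M) : Prop := ∀ p ∈ W, ∀ x y, A p x y = -A p y x

end Fields

/-- An oriented spacetime: a smooth metric `g` of signature `(-+++)` together with its metric
volume element `η`, which encodes the orientation. -/
structure OrientedSpacetime (M : Type*) [TopologicalSpace M] [ChartedSpace E4 M] where
  /-- the metric -/
  g : TensorField M
  symm : ∀ p x y, g p x y = g p y x
  signature : ∀ p, ∃ b : Module.Basis (Fin 4) ℝ (TangentSpace (𝓡 4) p),
    ∀ i j, g p (b i) (b j) = Matrix.diagonal ![-1, 1, 1, 1] i j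
  smooth : SmoothOn g Set.univ
  /-- the metric volume element -/
  η : FourForm M
  vol_sq : ∀ p (v : Fin 4 → TangentSpace (𝓡 4) p),
    η p v ^ 2 = -(Matrix.of fun i j => g p (v i) (v j)).det
  vol_smooth : ∀ e ∈ IsManifold.maximalAtlas (𝓡 4) ∞ M, ∀ i j k l,
    ContDiffOn ℝ ∞ (fun y => volComp e η y i j k l) e.target

namespace OrientedSpacetime

variable {M : Type*} [TopologicalSpace M] [ChartedSpace E4 M] (S : OrientedSpacetime M)

/-- The Killing-Yano equation `∇_{(α} A_{β)μ} = 0` on `W`. -/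
def KillingYanoEq (A : TensorField M) (W : Set M) : Prop :=
  ∀ e ∈ IsManifold.maximalAtlas (𝓡 4) ∞ M, ∀ y ∈ coordDom e W, ∀ α β μ,
    covDeriv (comp e S.g) (comp e A) y α β μ + covDeriv (comp e S.g) (comp e A) y β α μ = 0

/-- The 2-form `A` is regular (non-null) at `p`: its invariants `A_{αβ} A^{αβ}` and
`A_{αβ} (*A)^{αβ}` are not both zero. -/
def RegularAt (A : TensorField M) (p : M) : Prop :=
  ¬ (tr (matAt S.g p) (sq (matAt S.g p) (matAt A p)) = 0 ∧
     tr (matAt S.g p) (cross (matAt S.g p) (matAt A p)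
       (hodge (matAt S.g p) (volAt S.η p) (matAt A p))) = 0)

/-- `A` is a regular (smooth) Killing-Yano tensor on the open set `W`. -/
def IsRegularKYOn (A : TensorField M) (W : Set M) : Prop :=
  SkewOn A W ∧ SmoothOn A W ∧ S.KillingYanoEq A W ∧ ∀ p ∈ W, S.RegularAt A p

/-- `K = A²` on `W`. -/
def IsSquareOn (K A : TensorField M) (W : Set M) : Prop :=
  ∀ p ∈ W, matAt K p = sq (matAt S.g p) (matAt A p)

/-- The algebraic conditions: `4P² = (tr P²) g ≠ 0` for the traceless part `P` of `K`, and
`K(x, x) < 0` for every time-like vector `x`. -/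
def AlgebraicCond (K : TensorField M) : Prop :=
  (∀ p, (4 : ℝ) • sq (matAt S.g p) (tracelessPart (matAt S.g p) (matAt K p)) =
        tr (matAt S.g p) (sq (matAt S.g p) (tracelessPart (matAt S.g p) (matAt K p)))
          • matAt S.g p ∧
      tr (matAt S.g p) (sq (matAt S.g p) (tracelessPart (matAt S.g p) (matAt K p))) ≠ 0) ∧
  ∀ p x, S.g p x x < 0 → K p x x < 0

/-- `K` is a Killing tensor, `∇_{(α} K_{βμ)} = 0` (for symmetric `K` the total symmetrization is
the cyclic sum). -/
def IsKilling (K : TensorField M) : Prop :=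
  ∀ e ∈ IsManifold.maximalAtlas (𝓡 4) ∞ M, ∀ y ∈ e.target, ∀ α β μ,
    covDeriv (comp e S.g) (comp e K) y α β μ + covDeriv (comp e S.g) (comp e K) y β μ α +
      covDeriv (comp e S.g) (comp e K) y μ α β = 0

/-- `-2 dψ[K] = ε Ψ[P]`. -/
def RainichEq (K : TensorField M) (ε : ℝ) : Prop :=
  ∀ e ∈ IsManifold.maximalAtlas (𝓡 4) ∞ M, ∀ y ∈ e.target, ∀ δ,
    -2 * pd (fun z => rainichIndex (comp e S.g z) (comp e K z)) δ y =
      ε * rainichForm (comp e S.g) (volComp e S.η y)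
        (fun z => tracelessPart (comp e S.g z) (comp e K z)) y δ

/-- The algebraic and the differential conditions on `K`, with a given sign `ε`. -/
def CondWith (K : TensorField M) (ε : ℝ) : Prop :=
  S.AlgebraicCond K ∧ S.IsKilling K ∧ S.RainichEq K ε

/-- The algebraic and the differential conditions on `K`. -/
def Cond (K : TensorField M) : Prop :=
  ∃ ε : ℝ, (ε = 1 ∨ ε = -1) ∧ S.CondWith K ε

/-- The Rainich index `ψ[K]` is well defined: with `a = tr K`, `b = tr K²`, either the radicand
`2b - a²` is positive everywhere, or it vanishes identically with `a > 0`, where `ψ[K] = 0`. -/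
def IndexDefined (K : TensorField M) : Prop :=
  (∀ p, tr (matAt S.g p) (matAt K p) ^ 2 <
      2 * tr (matAt S.g p) (sq (matAt S.g p) (matAt K p))) ∨
  (∀ p, tr (matAt S.g p) (matAt K p) ^ 2 =
      2 * tr (matAt S.g p) (sq (matAt S.g p) (matAt K p)) ∧ 0 < tr (matAt S.g p) (matAt K p))

/-- `X` is a smooth 2-form on `W` for which the expression `F°[-P] = Q(X) / √(2 Q(X, X))` makes
sense, `P` being the traceless part of `K`. -/
def Admissible (K X : TensorField M) (W : Set M) : Prop :=
  SkewOn X W ∧ SmoothOn X W ∧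
    ∀ p ∈ W, Qform (matAt S.g p) (-tracelessPart (matAt S.g p) (matAt K p)) (matAt X p) ≠ 0

/-- The 2-form `A = cos ψ[K] A° + ε sin ψ[K] *A°`, where `A° = F°[-P]` is computed with `X`. -/
def kyTensor (K : TensorField M) (ε : ℝ) (X : TensorField M) : TensorField M := fun p =>
  Matrix.toBilin (basisAt p)
    (kyForm (matAt S.g p) (volAt S.η p) (matAt K p) ε (matAt X p))

end OrientedSpacetime

end Rainich

end

/-!
# Squares of regular Killing-Yano tensors

Everything rests on a normal form at a point. If `K` satisfies the algebraic conditions and its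
Rainich index is defined, then in a suitable orthonormal frame `K = diag (-l1, l1, -l2, -l2)` with
`0 < l1` and `0 ≤ l2` (`exists_canonical_frame`), and the 2-forms with square `K` are the forms
`x e⁰ ∧ e¹ + y e² ∧ e³` with `x² = l1`, `y² = l2` (`eq_canForm_of_sq_eq`). In this frame the
endomorphism `Q` formed with `-P` is a multiple of the projection to `e⁰ ∧ e¹`, so that
`A° = ±√(l1 + l2) e⁰ ∧ e¹` whatever the admissible 2-form. Moreover `tan ψ[K] = √(l2 / l1)`, so that
`cos ψ A° + ε sin ψ *A°` is one of these square roots, `ε` and the orientation fixing the sign of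
`x y` (`kyForm_canonical`). Conversely the square of a 2-form for which the index is defined
satisfies the algebraic conditions (`algebraicAt_sq`).

For the differential conditions let `A = x e⁰ ∧ e¹ + y e² ∧ e³` at a point, and `D = ∇A` there. As
`∇K = ∇A × A + A × ∇A`, the Killing and the Rainich equations for `K` become linear equations for
the components of `D`. If `D` is skew-symmetric in its first two indices, the Killing equation
holds and the Rainich 1-form of `P` is a multiple of `x dy - y dx` (`cyclicZero_dsq`,
`rainich_value_of_skewFirst`), which in turn is a multiple of `dψ[K]` as `ψ` is, up to sign, the
angle of `(x, y)`. Conversely, the equations for `K` force `D` to be skew-symmetric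
(`skewFirst_of_cyclicZero`): they determine `D` component by component, through rotations by the
angle of `(x, y)`. If `y` vanishes identically, the Killing equation leaves the derivative of `A`
along `e² ∧ e³` undetermined; it vanishes by the identity `A³ = ½ (tr A²) A`
(`LocalSquare.pull_cov_two_three`). These statements are transferred to coordinate components by
the Leibniz rule for the Levi-Civita connection (`LocalSquare.skewFirst_cov`,
`LocalSquare.killing_and_rainich`).

The sign `ε` belonging to a given Killing-Yano tensor `A` is opposite to that of its pseudoscalar
`A_{αβ} (*A)^{αβ}`, whose square is a multiple of `2b - a²`; it is the same at all points because
`M` is connected (`OrientedSpacetime.exists_sign_pseudoscalar`).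

An admissible 2-form exists locally, as `e⁰ ∧ e¹` with constant components in a chart
(`OrientedSpacetime.exists_admissible`). The forms `A°` that such local forms give differ by locally
constant signs on overlaps. These signs are the transition functions of a double covering of `M`,
which has a section if `M` is simply connected; the section glues the local forms to a global one
(`exists_section_of_sign_cocycle`, `OrientedSpacetime.exists_admissible_univ`).
-/


open scoped Manifold ContDiff

noncomputable section

namespace Rainich

open scoped Matrix
open Filter Topology

/-! ### Change of frame -/

/-- Components of a covariant 2-tensor after the change of frame with matrix `C`, whose columns are
the components of the vectors of the new frame in the old one. -/
def pull (C T : Mat4) : Mat4 := Cᵀ * T * C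

/-- Components of a covariant 4-tensor after the change of frame with matrix `C`. -/
def pullVol (C : Mat4) (η : Ten4) : Ten4 := fun i j k l =>
  ∑ a, ∑ b, ∑ c, ∑ d, C a i * C b j * C c k * C d l * η a b c d

theorem mul_mul_apply (A R B : Mat4) (i j : Fin 4) :
    (A * R * B) i j = ∑ μ, ∑ ν, A i μ * R μ ν * B ν j := by
  simp only [Matrix.mul_apply, Finset.sum_mul]
  exact Finset.sum_comm

theorem pull_apply (C T : Mat4) (i j : Fin 4) :
    pull C T i j = ∑ a, ∑ b, C a i * T a b * C b j := by
  simp [pull, mul_mul_apply]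

theorem pull_add (C A B : Mat4) : pull C (A + B) = pull C A + pull C B := by
  simp [pull, mul_add, add_mul]

theorem pull_sub (C A B : Mat4) : pull C (A - B) = pull C A - pull C B := by
  simp [pull, mul_sub, sub_mul]

theorem pull_neg (C A : Mat4) : pull C (-A) = -pull C A := by
  simp [pull]

theorem pull_smul (C A : Mat4) (c : ℝ) : pull C (c • A) = c • pull C A := by
  simp [pull]

theorem pull_pull (C D A : Mat4) : pull D (pull C A) = pull (C * D) A := by
  simp [pull, Matrix.mul_assoc]

theorem pull_one (A : Mat4) : pull 1 A = A := by simp [pull]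

theorem pull_transpose (C A : Mat4) : (pull C A)ᵀ = pull C Aᵀ := by
  simp [pull, Matrix.mul_assoc]

theorem pull_injective {C : Mat4} (hC : IsUnit C.det) {A B : Mat4} (h : pull C A = pull C B) :
    A = B := by
  have := congrArg (pull C⁻¹) h
  rwa [pull_pull, pull_pull, Matrix.mul_nonsing_inv _ hC, pull_one, pull_one] at this

theorem inv_pull (C g : Mat4) : (pull C g)⁻¹ = C⁻¹ * g⁻¹ * C⁻¹ᵀ := by
  simp [pull, Matrix.mul_inv_rev, Matrix.mul_assoc, Matrix.transpose_nonsing_inv]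

/-- The inverse metric transforms as a contravariant tensor. -/
theorem mul_inv_pull_mul {C : Mat4} (hC : IsUnit C.det) (g : Mat4) :
    C * (pull C g)⁻¹ * Cᵀ = g⁻¹ := by
  have h1 : C * C⁻¹ = 1 := Matrix.mul_nonsing_inv _ hC
  have h2 : C⁻¹ᵀ * Cᵀ = 1 := by rw [← Matrix.transpose_mul, h1, Matrix.transpose_one]
  calc C * (pull C g)⁻¹ * Cᵀ = (C * C⁻¹) * g⁻¹ * (C⁻¹ᵀ * Cᵀ) := by
        rw [inv_pull]; simp only [Matrix.mul_assoc]
    _ = g⁻¹ := by rw [h1, h2, one_mul, mul_one]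

theorem cross_pull {C : Mat4} (hC : IsUnit C.det) (g A B : Mat4) :
    cross (pull C g) (pull C A) (pull C B) = pull C (cross g A B) := by
  calc cross (pull C g) (pull C A) (pull C B)
      = Cᵀ * A * (C * (pull C g)⁻¹ * Cᵀ) * B * C := by
        simp only [cross, pull, Matrix.mul_assoc]
    _ = _ := by rw [mul_inv_pull_mul hC]; simp only [cross, pull, Matrix.mul_assoc]

theorem sq_pull {C : Mat4} (hC : IsUnit C.det) (g A : Mat4) :
    sq (pull C g) (pull C A) = pull C (sq g A) := cross_pull hC g A A

theorem tr_pull {C : Mat4} (hC : IsUnit C.det) (g T : Mat4) :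
    tr (pull C g) (pull C T) = tr g T := by
  calc tr (pull C g) (pull C T) = ((pull C g)⁻¹ * Cᵀ * T * C).trace := by
        rw [tr]; nth_rw 2 [pull]; simp only [Matrix.mul_assoc]
    _ = (C * (pull C g)⁻¹ * Cᵀ * T).trace := by
        rw [Matrix.trace_mul_comm]; simp only [Matrix.mul_assoc]
    _ = _ := by rw [mul_inv_pull_mul hC, tr]

theorem tracelessPart_pull {C : Mat4} (hC : IsUnit C.det) (g K : Mat4) :
    tracelessPart (pull C g) (pull C K) = pull C (tracelessPart g K) := by
  rw [tracelessPart, tr_pull hC, tracelessPart, pull_sub, pull_smul]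

theorem rainichIndex_pull {C : Mat4} (hC : IsUnit C.det) (g K : Mat4) :
    rainichIndex (pull C g) (pull C K) = rainichIndex g K := by
  simp only [rainichIndex, sq_pull hC, tr_pull hC]

theorem mul_raise_pull_mul {C : Mat4} (hC : IsUnit C.det) (g X : Mat4) :
    C * raise (pull C g) (pull C X) * Cᵀ = raise g X := by
  calc C * raise (pull C g) (pull C X) * Cᵀ
      = (C * (pull C g)⁻¹ * Cᵀ) * X * (C * (pull C g)⁻¹ * Cᵀ) := by
        simp only [raise]; nth_rw 2 [pull]; simp only [Matrix.mul_assoc]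
    _ = _ := by rw [mul_inv_pull_mul hC, raise]

/-- The Hodge dual does not depend on the frame in which it is computed. -/
theorem hodge_pull {C : Mat4} (hC : IsUnit C.det) (g : Mat4) (η : Ten4) (A : Mat4) :
    hodge (pull C g) (pullVol C η) (pull C A) = pull C (hodge g η A) := by
  ext α β
  have h : ∀ a b, raise g A a b =
      ∑ μ, ∑ ν, C a μ * raise (pull C g) (pull C A) μ ν * C b ν := by
    intro a b
    rw [← mul_raise_pull_mul hC g A, mul_mul_apply]; rfl
  rw [pull_apply]
  simp only [hodge, Matrix.of_apply, h, pullVol]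
  generalize raise (pull C g) (pull C A) = R
  have h1 : ∀ μ ν, R μ ν * ∑ a, ∑ b, ∑ c, ∑ d, C a μ * C b ν * C c α * C d β * η a b c d =
      ∑ c, ∑ d, ∑ a, ∑ b, C c α * C d β * (C a μ * R μ ν * C b ν * η a b c d) := by
    intro μ ν
    rw [Finset.mul_sum]
    simp only [Finset.mul_sum]
    rw [Finset.sum_congr rfl fun a _ => Finset.sum_comm, Finset.sum_comm]
    refine Finset.sum_congr rfl fun c _ => ?_
    rw [Finset.sum_congr rfl fun a _ => Finset.sum_comm, Finset.sum_comm]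
    refine Finset.sum_congr rfl fun d _ => Finset.sum_congr rfl fun a _ =>
      Finset.sum_congr rfl fun b _ => by ring
  simp only [h1]
  have h2 : ∀ c d, C c α * (1 / 2 * ∑ a, ∑ b, (∑ μ, ∑ ν, C a μ * R μ ν * C b ν) * η a b c d) *
      C d β = 1 / 2 * ∑ μ, ∑ ν, ∑ a, ∑ b, C c α * C d β * (C a μ * R μ ν * C b ν * η a b c d) := by
    intro c d
    have : ∑ μ, ∑ ν, ∑ a, ∑ b, C c α * C d β * (C a μ * R μ ν * C b ν * η a b c d) =
        C c α * C d β * ∑ a, ∑ b, (∑ μ, ∑ ν, C a μ * R μ ν * C b ν) * η a b c d := by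
      simp only [Finset.mul_sum, Finset.sum_mul]
      rw [Finset.sum_congr rfl fun μ _ => Finset.sum_comm, Finset.sum_comm]
      refine Finset.sum_congr rfl fun a _ => ?_
      rw [Finset.sum_congr rfl fun μ _ => Finset.sum_comm, Finset.sum_comm]
    rw [this]; ring
  simp only [h2]
  rw [Finset.sum_congr rfl fun c _ => (Finset.mul_sum _ _ _).symm, ← Finset.mul_sum]
  congr 1
  rw [Finset.sum_congr rfl fun μ _ => Finset.sum_comm, Finset.sum_comm]
  refine Finset.sum_congr rfl fun c _ => ?_
  rw [Finset.sum_congr rfl fun μ _ => Finset.sum_comm, Finset.sum_comm]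

/-! ### The double 2-form `Q` -/

/-- The symmetrized product `T × X + X × T`; it is the action of `T ∧ g` on a 2-form `X`. -/
def jordan (g T X : Mat4) : Mat4 := cross g T X + cross g X T

theorem jordan_pull {C : Mat4} (hC : IsUnit C.det) (g T X : Mat4) :
    jordan (pull C g) (pull C T) (pull C X) = pull C (jordan g T X) := by
  simp only [jordan, cross_pull hC, pull_add]

theorem jordan_transpose {g T X : Mat4} (hg : gᵀ = g) (hT : Tᵀ = T) (hX : Xᵀ = -X) :
    (jordan g T X)ᵀ = -jordan g T X := by
  simp only [jordan, cross, Matrix.transpose_add, Matrix.transpose_mul, hT, hX,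
    Matrix.transpose_nonsing_inv, hg]
  simp [Matrix.mul_assoc, add_comm]

theorem raise_transpose {g X : Mat4} (hg : gᵀ = g) (hX : Xᵀ = -X) :
    (raise g X)ᵀ = -raise g X := by
  simp [raise, Matrix.transpose_mul, hX, Matrix.transpose_nonsing_inv, hg, Matrix.mul_assoc]

theorem act_doubleWedge {g T X : Mat4} (hg : gᵀ = g) (hdet : IsUnit g.det) (hT : Tᵀ = T)
    (hX : Xᵀ = -X) : act g (doubleWedge T g) X = jordan g T X := by
  ext α β
  have e1 : T * raise g X * gᵀ = cross g T X := by
    simp only [hg, raise, cross, Matrix.mul_assoc]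
    rw [Matrix.nonsing_inv_mul _ hdet, mul_one]
  have e2 : g * raise g X * Tᵀ = cross g X T := by
    simp only [hT, raise, cross]
    simp only [← Matrix.mul_assoc]
    rw [Matrix.mul_nonsing_inv _ hdet, one_mul]
  have e3 : T * (raise g X)ᵀ * gᵀ = -cross g T X := by
    rw [raise_transpose hg hX, ← e1]; simp
  have e4 : g * (raise g X)ᵀ * Tᵀ = -cross g X T := by
    rw [raise_transpose hg hX, ← e2]; simp
  have f1 := congrFun (congrFun e1 α) β
  have f2 := congrFun (congrFun e2 α) β
  have f3 := congrFun (congrFun e3 α) β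
  have f4 := congrFun (congrFun e4 α) β
  rw [mul_mul_apply] at f1 f2 f3 f4
  rw [Finset.sum_comm] at f3 f4
  simp only [Matrix.transpose_apply, Matrix.neg_apply] at f1 f2 f3 f4
  have key : ∑ μ, ∑ ν, doubleWedge T g α β μ ν * raise g X μ ν =
      (∑ μ, ∑ ν, T α μ * raise g X μ ν * g β ν) + (∑ μ, ∑ ν, g α μ * raise g X μ ν * T β ν)
      - (∑ μ, ∑ ν, T α ν * raise g X μ ν * g β μ) - ∑ μ, ∑ ν, g α ν * raise g X μ ν * T β μ := by
    simp only [← Finset.sum_add_distrib, ← Finset.sum_sub_distrib]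
    refine Finset.sum_congr rfl fun μ _ => Finset.sum_congr rfl fun ν _ => ?_
    simp only [doubleWedge]; ring
  simp only [act, Matrix.of_apply, jordan, Matrix.add_apply]
  rw [key, f1, f2, f3, f4]; ring

/-- `doubleSq` is the square for the composition of endomorphisms of the space of 2-forms. -/
theorem act_doubleSq {g : Mat4} (hg : gᵀ = g) (R : Ten4) (X : Mat4) :
    act g (doubleSq g R) X = act g R (act g R X) := by
  have hh : ∀ a b, g⁻¹ a b = g⁻¹ b a := fun a b => by
    have := congrFun (congrFun (Matrix.transpose_nonsing_inv g) b) a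
    rw [hg] at this; exact this
  ext α β
  simp only [act, Matrix.of_apply]
  have h1 : ∀ ρ σ, raise g (Matrix.of fun α β => 1 / 2 * ∑ μ, ∑ ν, R α β μ ν * raise g X μ ν) ρ σ =
      ∑ μ, ∑ ν, ∑ κ, ∑ τ, 1 / 2 * (g⁻¹ ρ κ * g⁻¹ σ τ * R κ τ μ ν * raise g X μ ν) := by
    intro ρ σ
    rw [raise, mul_mul_apply]
    simp only [Matrix.of_apply, Finset.mul_sum, Finset.sum_mul]
    rw [Finset.sum_congr rfl fun κ _ => Finset.sum_comm, Finset.sum_comm]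
    refine Finset.sum_congr rfl fun μ _ => ?_
    rw [Finset.sum_congr rfl fun κ _ => Finset.sum_comm, Finset.sum_comm]
    refine Finset.sum_congr rfl fun ν _ => Finset.sum_congr rfl fun κ _ =>
      Finset.sum_congr rfl fun τ _ => ?_
    rw [hh τ σ]; ring
  simp only [h1, doubleSq]
  simp only [Finset.mul_sum, Finset.sum_mul]
  rw [Finset.sum_congr rfl fun μ _ => Finset.sum_comm, Finset.sum_comm]
  refine Finset.sum_congr rfl fun ρ _ => ?_
  rw [Finset.sum_congr rfl fun μ _ => Finset.sum_comm, Finset.sum_comm]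
  refine Finset.sum_congr rfl fun σ _ => Finset.sum_congr rfl fun μ _ =>
    Finset.sum_congr rfl fun ν _ => Finset.sum_congr rfl fun κ _ =>
      Finset.sum_congr rfl fun τ _ => by ring

/-- On 2-forms the endomorphism `Q` is `J - (tr T²)^{-1/2} J²`, `J` being the symmetrized product
with `T`. -/
theorem act_Qten {g T X : Mat4} (hg : gᵀ = g) (hdet : IsUnit g.det) (hT : Tᵀ = T)
    (hX : Xᵀ = -X) :
    act g (Qten g T) X =
      jordan g T X - (√(tr g (sq g T)))⁻¹ • jordan g T (jordan g T X) := by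
  rw [← act_doubleWedge hg hdet hT (jordan_transpose hg hT hX), ← act_doubleWedge hg hdet hT hX,
    ← act_doubleSq hg]
  ext α β
  simp only [act, Matrix.of_apply, Matrix.sub_apply, Matrix.smul_apply, smul_eq_mul, Qten,
    sub_mul, Finset.sum_sub_distrib, mul_sub, mul_assoc, ← Finset.mul_sum]
  ring

theorem Qform_eq {g T X : Mat4} (hg : gᵀ = g) (hX : Xᵀ = -X) :
    Qform g T X = -(1 / 2) * tr g (cross g (act g (Qten g T) X) X) := by
  have h : tr g (cross g (act g (Qten g T) X) X) =
      -∑ α, ∑ β, act g (Qten g T) X α β * raise g X α β := by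
    calc tr g (cross g (act g (Qten g T) X) X)
        = (act g (Qten g T) X * raise g X).trace := by
          rw [tr, cross, Matrix.trace_mul_comm, raise]; simp only [Matrix.mul_assoc]
      _ = -(act g (Qten g T) X * (raise g X)ᵀ).trace := by
          rw [raise_transpose hg hX]; simp
      _ = _ := by simp [Matrix.trace, Matrix.mul_apply]
  rw [h, Qform]
  simp only [act, Matrix.of_apply, Finset.mul_sum, Finset.sum_mul, mul_neg, neg_mul, neg_neg,
    ← Finset.sum_neg_distrib]
  refine Finset.sum_congr rfl fun ρ _ => Finset.sum_congr rfl fun σ _ =>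
    Finset.sum_congr rfl fun μ _ => Finset.sum_congr rfl fun ν _ => ?_
  ring

section

variable {C g T K X : Mat4}

theorem act_Qten_pull (hC : IsUnit C.det) (hg : gᵀ = g) (hdet : IsUnit g.det) (hT : Tᵀ = T)
    (hX : Xᵀ = -X) :
    act (pull C g) (Qten (pull C g) (pull C T)) (pull C X) = pull C (act g (Qten g T) X) := by
  have hdet' : IsUnit (pull C g).det := by
    simpa [pull, Matrix.det_mul] using (hC.mul hdet).mul hC
  rw [act_Qten (by rw [pull_transpose, hg]) hdet' (by rw [pull_transpose, hT])
    (by rw [pull_transpose, hX, pull_neg]), act_Qten hg hdet hT hX]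
  simp only [sq_pull hC, tr_pull hC, jordan_pull hC, pull_sub, pull_smul]

theorem Qform_pull (hC : IsUnit C.det) (hg : gᵀ = g) (hdet : IsUnit g.det) (hT : Tᵀ = T)
    (hX : Xᵀ = -X) : Qform (pull C g) (pull C T) (pull C X) = Qform g T X := by
  rw [Qform_eq (by rw [pull_transpose, hg]) (by rw [pull_transpose, hX, pull_neg]),
    Qform_eq hg hX, act_Qten_pull hC hg hdet hT hX, cross_pull hC, tr_pull hC]

theorem Fzero_pull (hC : IsUnit C.det) (hg : gᵀ = g) (hdet : IsUnit g.det) (hT : Tᵀ = T)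
    (hX : Xᵀ = -X) : Fzero (pull C g) (pull C T) (pull C X) = pull C (Fzero g T X) := by
  rw [Fzero, Qform_pull hC hg hdet hT hX, act_Qten_pull hC hg hdet hT hX, Fzero, pull_smul]

theorem tracelessPart_transpose (hg : gᵀ = g) (hK : Kᵀ = K) :
    (tracelessPart g K)ᵀ = tracelessPart g K := by
  simp [tracelessPart, hg, hK]

theorem kyForm_pull (hC : IsUnit C.det) (hg : gᵀ = g) (hdet : IsUnit g.det) (hK : Kᵀ = K)
    (hX : Xᵀ = -X) (η : Ten4) (ε : ℝ) :
    kyForm (pull C g) (pullVol C η) (pull C K) ε (pull C X) = pull C (kyForm g η K ε X) := by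
  have hP : (-tracelessPart g K)ᵀ = -tracelessPart g K := by
    rw [Matrix.transpose_neg, tracelessPart_transpose hg hK]
  rw [kyForm, rainichIndex_pull hC, tracelessPart_pull hC, ← pull_neg,
    Fzero_pull hC hg hdet hP hX, hodge_pull hC, kyForm, pull_add, pull_smul, pull_smul]

end

/-! ### Orthonormal frames adapted to a symmetric tensor -/

/-- The components of the metric in an orthonormal frame. -/
def mink : Mat4 := Matrix.diagonal ![-1, 1, 1, 1]

theorem mink_mul_mink : mink * mink = 1 := by
  ext i j
  fin_cases i <;> fin_cases j <;> simp [mink]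

theorem mink_inv : mink⁻¹ = mink := Matrix.inv_eq_right_inv mink_mul_mink

theorem mink_transpose : minkᵀ = mink := by simp [mink]

theorem mink_det : mink.det = -1 := by
  simp [mink, Matrix.det_diagonal, Fin.prod_univ_four]

theorem isUnit_det_mink : IsUnit mink.det := by simp [mink_det]

theorem det_sq_mul_det_of_pull_eq_mink {L g : Mat4} (h : pull L g = mink) :
    L.det ^ 2 * g.det = -1 := by
  have := congrArg Matrix.det h
  simp only [pull, Matrix.det_mul, Matrix.det_transpose, mink_det] at this
  linarith

theorem isUnit_det_frame {L g : Mat4} (h : pull L g = mink) : IsUnit L.det := by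
  have := det_sq_mul_det_of_pull_eq_mink h
  refine isUnit_iff_ne_zero.2 fun h0 => ?_
  rw [h0] at this; norm_num at this

theorem isUnit_det_metric {L g : Mat4} (h : pull L g = mink) : IsUnit g.det := by
  have := det_sq_mul_det_of_pull_eq_mink h
  refine isUnit_iff_ne_zero.2 fun h0 => ?_
  rw [h0] at this; norm_num at this

theorem transpose_of_pull_eq_mink {L g : Mat4} (h : pull L g = mink) : gᵀ = g :=
  pull_injective (isUnit_det_frame h) (by rw [← pull_transpose, h, mink_transpose])

theorem tr_mink (T : Mat4) : tr mink T = -T 0 0 + T 1 1 + T 2 2 + T 3 3 := by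
  rw [tr, mink_inv]
  simp [Matrix.trace, Fin.sum_univ_four, mink, Matrix.diagonal_mul]

theorem cross_mink_apply (A B : Mat4) (i j : Fin 4) :
    cross mink A B i j =
      -(A i 0 * B 0 j) + A i 1 * B 1 j + A i 2 * B 2 j + A i 3 * B 3 j := by
  rw [cross, mink_inv]
  simp [mink, Matrix.mul_apply, Fin.sum_univ_four]

/-- The Lorentz boost with first column `f`, a future-directed unit timelike vector. -/
def boost (f : Fin 4 → ℝ) : Mat4 := fun i j =>
  if i = 0 then f j else if j = 0 then f i else (if i = j then 1 else 0) + f i * f j / (1 + f 0)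

theorem pull_boost {f : Fin 4 → ℝ} (h0 : 0 < f 0)
    (h : f 0 ^ 2 = 1 + f 1 ^ 2 + f 2 ^ 2 + f 3 ^ 2) : pull (boost f) mink = mink := by
  have h1 : 1 + f 0 ≠ 0 := by positivity
  have h2 : f 0 ^ 2 - 1 - f 1 ^ 2 - f 2 ^ 2 - f 3 ^ 2 = 0 := by linarith
  ext i j
  rw [pull_apply]
  fin_cases i <;> fin_cases j <;>
    simp [mink, boost, Fin.sum_univ_four, Matrix.diagonal_apply] <;> field_simp <;> grind

/-- The block matrix `1 ⊕ R`, a spatial rotation if `R` is orthogonal. -/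
def rot (R : Matrix (Fin 3) (Fin 3) ℝ) : Mat4 :=
  Matrix.of ![![1, 0, 0, 0], ![0, R 0 0, R 0 1, R 0 2], ![0, R 1 0, R 1 1, R 1 2],
    ![0, R 2 0, R 2 1, R 2 2]]

/-- A tensor `T = T₀₀ ⊕ S` is diagonalized by `1 ⊕ R` if `S` is diagonalized by `R`. -/
theorem pull_rot (R : Matrix (Fin 3) (Fin 3) ℝ) (T : Mat4) (S : Matrix (Fin 3) (Fin 3) ℝ)
    (hT : T = Matrix.of ![![T 0 0, 0, 0, 0], ![0, S 0 0, S 0 1, S 0 2], ![0, S 1 0, S 1 1, S 1 2],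
      ![0, S 2 0, S 2 1, S 2 2]]) {a b c : ℝ} (hR : Rᵀ * S * R = Matrix.diagonal ![a, b, c]) :
    pull (rot R) T = Matrix.diagonal ![T 0 0, a, b, c] := by
  have e : ∀ i j, (Rᵀ * S * R) i j = Matrix.diagonal ![a, b, c] i j := fun i j => by rw [hR]
  simp only [Matrix.mul_apply, Fin.sum_univ_three, Matrix.transpose_apply] at e
  have e00 := e 0 0; have e01 := e 0 1; have e02 := e 0 2
  have e10 := e 1 0; have e11 := e 1 1; have e12 := e 1 2
  have e20 := e 2 0; have e21 := e 2 1; have e22 := e 2 2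
  simp at e00 e01 e02 e10 e11 e12 e20 e21 e22
  rw [hT]
  ext i j
  fin_cases i <;> fin_cases j <;>
    simp [pull, rot, Matrix.mul_apply, Fin.sum_univ_four] <;> linarith

/-- The eigenvalues of `S` are `±q`, and the trace determines their multiplicities. -/
theorem exists_orthogonal_diagonal {S : Matrix (Fin 3) (Fin 3) ℝ} {q : ℝ} (hq : 0 < q)
    (hS : Sᵀ = S) (hS2 : S * S = q ^ 2 • 1) (htr : S.trace = -q) :
    ∃ R : Matrix (Fin 3) (Fin 3) ℝ, Rᵀ * R = 1 ∧ Rᵀ * S * R = Matrix.diagonal ![q, -q, -q] := by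
  have hH : S.IsHermitian := by
    rw [Matrix.IsHermitian, Matrix.conjTranspose_eq_transpose_of_trivial, hS]
  obtain ⟨U, d, hU, hUd⟩ : ∃ (U : Matrix (Fin 3) (Fin 3) ℝ) (d : Fin 3 → ℝ), Uᵀ * U = 1 ∧
      Uᵀ * S * U = Matrix.diagonal d := by
    refine ⟨hH.eigenvectorUnitary, hH.eigenvalues, ?_, ?_⟩
    · have := Unitary.coe_star_mul_self hH.eigenvectorUnitary
      rwa [Matrix.star_eq_conjTranspose, Matrix.conjTranspose_eq_transpose_of_trivial] at this
    · have := hH.conjStarAlgAut_star_eigenvectorUnitary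
      rw [Unitary.conjStarAlgAut_star_apply] at this
      rwa [Matrix.star_eq_conjTranspose, Matrix.conjTranspose_eq_transpose_of_trivial] at this
  have hU' : U * Uᵀ = 1 := mul_eq_one_comm.1 hU
  have hd : ∀ i, d i ^ 2 = q ^ 2 := by
    have : Matrix.diagonal d * Matrix.diagonal d = q ^ 2 • (1 : Matrix (Fin 3) (Fin 3) ℝ) := by
      calc Matrix.diagonal d * Matrix.diagonal d = Uᵀ * S * (U * Uᵀ) * S * U := by
            rw [← hUd]; simp only [Matrix.mul_assoc]
        _ = Uᵀ * (S * S) * U := by rw [hU']; simp only [Matrix.mul_assoc, Matrix.one_mul]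
        _ = _ := by rw [hS2]; simp [hU]
    intro i
    have := congrFun (congrFun this i) i
    simpa [pow_two] using this
  have hsum : d 0 + d 1 + d 2 = -q := by
    have : (Uᵀ * S * U).trace = S.trace := by
      rw [Matrix.trace_mul_comm, ← Matrix.mul_assoc, hU', Matrix.one_mul]
    rw [hUd, htr] at this
    simpa [Matrix.trace, Fin.sum_univ_three] using this
  -- a permutation of the eigenvectors brings the positive eigenvalue to the front
  obtain ⟨σ, h0, h1, h2⟩ : ∃ σ : Equiv.Perm (Fin 3),
      d (σ 0) = q ∧ d (σ 1) = -q ∧ d (σ 2) = -q := by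
    have c : ∀ i, d i = q ∨ d i = -q := fun i => sq_eq_sq_iff_eq_or_eq_neg.1 (hd i)
    have s1 : Equiv.swap (0 : Fin 3) 1 2 = 2 := by decide
    have s2 : Equiv.swap (0 : Fin 3) 2 1 = 1 := by decide
    rcases c 0 with a0 | a0 <;> rcases c 1 with a1 | a1 <;> rcases c 2 with a2 | a2 <;>
      first
        | (exfalso; linarith)
        | exact ⟨1, a0, a1, a2⟩
        | exact ⟨Equiv.swap 0 1, (congrArg d (Equiv.swap_apply_left _ _)).trans a1,
            (congrArg d (Equiv.swap_apply_right _ _)).trans a0, (congrArg d s1).trans a2⟩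
        | exact ⟨Equiv.swap 0 2, (congrArg d (Equiv.swap_apply_left _ _)).trans a2,
            (congrArg d s2).trans a1, (congrArg d (Equiv.swap_apply_right _ _)).trans a0⟩
  refine ⟨U.submatrix id σ, ?_, ?_⟩
  · have : (U.submatrix id σ)ᵀ * U.submatrix id σ = (Uᵀ * U).submatrix σ σ := by
      rw [Matrix.transpose_submatrix, Matrix.submatrix_mul_equiv _ _ σ (Equiv.refl _) σ |>.symm]
      rfl
    rw [this, hU, Matrix.submatrix_one_equiv]
  · have : (U.submatrix id σ)ᵀ * S * U.submatrix id σ = (Uᵀ * S * U).submatrix σ σ := by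
      ext i j; simp [Matrix.mul_apply]
    rw [this, hUd, Matrix.submatrix_diagonal_equiv]
    congr 1
    ext i; fin_cases i <;> simp [h0, h1, h2]

/-- The algebraic conditions on `K` at a point, in components. -/
def AlgebraicAt (g K : Mat4) : Prop :=
  ((4 : ℝ) • sq g (tracelessPart g K) = tr g (sq g (tracelessPart g K)) • g ∧
    tr g (sq g (tracelessPart g K)) ≠ 0) ∧
  ∀ x : Fin 4 → ℝ, x ⬝ᵥ g *ᵥ x < 0 → x ⬝ᵥ K *ᵥ x < 0

theorem dotProduct_pull_mulVec (C T : Mat4) (x : Fin 4 → ℝ) :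
    x ⬝ᵥ pull C T *ᵥ x = (C *ᵥ x) ⬝ᵥ T *ᵥ (C *ᵥ x) := by
  rw [pull, ← Matrix.mulVec_mulVec, ← Matrix.mulVec_mulVec, Matrix.dotProduct_mulVec,
    Matrix.vecMul_transpose]

theorem AlgebraicAt.pull {C g K : Mat4} (hC : IsUnit C.det) (h : AlgebraicAt g K) :
    AlgebraicAt (pull C g) (pull C K) := by
  refine ⟨⟨?_, ?_⟩, fun x hx => ?_⟩
  · rw [tracelessPart_pull hC, sq_pull hC, tr_pull hC, ← pull_smul, ← pull_smul, h.1.1]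
  · rw [tracelessPart_pull hC, sq_pull hC, tr_pull hC]; exact h.1.2
  · rw [dotProduct_pull_mulVec] at hx ⊢
    exact h.2 _ hx

theorem AlgebraicAt.of_pull {C g K : Mat4} (hC : IsUnit C.det)
    (h : AlgebraicAt (Rainich.pull C g) (Rainich.pull C K)) : AlgebraicAt g K := by
  have hC' : IsUnit (C⁻¹).det := by rw [Matrix.det_nonsing_inv]; simpa using hC
  have := h.pull hC'
  rwa [pull_pull, pull_pull, Matrix.mul_nonsing_inv _ hC, pull_one, pull_one] at this

theorem tr_sub (g A B : Mat4) : tr g (A - B) = tr g A - tr g B := by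
  simp [tr, mul_sub]

theorem tr_add (g A B : Mat4) : tr g (A + B) = tr g A + tr g B := by
  simp [tr, mul_add]

theorem tr_smul (g A : Mat4) (c : ℝ) : tr g (c • A) = c * tr g A := by
  simp [tr]

theorem tr_self {g : Mat4} (hg : IsUnit g.det) : tr g g = 4 := by
  simp [tr, Matrix.nonsing_inv_mul _ hg]

theorem tr_tracelessPart {g : Mat4} (hg : IsUnit g.det) (K : Mat4) :
    tr g (tracelessPart g K) = 0 := by
  rw [tracelessPart, tr_sub, tr_smul, tr_self hg]; ring

/-- `4 tr P² = 4 tr K² - (tr K)²`. -/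
theorem tr_sq_tracelessPart {g : Mat4} (hg : IsUnit g.det) (K : Mat4) :
    4 * tr g (sq g (tracelessPart g K)) = 4 * tr g (sq g K) - tr g K ^ 2 := by
  have e : sq g (tracelessPart g K) = sq g K - (tr g K / 4) • K - (tr g K / 4) • K
      + (tr g K / 4) ^ 2 • g := by
    simp only [sq, cross, tracelessPart, sub_mul, mul_sub, Matrix.smul_mul, Matrix.mul_smul,
      Matrix.mul_assoc, Matrix.nonsing_inv_mul _ hg, mul_one, smul_smul]
    rw [← Matrix.mul_assoc g, Matrix.mul_nonsing_inv _ hg, one_mul, pow_two]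
    abel
  rw [e, tr_add, tr_sub, tr_sub, tr_smul, tr_smul, tr_self hg]; ring

/-- A symmetric traceless `P` with `P² = q² g` and `P(e₀, e₀) < q` is diagonal in an orthonormal
frame: with one index raised, its `q`-eigenspace is a timelike plane, and its `-q`-eigenspace is the
orthogonal spacelike plane. -/
theorem exists_frame_diagonal {P : Mat4} {q : ℝ} (hq : 0 < q) (hP : Pᵀ = P)
    (htr : tr mink P = 0) (hsq : sq mink P = q ^ 2 • mink) (h00 : P 0 0 < q) :
    ∃ L, pull L mink = mink ∧ pull L P = Matrix.diagonal ![-q, q, -q, -q] := by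
  have hPN : P * mink * P = q ^ 2 • mink := by rw [← hsq, sq, cross, mink_inv]
  have hs : ∀ i j, P j i = P i j := fun i j => congrFun (congrFun hP i) j
  have hPij : ∀ i j, -(P i 0 * P 0 j) + P i 1 * P 1 j + P i 2 * P 2 j + P i 3 * P 3 j =
      q ^ 2 * mink i j := fun i j => by
    rw [← cross_mink_apply, ← sq, hsq]; rfl
  -- `x = e₀ + q⁻¹ P(e₀)` lies in the `q`-eigenspace and is timelike, with `g(x, x) = -s`
  set x : Fin 4 → ℝ := ![1 - P 0 0 / q, P 1 0 / q, P 2 0 / q, P 3 0 / q] with hx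
  set s : ℝ := 2 - 2 * P 0 0 / q with hsdef
  have hs0 : 0 < s := by
    have : P 0 0 / q < 1 := (div_lt_one hq).2 h00
    rw [hsdef, mul_div_assoc]; linarith
  have hxs : x 0 ^ 2 = s + x 1 ^ 2 + x 2 ^ 2 + x 3 ^ 2 := by
    have := hPij 0 0
    simp [mink] at this
    rw [hs 1 0, hs 2 0, hs 3 0] at this
    simp [hx, hsdef]
    field_simp
    linarith
  have hx0 : 0 < x 0 := by
    have : P 0 0 / q < 1 := (div_lt_one hq).2 h00
    simp [hx]; linarith
  have hPx : ∀ i, P i 0 * x 0 + P i 1 * x 1 + P i 2 * x 2 + P i 3 * x 3 =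
      q * (mink i i * x i) := by
    intro i
    have := hPij i 0
    simp only [hx]
    fin_cases i <;> simp [mink] at this ⊢ <;> field_simp <;> linarith
  have hsq0 : 0 < √s := Real.sqrt_pos.2 hs0
  set f : Fin 4 → ℝ := fun i => x i / √s with hf
  have hf0 : 0 < f 0 := div_pos hx0 hsq0
  have hff : f 0 ^ 2 = 1 + f 1 ^ 2 + f 2 ^ 2 + f 3 ^ 2 := by
    simp only [hf, div_pow, Real.sq_sqrt hs0.le]
    field_simp; linarith
  have hPf : ∀ i, P i 0 * f 0 + P i 1 * f 1 + P i 2 * f 2 + P i 3 * f 3 =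
      q * (mink i i * f i) := by
    intro i
    simp only [hf]
    have := hPx i
    field_simp; linarith
  -- a boost moves `e₀` to `x / √s`; then `P` splits into a time and a space part
  have hB := pull_boost hf0 hff
  set B := boost f with hBdef
  have hBd := isUnit_det_frame hB
  set T := pull B P with hT
  have hTt : Tᵀ = T := by rw [hT, pull_transpose, hP]
  have hT0 : ∀ i, T i 0 = q * mink i 0 := by
    intro i
    rw [← hB, hT, pull_apply, pull_apply, Finset.mul_sum]
    refine Finset.sum_congr rfl fun a _ => ?_
    have e1 : ∑ b, B a i * P a b * B b 0 = B a i * (q * (mink a a * f a)) := by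
      rw [← hPf a]
      have hb : ∀ b, B b 0 = f b := by intro b; fin_cases b <;> simp [hBdef, boost]
      simp only [hb, Fin.sum_univ_four]; ring
    have e2 : ∑ b, B a i * mink a b * B b 0 = B a i * (mink a a * f a) := by
      have hb : ∀ b, B b 0 = f b := by intro b; fin_cases b <;> simp [hBdef, boost]
      simp only [hb, Fin.sum_univ_four]
      fin_cases a <;> simp [mink]
    rw [e1, e2]; ring
  have hTs : ∀ i j, T j i = T i j := fun i j => congrFun (congrFun hTt i) j
  have hTsq : sq mink T = q ^ 2 • mink := by
    conv_lhs => rw [← hB, hT]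
    rw [sq_pull hBd, hsq, pull_smul, hB]
  have hTtr : tr mink T = 0 := by
    conv_lhs => rw [← hB, hT]
    rw [tr_pull hBd, htr]
  have t00 : T 0 0 = -q := by rw [hT0]; simp [mink]
  have t10 : T 1 0 = 0 := by rw [hT0]; simp [mink]
  have t20 : T 2 0 = 0 := by rw [hT0]; simp [mink]
  have t30 : T 3 0 = 0 := by rw [hT0]; simp [mink]
  have t01 : T 0 1 = 0 := by rw [hTs, t10]
  have t02 : T 0 2 = 0 := by rw [hTs, t20]
  have t03 : T 0 3 = 0 := by rw [hTs, t30]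
  set S : Matrix (Fin 3) (Fin 3) ℝ := Matrix.of fun i j => T i.succ j.succ with hSdef
  have hTij : ∀ i j, -(T i 0 * T 0 j) + T i 1 * T 1 j + T i 2 * T 2 j + T i 3 * T 3 j =
      q ^ 2 * mink i j := fun i j => by
    rw [← cross_mink_apply, ← sq, hTsq]; rfl
  obtain ⟨R, hR, hRS⟩ := exists_orthogonal_diagonal (S := S) hq
    (by ext i j; simp [hSdef, hTs])
    (by
      ext i j
      have := hTij i.succ j.succ
      have h0 : T i.succ 0 = 0 := by
        rw [hT0]; simp [mink]
      rw [h0] at this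
      simp only [Matrix.mul_apply, Fin.sum_univ_three, hSdef, Matrix.of_apply, Matrix.smul_apply,
        smul_eq_mul]
      rw [show mink i.succ j.succ = (1 : Matrix (Fin 3) (Fin 3) ℝ) i j by
        fin_cases i <;> fin_cases j <;> simp [mink]] at this
      rw [← this]; simp)
    (by
      rw [tr_mink, t00] at hTtr
      simp [Matrix.trace, Fin.sum_univ_three, hSdef]
      linarith)
  refine ⟨B * rot R, ?_, ?_⟩
  · rw [← pull_pull, hB]
    have := pull_rot R mink 1 (by ext i j; fin_cases i <;> fin_cases j <;> simp [mink])
      (a := 1) (b := 1) (c := 1) (by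
        rw [Matrix.mul_one, hR]; ext i j; fin_cases i <;> fin_cases j <;> simp)
    rw [this]; simp [mink]
  · rw [← pull_pull, ← hT]
    have := pull_rot R T S (by
      ext i j
      fin_cases i <;> fin_cases j <;> simp [hSdef, t01, t02, t03, t10, t20, t30] ) hRS
    rw [this, t00]

/-- A `K` that satisfies the algebraic conditions and `(tr K)² ≤ 2 tr K²` has, in an orthonormal
frame, the diagonal form of the square of a 2-form. The sign condition on timelike vectors gives
`0 < l1`, the inequality gives `0 ≤ l2`. -/
theorem exists_canonical_frame {g K : Mat4} (hg : ∃ L, pull L g = mink) (hK : Kᵀ = K)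
    (halg : AlgebraicAt g K) (hidx : tr g K ^ 2 ≤ 2 * tr g (sq g K)) :
    ∃ (L : Mat4) (l1 l2 : ℝ), pull L g = mink ∧
      pull L K = Matrix.diagonal ![-l1, l1, -l2, -l2] ∧ 0 < l1 ∧ 0 ≤ l2 := by
  obtain ⟨L₀, hL₀⟩ := hg
  have hu := isUnit_det_frame hL₀
  set k := pull L₀ K with hk
  have halg' : AlgebraicAt mink k := by rw [← hL₀]; exact halg.pull hu
  have hidx' : tr mink k ^ 2 ≤ 2 * tr mink (sq mink k) := by
    rw [← hL₀, hk, sq_pull hu, tr_pull hu, tr_pull hu]; exact hidx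
  have hkt : kᵀ = k := by rw [hk, pull_transpose, hK]
  set P := tracelessPart mink k with hP
  have hb := tr_sq_tracelessPart isUnit_det_mink k
  rw [← hP] at hb
  set t := tr mink (sq mink P) with ht
  have htpos : 0 < t := lt_of_le_of_ne (by nlinarith [sq_nonneg (tr mink k)]) halg'.1.2.symm
  set q := √(t / 4) with hqdef
  have hq : 0 < q := Real.sqrt_pos.2 (by linarith)
  have hq2 : q ^ 2 = t / 4 := Real.sq_sqrt (by linarith)
  -- this is where `(tr K)² ≤ 2 tr K²` enters
  have haq : |tr mink k / 4| ≤ q := by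
    refine abs_le_of_sq_le_sq ?_ hq.le
    nlinarith
  rw [abs_le] at haq
  have hkP : k = P + (tr mink k / 4) • mink := by simp [hP, tracelessPart]
  have hneg : ∀ {L : Mat4}, pull L mink = mink → pull L k 0 0 < 0 := by
    intro L hL
    have h1 := (halg'.pull (isUnit_det_frame hL)).2 (Pi.single 0 1)
    rw [hL] at h1
    simpa [mink] using h1 (by simp [mink])
  obtain ⟨L, hL, hLP⟩ := exists_frame_diagonal (P := P) hq
    (by rw [hP, tracelessPart_transpose mink_transpose hkt])
    (tr_tracelessPart isUnit_det_mink k)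
    (by
      have := halg'.1.1
      rw [← hP, ← ht] at this
      rw [hq2, div_eq_mul_inv, mul_comm, ← smul_smul, ← this, smul_smul]; norm_num)
    (by
      have h1 := hneg (L := 1) (pull_one _)
      rw [pull_one] at h1
      have h2 := congrFun (congrFun hkP 0) 0
      rw [Matrix.add_apply, Matrix.smul_apply, show mink 0 0 = -1 by simp [mink]] at h2
      simp only [smul_eq_mul] at h2
      linarith [haq.2])
  have hLk : pull L k = Matrix.diagonal ![-(q + tr mink k / 4), q + tr mink k / 4,
      -(q - tr mink k / 4), -(q - tr mink k / 4)] := by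
    rw [hkP, pull_add, pull_smul, hL, hLP, ← hkP]
    ext i j
    fin_cases i <;> fin_cases j <;> simp [mink] <;> ring
  refine ⟨L₀ * L, _, _, by rw [← pull_pull, hL₀, hL], by rw [← pull_pull, ← hk, hLk], ?_, ?_⟩
  · have := hneg hL
    rw [hLk] at this
    simp at this; linarith
  · linarith

theorem tr_canonical {K : Mat4} {l1 l2 : ℝ} (hK : K = Matrix.diagonal ![-l1, l1, -l2, -l2]) :
    tr mink K = 2 * (l1 - l2) := by
  rw [tr_mink, hK]; simp; ring

theorem tr_sq_canonical {K : Mat4} {l1 l2 : ℝ} (hK : K = Matrix.diagonal ![-l1, l1, -l2, -l2]) :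
    tr mink (sq mink K) = 2 * (l1 ^ 2 + l2 ^ 2) := by
  rw [tr_mink, sq]; simp only [cross_mink_apply, hK]; simp; ring

/-- The 2-form `x e⁰ ∧ e¹ + y e² ∧ e³`. -/
def canForm (x y : ℝ) : Mat4 :=
  Matrix.of ![![0, x, 0, 0], ![-x, 0, 0, 0], ![0, 0, 0, y], ![0, 0, -y, 0]]

theorem sq_canForm (x y : ℝ) :
    sq mink (canForm x y) = Matrix.diagonal ![-x ^ 2, x ^ 2, -y ^ 2, -y ^ 2] := by
  ext i j
  rw [sq, cross_mink_apply]
  fin_cases i <;> fin_cases j <;> simp [canForm] <;> ring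

/-- A 2-form commutes with its square, hence it preserves the two blades of the latter. -/
theorem eq_canForm_of_sq_eq {A : Mat4} {l1 l2 : ℝ} (hA : Aᵀ = -A)
    (h : sq mink A = Matrix.diagonal ![-l1, l1, -l2, -l2]) (h12 : l1 + l2 ≠ 0) :
    A = canForm (A 0 1) (A 2 3) ∧ A 0 1 ^ 2 = l1 ∧ A 2 3 ^ 2 = l2 := by
  have hs : ∀ i j, A j i = -A i j := fun i j => congrFun (congrFun hA i) j
  have hd : ∀ i, A i i = 0 := fun i => by linarith [hs i i]
  have hcomm : cross mink A (sq mink A) = cross mink (sq mink A) A := by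
    simp only [sq, cross, Matrix.mul_assoc]
  rw [h] at hcomm
  have hc : ∀ i j, _ = _ := fun i j => congrFun (congrFun hcomm i) j
  simp only [cross_mink_apply] at hc
  have c02 := hc 0 2; have c03 := hc 0 3; have c12 := hc 1 2; have c13 := hc 1 3
  simp at c02 c03 c12 c13
  have z02 : A 0 2 = 0 := (mul_eq_zero.1 (show (l1 + l2) * A 0 2 = 0 by linarith)).resolve_left h12
  have z03 : A 0 3 = 0 := (mul_eq_zero.1 (show (l1 + l2) * A 0 3 = 0 by linarith)).resolve_left h12
  have z12 : A 1 2 = 0 := (mul_eq_zero.1 (show (l1 + l2) * A 1 2 = 0 by linarith)).resolve_left h12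
  have z13 : A 1 3 = 0 := (mul_eq_zero.1 (show (l1 + l2) * A 1 3 = 0 by linarith)).resolve_left h12
  refine ⟨?_, ?_, ?_⟩
  · ext i j
    fin_cases i <;> fin_cases j <;>
      simp [canForm, hd, z02, z03, z12, z13, hs 0 1, hs 0 2, hs 0 3, hs 1 2, hs 1 3, hs 2 3]
  · have := congrFun (congrFun h 0) 0
    rw [sq, cross_mink_apply] at this
    simp [hd, z02, z03, hs 0 1] at this
    linarith
  · have := congrFun (congrFun h 2) 2
    rw [sq, cross_mink_apply] at this
    simp [hd, z02, z12, hs 0 2, hs 1 2, hs 2 3] at this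
    linarith

/-! ### 2-forms in an orthonormal frame -/

/-- The Levi-Civita symbol, as a Vandermonde determinant; `12` is its value at `(0, 1, 2, 3)`. -/
def leviCivita : Ten4 := fun i j k l =>
  (((j : ℕ) : ℝ) - (i : ℕ)) * ((k : ℕ) - (i : ℕ)) * ((l : ℕ) - (i : ℕ)) * ((k : ℕ) - (j : ℕ)) *
    ((l : ℕ) - (j : ℕ)) * ((l : ℕ) - (k : ℕ)) / 12

/-- The 4-form with component `o` on the frame. -/
def frameVol (o : ℝ) : Ten4 := fun i j k l => o * leviCivita i j k l

theorem leviCivita_perm (σ : Equiv.Perm (Fin 4)) :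
    leviCivita (σ 0) (σ 1) (σ 2) (σ 3) = Equiv.Perm.sign σ := by
  have h := Matrix.det_vandermonde (fun i : Fin 4 => ((σ i : ℕ) : ℝ))
  have h0 := Matrix.det_vandermonde (fun i : Fin 4 => ((i : ℕ) : ℝ))
  have e : Matrix.vandermonde (fun i : Fin 4 => ((σ i : ℕ) : ℝ)) =
      (Matrix.vandermonde (fun i : Fin 4 => ((i : ℕ) : ℝ))).submatrix σ id := rfl
  rw [e, Matrix.det_permute, h0] at h
  have i0 : Finset.Ioi (0 : Fin 4) = {1, 2, 3} := by decide
  have i1 : Finset.Ioi (1 : Fin 4) = {2, 3} := by decide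
  have i2 : Finset.Ioi (2 : Fin 4) = {3} := by decide
  have i3 : Finset.Ioi (3 : Fin 4) = ∅ := by decide
  simp [Fin.prod_univ_four, i0, i1, i2, i3] at h
  rw [leviCivita]
  norm_num at h
  rw [eq_comm, eq_div_iff (by norm_num)]
  linarith

/-- A 4-form is determined by its value on a frame. -/
theorem eq_frameVol {V : Type*} [AddCommGroup V] [Module ℝ V] (φ : V [⋀^Fin 4]→ₗ[ℝ] ℝ)
    (v : Fin 4 → V) (i j k l : Fin 4) :
    φ ![v i, v j, v k, v l] = frameVol (φ v) i j k l := by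
  have e : ![v i, v j, v k, v l] = v ∘ ![i, j, k, l] := by
    ext m; fin_cases m <;> rfl
  rw [e]
  by_cases hinj : Function.Injective ![i, j, k, l]
  · have hb : Function.Bijective ![i, j, k, l] := Finite.injective_iff_bijective.1 hinj
    set σ : Equiv.Perm (Fin 4) := Equiv.ofBijective _ hb with hσ
    have := φ.map_perm v σ
    rw [show v ∘ ![i, j, k, l] = v ∘ σ from rfl, this, frameVol]
    have h2 := leviCivita_perm σ
    have h3 : leviCivita (σ 0) (σ 1) (σ 2) (σ 3) = leviCivita i j k l := rfl
    rw [← h3, h2, Units.smul_def, zsmul_eq_mul, mul_comm]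
  · rw [Function.Injective] at hinj
    push Not at hinj
    obtain ⟨a, b, hab, hne⟩ := hinj
    rw [φ.map_eq_zero_of_eq (v ∘ ![i, j, k, l]) (congrArg v hab) hne, frameVol]
    have : leviCivita i j k l = 0 := by
      rw [leviCivita]
      fin_cases a <;> fin_cases b <;> simp at hab hne <;> simp [hab]
    rw [this, mul_zero]

theorem raise_mink_apply (A : Mat4) (i j : Fin 4) :
    raise mink A i j = mink i i * A i j * mink j j := by
  rw [raise, mink_inv, mink, Matrix.mul_diagonal, Matrix.diagonal_mul]
  simp

theorem hodge_mink (o : ℝ) {A : Mat4} (hA : Aᵀ = -A) :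
    hodge mink (frameVol o) A = o • Matrix.of ![![0, A 2 3, -A 1 3, A 1 2],
      ![-A 2 3, 0, -A 0 3, A 0 2], ![A 1 3, A 0 3, 0, -A 0 1], ![-A 1 2, -A 0 2, A 0 1, 0]] := by
  have hs : ∀ i j, A j i = -A i j := fun i j => congrFun (congrFun hA i) j
  have hd : ∀ i, A i i = 0 := fun i => by linarith [hs i i]
  ext i j
  simp only [hodge, Matrix.of_apply, raise_mink_apply, Fin.sum_univ_four, frameVol, leviCivita,
    hd, hs 0 1, hs 0 2, hs 0 3, hs 1 2, hs 1 3, hs 2 3]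
  fin_cases i <;> fin_cases j <;> simp [mink] <;> ring

theorem canForm_transpose (x y : ℝ) : (canForm x y)ᵀ = -canForm x y := by
  ext i j
  fin_cases i <;> fin_cases j <;> simp [canForm]

theorem hodge_canForm (o x y : ℝ) :
    hodge mink (frameVol o) (canForm x y) = canForm (o * y) (-(o * x)) := by
  rw [hodge_mink o (canForm_transpose x y)]
  ext i j
  fin_cases i <;> fin_cases j <;> simp [canForm]

theorem smul_canForm (c x y : ℝ) : c • canForm x y = canForm (c * x) (c * y) := by
  ext i j
  fin_cases i <;> fin_cases j <;> simp [canForm]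

theorem canForm_add (x y x' y' : ℝ) : canForm x y + canForm x' y' = canForm (x + x') (y + y') := by
  ext i j
  fin_cases i <;> fin_cases j <;> simp [canForm] <;> ring

theorem tr_sq_canForm (x y : ℝ) : tr mink (sq mink (canForm x y)) = 2 * (x ^ 2 - y ^ 2) := by
  rw [sq_canForm, tr_mink]; simp; ring

theorem tr_cross_canForm (x y x' y' : ℝ) :
    tr mink (cross mink (canForm x y) (canForm x' y')) = 2 * (x * x' - y * y') := by
  rw [tr_mink]; simp only [cross_mink_apply]; simp [canForm]; ring

theorem tr_cross_hodge_canForm (o x y : ℝ) :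
    tr mink (cross mink (canForm x y) (hodge mink (frameVol o) (canForm x y))) =
      4 * (o * (x * y)) := by
  rw [hodge_canForm, tr_cross_canForm]; ring

/-- The range of validity of the Rainich index, at a point. -/
def IndexDefinedAt (g K : Mat4) : Prop :=
  tr g K ^ 2 < 2 * tr g (sq g K) ∨ tr g K ^ 2 = 2 * tr g (sq g K) ∧ 0 < tr g K

theorem IndexDefinedAt.le {g K : Mat4} (h : IndexDefinedAt g K) :
    tr g K ^ 2 ≤ 2 * tr g (sq g K) := h.elim le_of_lt fun h => h.1.le

/-- A timelike vector is proportional to the first vector of an orthonormal frame. -/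
theorem exists_boost {x : Fin 4 → ℝ} (hx : x ⬝ᵥ mink *ᵥ x < 0) :
    ∃ (L : Mat4) (s : ℝ), pull L mink = mink ∧ s ≠ 0 ∧ x = L *ᵥ Pi.single 0 s := by
  have h1 : x ⬝ᵥ mink *ᵥ x = -x 0 ^ 2 + x 1 ^ 2 + x 2 ^ 2 + x 3 ^ 2 := by
    simp [mink, Matrix.mulVec_diagonal, dotProduct, Fin.sum_univ_four]; ring
  have h0 : x 0 ≠ 0 := by
    intro h; rw [h1, h] at hx; nlinarith [sq_nonneg (x 1), sq_nonneg (x 2), sq_nonneg (x 3)]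
  obtain ⟨s, hs, hs2⟩ : ∃ s : ℝ, 0 < x 0 / s ∧ s ^ 2 = -(x ⬝ᵥ mink *ᵥ x) := by
    have hp : 0 < √(-(x ⬝ᵥ mink *ᵥ x)) := Real.sqrt_pos.2 (by linarith)
    have hp2 : √(-(x ⬝ᵥ mink *ᵥ x)) ^ 2 = -(x ⬝ᵥ mink *ᵥ x) := Real.sq_sqrt (by linarith)
    rcases lt_or_gt_of_ne h0 with h | h
    · exact ⟨-√(-(x ⬝ᵥ mink *ᵥ x)), div_pos_of_neg_of_neg h (by linarith), by rw [neg_sq, hp2]⟩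
    · exact ⟨√(-(x ⬝ᵥ mink *ᵥ x)), div_pos h hp, hp2⟩
  have hs0 : s ≠ 0 := by rintro rfl; simp at hs
  refine ⟨boost fun i => x i / s, s, pull_boost hs ?_, hs0, ?_⟩
  · field_simp; linarith
  · ext i
    fin_cases i <;> simp [boost, hs0]

/-- The square of a 2-form satisfies the algebraic conditions, provided that the Rainich index
makes sense. -/
theorem algebraicAt_sq {g A : Mat4} (hg : ∃ L, pull L g = mink) (hA : Aᵀ = -A)
    (hidx : IndexDefinedAt g (sq g A)) : AlgebraicAt g (sq g A) := by
  obtain ⟨L, hL⟩ := hg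
  have hu := isUnit_det_frame hL
  refine AlgebraicAt.of_pull hu ?_
  have hidx' : IndexDefinedAt mink (sq mink (pull L A)) := by
    rw [← hL]; simp only [IndexDefinedAt, sq_pull hu, tr_pull hu]; exact hidx
  rw [← sq_pull hu, hL]
  have hA' : (pull L A)ᵀ = -pull L A := by rw [pull_transpose, hA, pull_neg]
  generalize pull L A = B at hidx' hA'
  have hne : tr mink (sq mink (tracelessPart mink (sq mink B))) ≠ 0 := by
    have hb := tr_sq_tracelessPart isUnit_det_mink (sq mink B)
    rcases hidx' with h | h
    · nlinarith [sq_nonneg (tr mink (sq mink B))]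
    · nlinarith [mul_pos h.2 h.2]
  refine ⟨⟨?_, hne⟩, fun x hx => ?_⟩
  -- `4 P² = (tr P²) g` is a polynomial identity in the components of the 2-form
  · have hs : ∀ i j, B j i = -B i j := fun i j => congrFun (congrFun hA' i) j
    have hd : ∀ i, B i i = 0 := fun i => by linarith [hs i i]
    have hP : ∀ i j, tracelessPart mink (sq mink B) i j = sq mink B i j -
        (-sq mink B 0 0 + sq mink B 1 1 + sq mink B 2 2 + sq mink B 3 3) / 4 * mink i j :=
      fun i j => by rw [tracelessPart, tr_mink]; rfl
    generalize tracelessPart mink (sq mink B) = P at hP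
    rw [tr_mink]
    ext i j
    rw [Matrix.smul_apply, Matrix.smul_apply]
    simp only [sq, cross_mink_apply, hP]
    fin_cases i <;> fin_cases j <;>
      simp [mink, hd, hs 0 1, hs 0 2, hs 0 3, hs 1 2, hs 1 3, hs 2 3] <;> ring
  -- in a frame with `x` along `e₀`, `A²(e₀, e₀)` is minus the square of the electric part of `A`
  · obtain ⟨M, s, hM, hs0, rfl⟩ := exists_boost hx
    rw [← dotProduct_pull_mulVec] at hx ⊢
    have hMu := isUnit_det_frame hM
    have hidx2 : IndexDefinedAt mink (sq mink (pull M B)) := by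
      rw [← hM]; simp only [IndexDefinedAt, sq_pull hMu, tr_pull hMu]; exact hidx'
    rw [← sq_pull hMu, hM]
    have hA2 : (pull M B)ᵀ = -pull M B := by rw [pull_transpose, hA', pull_neg]
    generalize pull M B = A at hidx2 hA2
    have hs : ∀ i j, A j i = -A i j := fun i j => congrFun (congrFun hA2 i) j
    have hd : ∀ i, A i i = 0 := fun i => by linarith [hs i i]
    have h00 : sq mink A 0 0 = -(A 0 1 ^ 2 + A 0 2 ^ 2 + A 0 3 ^ 2) := by
      rw [sq, cross_mink_apply, hd, hs 0 1, hs 0 2, hs 0 3]; ring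
    have hpos : 0 < A 0 1 ^ 2 + A 0 2 ^ 2 + A 0 3 ^ 2 := by
      -- a purely magnetic `A` has `2 tr A⁴ = (tr A²)²` and `tr A² ≤ 0`
      by_contra hcon
      have z1 : A 0 1 = 0 := by
        nlinarith [sq_nonneg (A 0 1), sq_nonneg (A 0 2), sq_nonneg (A 0 3)]
      have z2 : A 0 2 = 0 := by
        nlinarith [sq_nonneg (A 0 1), sq_nonneg (A 0 2), sq_nonneg (A 0 3)]
      have z3 : A 0 3 = 0 := by
        nlinarith [sq_nonneg (A 0 1), sq_nonneg (A 0 2), sq_nonneg (A 0 3)]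
      have ha : tr mink (sq mink A) = -2 * (A 1 2 ^ 2 + A 1 3 ^ 2 + A 2 3 ^ 2) := by
        rw [tr_mink, sq]
        simp only [cross_mink_apply, hd, hs 0 1, hs 0 2, hs 0 3, hs 1 2, hs 1 3, hs 2 3,
          z1, z2, z3]
        ring
      have hb : 2 * tr mink (sq mink (sq mink A)) = tr mink (sq mink A) ^ 2 := by
        rw [ha, tr_mink, sq, sq]
        simp only [cross_mink_apply, hd, hs 0 1, hs 0 2, hs 0 3, hs 1 2, hs 1 3, hs 2 3,
          z1, z2, z3]
        ring
      rcases hidx2 with h | h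
      · linarith
      · nlinarith [sq_nonneg (A 1 2), sq_nonneg (A 1 3), sq_nonneg (A 2 3)]
    simp only [Matrix.mulVec_single, single_dotProduct]
    simp [h00]
    have : 0 < s ^ 2 := by positivity
    nlinarith [mul_pos this hpos]

/-! ### The form `A` in a canonical frame -/

theorem tracelessPart_canonical {K : Mat4} {l1 l2 : ℝ}
    (hK : K = Matrix.diagonal ![-l1, l1, -l2, -l2]) : tracelessPart mink K =
    Matrix.diagonal ![-((l1 + l2) / 2), (l1 + l2) / 2, -((l1 + l2) / 2), -((l1 + l2) / 2)] := by
  rw [tracelessPart, tr_canonical hK, hK]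
  ext i j
  fin_cases i <;> fin_cases j <;> simp [mink] <;> ring

/-- For a `T` with blades `e₀ ∧ e₁` and `e₂ ∧ e₃`, the endomorphism `Q` is `-2r` times the
projection to the timelike blade. -/
theorem act_Qten_canonical {T X : Mat4} {r : ℝ} (hr : 0 < r)
    (hT : T = Matrix.diagonal ![r / 2, -(r / 2), r / 2, r / 2]) (hX : Xᵀ = -X) :
    act mink (Qten mink T) X = canForm (-2 * r * X 0 1) 0 := by
  have hs : ∀ i j, X j i = -X i j := fun i j => congrFun (congrFun hX i) j
  have hd : ∀ i, X i i = 0 := fun i => by linarith [hs i i]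
  -- `T ∧ g` has the eigenvalues `-r` on `e⁰ ∧ e¹`, `r` on `e² ∧ e³` and `0` on the mixed 2-forms
  have hJ : ∀ {Y : Mat4}, Yᵀ = -Y → jordan mink T Y = canForm (-r * Y 0 1) (r * Y 2 3) := by
    intro Y hY
    have hs : ∀ i j, Y j i = -Y i j := fun i j => congrFun (congrFun hY i) j
    have hd : ∀ i, Y i i = 0 := fun i => by linarith [hs i i]
    ext i j
    rw [jordan, Matrix.add_apply, cross_mink_apply, cross_mink_apply, hT]
    fin_cases i <;> fin_cases j <;>
      simp [canForm, hd, hs 0 1, hs 0 2, hs 0 3, hs 1 2, hs 1 3, hs 2 3] <;> ring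
  have ht : tr mink (sq mink T) = r ^ 2 := by
    rw [tr_mink, sq]; simp only [cross_mink_apply, hT]; simp; ring
  rw [act_Qten mink_transpose isUnit_det_mink (by rw [hT]; simp) hX, hJ hX,
    hJ (canForm_transpose _ _), ht, Real.sqrt_sq hr.le]
  ext i j
  have := hr.ne'
  fin_cases i <;> fin_cases j <;> simp [canForm] <;> field_simp <;> ring

theorem Qform_canonical {T X : Mat4} {r : ℝ} (hr : 0 < r)
    (hT : T = Matrix.diagonal ![r / 2, -(r / 2), r / 2, r / 2]) (hX : Xᵀ = -X) :
    Qform mink T X = 2 * r * X 0 1 ^ 2 := by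
  have hs : ∀ i j, X j i = -X i j := fun i j => congrFun (congrFun hX i) j
  rw [Qform_eq mink_transpose hX, act_Qten_canonical hr hT hX, tr_mink]
  simp only [cross_mink_apply]
  simp [canForm, hs 0 1]; ring

/-- `F°[T]` is a simple 2-form along the timelike blade, with square `r`. -/
theorem Fzero_canonical {T X : Mat4} {r : ℝ} (hr : 0 < r)
    (hT : T = Matrix.diagonal ![r / 2, -(r / 2), r / 2, r / 2]) (hX : Xᵀ = -X)
    (hQ : Qform mink T X ≠ 0) : ∃ f, Fzero mink T X = canForm f 0 ∧ f ^ 2 = r := by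
  rw [Qform_canonical hr hT hX] at hQ
  have hx : X 0 1 ≠ 0 := by rintro h; simp [h] at hQ
  refine ⟨(√(2 * (2 * r * X 0 1 ^ 2)))⁻¹ * (-2 * r * X 0 1), ?_, ?_⟩
  · rw [Fzero, Qform_canonical hr hT hX, act_Qten_canonical hr hT hX, smul_canForm, mul_zero]
  · rw [mul_pow, inv_pow, Real.sq_sqrt (by positivity)]
    field_simp

/-- The Rainich index is the angle `ψ` with `tan ψ = √(l2 / l1)`; the value at `l2 = 0` rests on
`0 / 0 = 0` in the definition of the index. -/
theorem rainichIndex_canonical {K : Mat4} {l1 l2 : ℝ}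
    (hK : K = Matrix.diagonal ![-l1, l1, -l2, -l2]) (h1 : 0 < l1) (h2 : 0 ≤ l2) :
    rainichIndex mink K = Real.arctan (√l2 / √l1) := by
  rw [rainichIndex]
  simp only [tr_canonical hK, tr_sq_canonical hK]
  congr 1
  rw [show 4 * (2 * (l1 ^ 2 + l2 ^ 2)) - (2 * (l1 - l2)) ^ 2 = (2 * (l1 + l2)) ^ 2 by ring,
    Real.sqrt_sq (by linarith),
    show 2 * (2 * (2 * (l1 ^ 2 + l2 ^ 2)) - (2 * (l1 - l2)) ^ 2) = 4 ^ 2 * (l1 * l2) by ring,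
    Real.sqrt_mul (by norm_num), Real.sqrt_sq (by norm_num), Real.sqrt_mul h1.le]
  rcases h2.eq_or_lt with rfl | h2
  · simp
  · have a1 := Real.sqrt_pos.2 h1
    have a2 := Real.sqrt_pos.2 h2
    have b2 := Real.sq_sqrt h2.le
    rw [div_eq_div_iff (by positivity) (by positivity)]
    linear_combination (-4) * √l1 * b2

/-- The form `A = cos ψ A° + ε sin ψ *A°` is `x e⁰ ∧ e¹ + y e² ∧ e³` with `x² = l1`, `y² = l2`,
and `ε` governs the relative sign of `x` and `y`. -/
theorem kyForm_canonical {K X : Mat4} {l1 l2 o ε : ℝ}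
    (hK : K = Matrix.diagonal ![-l1, l1, -l2, -l2]) (h1 : 0 < l1) (h2 : 0 ≤ l2)
    (ho : o ^ 2 = 1) (hε : ε ^ 2 = 1) (hX : Xᵀ = -X)
    (hQ : Qform mink (-tracelessPart mink K) X ≠ 0) :
    ∃ x y, kyForm mink (frameVol o) K ε X = canForm x y ∧ x ^ 2 = l1 ∧ y ^ 2 = l2 ∧
      x * y = -(o * ε) * √(l1 * l2) := by
  have hr : 0 < l1 + l2 := by linarith
  obtain ⟨f, hf, hf2⟩ := Fzero_canonical hr (T := -tracelessPart mink K) (by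
    rw [tracelessPart_canonical hK]; ext i j
    fin_cases i <;> fin_cases j <;> simp) hX hQ
  have e1 : 1 + (√l2 / √l1) ^ 2 = (l1 + l2) / l1 := by
    rw [div_pow, Real.sq_sqrt h1.le, Real.sq_sqrt h2]; field_simp
  have hc : Real.cos (rainichIndex mink K) = √l1 / √(l1 + l2) := by
    rw [rainichIndex_canonical hK h1 h2, Real.cos_arctan, e1, Real.sqrt_div hr.le]
    simp
  have hsn : Real.sin (rainichIndex mink K) = √l2 / √(l1 + l2) := by
    have a1 := (Real.sqrt_pos.2 h1).ne'
    rw [rainichIndex_canonical hK h1 h2, Real.sin_arctan, e1, Real.sqrt_div hr.le]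
    field_simp
  have hr2 := Real.sq_sqrt hr.le
  have hr0 := (Real.sqrt_pos.2 hr).ne'
  refine ⟨√l1 / √(l1 + l2) * f, -(o * ε) * (√l2 / √(l1 + l2) * f), ?_, ?_, ?_, ?_⟩
  · rw [kyForm, hf, hc, hsn, hodge_canForm, smul_canForm, smul_canForm, canForm_add]
    congr 1 <;> ring
  · rw [mul_pow, div_pow, Real.sq_sqrt h1.le, hr2, hf2]; field_simp
  · rw [mul_pow, neg_sq, mul_pow, ho, hε, mul_pow, div_pow, Real.sq_sqrt h2, hr2, hf2]; field_simp
  · rw [Real.sqrt_mul h1.le]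
    field_simp
    rw [hr2, hf2]

/-! ### First-order algebra -/

/-- The action of a matrix on the three indices of an array `t_{αβγ}`, stored as the family of
matrices `t α`. -/
def tmul (A : Mat4) (t : Fin 4 → Mat4) : Fin 4 → Mat4 := fun a =>
  A * (∑ α, A a α • t α) * Aᵀ

/-- The full contraction of two arrays with three indices. -/
def contract (t u : Fin 4 → Mat4) : ℝ := ∑ a, ∑ b, ∑ c, t a b c * u a b c

theorem tmul_apply (A : Mat4) (t : Fin 4 → Mat4) (a b c : Fin 4) :
    tmul A t a b c = ∑ α, ∑ β, ∑ γ, A a α * A b β * A c γ * t α β γ := by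
  rw [tmul, mul_mul_apply]
  simp only [Matrix.sum_apply, Matrix.smul_apply, smul_eq_mul, Matrix.transpose_apply,
    Finset.mul_sum, Finset.sum_mul]
  rw [Finset.sum_congr rfl fun β _ => Finset.sum_comm, Finset.sum_comm]
  refine Finset.sum_congr rfl fun α _ => Finset.sum_congr rfl fun β _ =>
    Finset.sum_congr rfl fun γ _ => by ring

theorem tmul_tmul (A B : Mat4) (t : Fin 4 → Mat4) : tmul A (tmul B t) = tmul (A * B) t := by
  funext a
  have h : ∑ α, A a α • tmul B t α = B * (∑ α, (A * B) a α • t α) * Bᵀ := by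
    have e : ∀ α, A a α • tmul B t α = B * (A a α • ∑ β, B α β • t β) * Bᵀ := by simp [tmul]
    simp only [e, ← Finset.sum_mul, ← Finset.mul_sum]
    congr 2
    simp only [Finset.smul_sum, Matrix.mul_apply, Finset.sum_smul, smul_smul]
    exact Finset.sum_comm
  rw [tmul, h, tmul, Matrix.transpose_mul]
  simp only [Matrix.mul_assoc]

theorem tmul_one (t : Fin 4 → Mat4) : tmul 1 t = t := by
  funext a
  simp [tmul, Matrix.one_apply]

theorem contract_tmul (A : Mat4) (t u : Fin 4 → Mat4) :
    contract (tmul A t) u = contract t (tmul Aᵀ u) := by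
  simp only [contract, tmul_apply, Matrix.transpose_apply, Finset.mul_sum, Finset.sum_mul]
  have h : ∀ F : Fin 4 → Fin 4 → Fin 4 → Fin 4 → Fin 4 → Fin 4 → ℝ,
      ∑ a, ∑ b, ∑ c, ∑ α, ∑ β, ∑ γ, F a b c α β γ =
        ∑ α, ∑ β, ∑ γ, ∑ a, ∑ b, ∑ c, F a b c α β γ := by
    intro F
    have := Finset.sum_comm (s := (Finset.univ : Finset (Fin 4 × Fin 4 × Fin 4)))
      (t := (Finset.univ : Finset (Fin 4 × Fin 4 × Fin 4)))
      (f := fun p q => F p.1 p.2.1 p.2.2 q.1 q.2.1 q.2.2)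
    simpa only [Fintype.sum_prod_type] using this
  rw [h]
  refine Finset.sum_congr rfl fun _ _ => Finset.sum_congr rfl fun _ _ =>
    Finset.sum_congr rfl fun _ _ => Finset.sum_congr rfl fun _ _ => Finset.sum_congr rfl fun _ _ =>
    Finset.sum_congr rfl fun _ _ => by ring

theorem sum_last_comm (F : Fin 4 → Fin 4 → Fin 4 → Fin 4 → ℝ) :
    ∑ a, ∑ b, ∑ c, ∑ δ, F a b c δ = ∑ δ, ∑ a, ∑ b, ∑ c, F a b c δ := by
  have := Finset.sum_comm (s := (Finset.univ : Finset (Fin 4 × Fin 4 × Fin 4)))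
    (t := (Finset.univ : Finset (Fin 4))) (f := fun p δ => F p.1 p.2.1 p.2.2 δ)
  simpa only [Fintype.sum_prod_type] using this

theorem contract_sum_smul (t : Fin 4 → Mat4) (c : Fin 4 → ℝ) (u : Fin 4 → Fin 4 → Mat4) :
    contract t (fun a => ∑ δ, c δ • u δ a) = ∑ δ, c δ * contract t (u δ) := by
  simp only [contract, Matrix.sum_apply, Matrix.smul_apply, smul_eq_mul, Finset.mul_sum]
  rw [sum_last_comm]
  refine Finset.sum_congr rfl fun _ _ => Finset.sum_congr rfl fun _ _ =>
    Finset.sum_congr rfl fun _ _ => Finset.sum_congr rfl fun _ _ => by ring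

/-- Skew-symmetry in the first two indices; for the covariant derivative of a 2-tensor this is the
Killing-Yano equation. -/
def SkewFirst (t : Fin 4 → Mat4) : Prop := ∀ a b c, t a b c + t b a c = 0

/-- Vanishing of the cyclic sum; for the covariant derivative of a symmetric 2-tensor this is the
Killing equation. -/
def CyclicZero (t : Fin 4 → Mat4) : Prop := ∀ a b c, t a b c + t b c a + t c a b = 0

theorem SkewFirst.tmul (A : Mat4) {t : Fin 4 → Mat4} (h : SkewFirst t) :
    SkewFirst (tmul A t) := by
  intro a b c
  rw [tmul_apply, tmul_apply]
  rw [Finset.sum_comm (f := fun α β => ∑ γ, A b α * A a β * A c γ * t α β γ)]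
  simp only [← Finset.sum_add_distrib]
  refine Finset.sum_eq_zero fun α _ => Finset.sum_eq_zero fun β _ =>
    Finset.sum_eq_zero fun γ _ => ?_
  linear_combination A a α * A b β * A c γ * h α β γ

theorem CyclicZero.tmul (A : Mat4) {t : Fin 4 → Mat4} (h : CyclicZero t) :
    CyclicZero (tmul A t) := by
  intro a b c
  have h1 : Rainich.tmul A t b c a = ∑ α, ∑ β, ∑ γ, A a α * A b β * A c γ * t β γ α := by
    rw [tmul_apply, Finset.sum_congr rfl fun α _ => Finset.sum_comm, Finset.sum_comm]
    exact Finset.sum_congr rfl fun _ _ => Finset.sum_congr rfl fun _ _ =>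
      Finset.sum_congr rfl fun _ _ => by ring
  have h2 : Rainich.tmul A t c a b = ∑ α, ∑ β, ∑ γ, A a α * A b β * A c γ * t γ α β := by
    rw [tmul_apply, Finset.sum_comm, Finset.sum_congr rfl fun α _ => Finset.sum_comm]
    exact Finset.sum_congr rfl fun _ _ => Finset.sum_congr rfl fun _ _ =>
      Finset.sum_congr rfl fun _ _ => by ring
  rw [h1, h2, tmul_apply]
  simp only [← Finset.sum_add_distrib]
  refine Finset.sum_eq_zero fun α _ => Finset.sum_eq_zero fun β _ =>
    Finset.sum_eq_zero fun γ _ => ?_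
  linear_combination A a α * A b β * A c γ * h α β γ

theorem SkewFirst.of_tmul {A : Mat4} (hA : IsUnit A.det) {t : Fin 4 → Mat4}
    (h : SkewFirst (Rainich.tmul A t)) : SkewFirst t := by
  have := h.tmul A⁻¹
  rwa [tmul_tmul, Matrix.nonsing_inv_mul _ hA, tmul_one] at this

theorem CyclicZero.of_tmul {A : Mat4} (hA : IsUnit A.det) {t : Fin 4 → Mat4}
    (h : CyclicZero (Rainich.tmul A t)) : CyclicZero t := by
  have := h.tmul A⁻¹
  rwa [tmul_tmul, Matrix.nonsing_inv_mul _ hA, tmul_one] at this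

/-- The components of a covariant array of rank three after the change of frame with matrix `C`. -/
abbrev pull3 (C : Mat4) (t : Fin 4 → Mat4) : Fin 4 → Mat4 := tmul Cᵀ t

theorem pull3_eq (C : Mat4) (t : Fin 4 → Mat4) (a : Fin 4) :
    pull3 C t a = ∑ α, C α a • pull C (t α) := by
  simp only [pull3, tmul, pull, Matrix.transpose_transpose, Finset.mul_sum, Finset.sum_mul,
    Matrix.mul_smul, Matrix.smul_mul, Matrix.transpose_apply]

/-- The Rainich 1-form, as a function of the values of `T` and `∇T` at a point. -/
def rainichFormAt (g : Mat4) (η : Ten4) (T : Mat4) (DT : Fin 4 → Mat4) (δ : Fin 4) : ℝ :=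
  (tr g (sq g T))⁻¹ *
    contract (tmul g⁻¹ fun α => cross g (DT α) T) (fun α => Matrix.of fun β γ => η α β γ δ)

theorem rainichForm_eq (G : E4 → Mat4) (η : Ten4) (T : E4 → Mat4) (y : E4) (δ : Fin 4) :
    rainichForm G η T y δ =
      rainichFormAt (G y) η (T y) (fun α => Matrix.of fun β μ => covDeriv G T y α β μ) δ := by
  rw [rainichForm, rainichFormAt]
  simp only [contract, tmul_apply, cross, mul_mul_apply, Matrix.of_apply]

/-- The Rainich 1-form transforms as a covector. -/
theorem rainichFormAt_pull {C : Mat4} (hC : IsUnit C.det) (g : Mat4) (η : Ten4) (T : Mat4)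
    (DT : Fin 4 → Mat4) (d : Fin 4) :
    rainichFormAt (pull C g) (pullVol C η) (pull C T) (pull3 C DT) d =
      ∑ δ, C δ d * rainichFormAt g η T DT δ := by
  have h1 : (fun a => cross (pull C g) (pull3 C DT a) (pull C T)) =
      pull3 C (fun α => cross g (DT α) T) := by
    funext a
    simp only [pull3_eq, ← cross_pull hC]
    simp only [cross, Finset.sum_mul, Matrix.smul_mul]
  have h2 : (fun a => Matrix.of fun b c => pullVol C η a b c d : Fin 4 → Mat4) =
      fun a => ∑ δ, C δ d • tmul Cᵀ (fun α => Matrix.of fun β γ => η α β γ δ) a := by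
    funext a
    ext b c
    simp only [Matrix.of_apply, Matrix.sum_apply, Matrix.smul_apply, tmul_apply, pullVol,
      Matrix.transpose_apply, smul_eq_mul, Finset.mul_sum]
    rw [sum_last_comm]
    refine Finset.sum_congr rfl fun _ _ => Finset.sum_congr rfl fun _ _ =>
      Finset.sum_congr rfl fun _ _ => Finset.sum_congr rfl fun _ _ => by ring
  have h3 : tmul g⁻¹ (fun α => cross g (DT α) T) =
      tmul C (tmul (pull C g)⁻¹ (pull3 C (fun α => cross g (DT α) T))) := by
    rw [tmul_tmul, tmul_tmul, mul_inv_pull_mul hC]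
  simp only [rainichFormAt, sq_pull hC, tr_pull hC]
  rw [h1, h2, contract_sum_smul, h3, Finset.mul_sum]
  refine Finset.sum_congr rfl fun δ _ => ?_
  rw [contract_tmul C]; ring

/-! ### Killing-Yano, Killing and Rainich equations in a canonical frame -/

/-- The derivative of `A ↦ A²` at `A` in the direction `B`. -/
def dsq (g A B : Mat4) : Mat4 := cross g B A + cross g A B

theorem dsq_canForm (x y : ℝ) {B : Mat4} (hB : Bᵀ = -B) :
    dsq mink (canForm x y) B = Matrix.of ![
      ![-2 * x * B 0 1, 0, x * B 1 2 - y * B 0 3, x * B 1 3 + y * B 0 2],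
      ![0, 2 * x * B 0 1, x * B 0 2 - y * B 1 3, x * B 0 3 + y * B 1 2],
      ![x * B 1 2 - y * B 0 3, x * B 0 2 - y * B 1 3, -2 * y * B 2 3, 0],
      ![x * B 1 3 + y * B 0 2, x * B 0 3 + y * B 1 2, 0, -2 * y * B 2 3]] := by
  have hs : ∀ i j, B j i = -B i j := fun i j => congrFun (congrFun hB i) j
  have hd : ∀ i, B i i = 0 := fun i => by linarith [hs i i]
  ext i j
  rw [dsq, Matrix.add_apply, cross_mink_apply, cross_mink_apply]
  fin_cases i <;> fin_cases j <;>
    simp [canForm, hd, hs 0 1, hs 0 2, hs 0 3, hs 1 2, hs 1 3, hs 2 3] <;> ring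

theorem contract_frameVol (t : Fin 4 → Mat4) (o : ℝ) (d : Fin 4) :
    contract (tmul mink t) (fun a => Matrix.of fun b c => frameVol o a b c d) =
      ∑ a, ∑ b, ∑ c, mink a a * mink b b * mink c c * t a b c * frameVol o a b c d := by
  simp only [contract, tmul_apply, Matrix.of_apply]
  refine Finset.sum_congr rfl fun a _ => Finset.sum_congr rfl fun b _ =>
    Finset.sum_congr rfl fun c _ => ?_
  congr 1
  simp [mink, Matrix.diagonal_apply, Finset.sum_ite_eq]

/-- The Rainich 1-form of `P`, up to its normalization, in terms of the mixed components of `∇K`;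
here `K = A²`. -/
theorem rainich_contract {x y o r : ℝ} {K : Mat4} (hr : r = x ^ 2 + y ^ 2)
    (hK : K = Matrix.diagonal ![-x ^ 2, x ^ 2, -y ^ 2, -y ^ 2])
    {E : Fin 4 → Mat4} (hE : ∀ a, (E a)ᵀ = E a) :
    ∀ d, contract
      (tmul mink fun a => cross mink (E a - (tr mink (E a) / 4) • mink) (tracelessPart mink K))
      (fun a => Matrix.of fun b c => frameVol o a b c d) =
      o * r * ![E 3 1 2 - E 2 1 3, E 3 0 2 - E 2 0 3, E 1 0 3 - E 0 1 3, E 0 1 2 - E 1 0 2] d := by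
  intro d
  have hs : ∀ a i j, E a j i = E a i j := fun a i j => congrFun (congrFun (hE a) i) j
  have ht : ∀ a b c, cross mink (E a - (tr mink (E a) / 4) • mink) (tracelessPart mink K) b c =
      (E a b c - (tr mink (E a) / 4) * mink b c) * ![r / 2, r / 2, -(r / 2), -(r / 2)] c := by
    intro a b c
    rw [cross_mink_apply, tracelessPart_canonical hK, ← hr]
    fin_cases c <;> simp
  rw [contract_frameVol]
  simp only [ht, Fin.sum_univ_four, frameVol, leviCivita]
  generalize tr mink (E 0) = t0
  generalize tr mink (E 1) = t1
  generalize tr mink (E 2) = t2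
  generalize tr mink (E 3) = t3
  fin_cases d <;> simp [mink] <;>
    simp only [hs _ 0 1, hs _ 0 2, hs _ 0 3, hs _ 1 2, hs _ 1 3, hs _ 2 3] <;> ring

section

variable {x y : ℝ} {D : Fin 4 → Mat4}

/-- The square of a Killing-Yano tensor is a Killing tensor; this holds in any frame, and is stated
in a canonical one. -/
theorem cyclicZero_dsq (hD : ∀ a, (D a)ᵀ = -D a) (hKY : SkewFirst D) :
    CyclicZero fun a => dsq mink (canForm x y) (D a) := by
  have hs : ∀ a i j, D a j i = -D a i j := fun a i j => congrFun (congrFun (hD a) i) j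
  have hm : ∀ a b c, D a b c = -D b a c := fun a b c => by linarith [hKY a b c]
  have hc : ∀ a b c, dsq mink (canForm x y) (D a) b c + dsq mink (canForm x y) (D b) c a +
      dsq mink (canForm x y) (D c) a b = 0 := by
    intro a b c
    have hA : ∀ i j, canForm x y j i = -canForm x y i j :=
      fun i j => congrFun (congrFun (canForm_transpose x y) i) j
    simp only [dsq, Matrix.add_apply, cross_mink_apply]
    have key : ∀ m, D a b m * canForm x y m c + canForm x y b m * D a m c +
        (D b c m * canForm x y m a + canForm x y c m * D b m a) +
        (D c a m * canForm x y m b + canForm x y a m * D c m b) = 0 := by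
      intro m
      rw [hs a c m, hs b a m, hs c b m, hA m c, hA m a, hA m b, hA b m, hA c m, hA a m, hm b a m,
        hm c b m, hm a c m]
      ring
    linear_combination (-1) * key 0 + key 1 + key 2 + key 3
  exact hc

/-- The value of the Rainich 1-form of a Killing-Yano tensor `A = x e⁰ ∧ e¹ + y e² ∧ e³` is, up to
normalization, the differential of the angle of `(x, y)`. -/
theorem rainich_value_of_skewFirst {o r : ℝ} {K : Mat4} (hr : r = x ^ 2 + y ^ 2)
    (hK : K = Matrix.diagonal ![-x ^ 2, x ^ 2, -y ^ 2, -y ^ 2])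
    (hD : ∀ a, (D a)ᵀ = -D a) (hKY : SkewFirst D) (d : Fin 4) :
    contract
      (tmul mink fun a => cross mink (dsq mink (canForm x y) (D a) -
        (tr mink (dsq mink (canForm x y) (D a)) / 4) • mink) (tracelessPart mink K))
      (fun a => Matrix.of fun b c => frameVol o a b c d) =
      2 * o * r * (x * D d 2 3 - y * D d 0 1) := by
  have hs : ∀ a i j, D a j i = -D a i j := fun a i j => congrFun (congrFun (hD a) i) j
  rw [rainich_contract hr hK fun a => by
    rw [dsq_canForm x y (hD a)]; ext i j; fin_cases i <;> fin_cases j <;> rfl]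
  simp only [dsq_canForm x y (hD _)]
  have hm : ∀ a b c, D a b c = -D b a c := fun a b c => by linarith [hKY a b c]
  have z1 : ∀ a b, D a a b = 0 := fun a b => by linarith [hKY a a b]
  have z2 : ∀ a b, D a b a = 0 := fun a b => by rw [hs a a b, z1, neg_zero]
  have hc : ∀ a b c, D a b c = D c a b := fun a b c => by
    rw [hs a c b, hm a c b, neg_neg]
  fin_cases d <;> simp [z1, z2]
  · rw [← hc 0 2 3, hm 2 0 3]; ring
  · rw [← hc 1 2 3, hm 2 1 3]; ring
  · rw [hc 2 0 1, hc 1 2 0, hm 1 0 2]; ring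
  · rw [hc 3 0 1, hc 1 3 0, hm 1 0 3]; ring

theorem eq_and_eq_of_rotation {x y a b m n : ℝ} (h : x ^ 2 + y ^ 2 ≠ 0)
    (h1 : x * a - y * b = x * m - y * n) (h2 : x * b + y * a = x * n + y * m) :
    a = m ∧ b = n := by
  constructor <;> refine mul_left_cancel₀ h ?_
  · linear_combination x * h1 + y * h2
  · linear_combination x * h2 - y * h1

/-- In a canonical frame, the Killing equation for `K = A²` and the Rainich equation imply the
Killing-Yano equation for `A`.

The Killing equation gives the vanishing of the derivatives of `x` along `e₀ ∧ e₁` and of `y` along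
`e₂ ∧ e₃`. The mixed components of `∇A` come in eight pairs; in each of them the Killing equation
and the Rainich equation determine the two components of the pair rotated by the angle of `(x, y)`.
Where `y = 0` the Killing equation says nothing on the component along `e₂ ∧ e₃`, which is why its
vanishing is assumed there. -/
theorem skewFirst_of_cyclicZero {o r : ℝ} {K : Mat4} (ho : o ≠ 0) (hr : r = x ^ 2 + y ^ 2)
    (hx : x ≠ 0)
    (hK : K = Matrix.diagonal ![-x ^ 2, x ^ 2, -y ^ 2, -y ^ 2])
    (hD : ∀ a, (D a)ᵀ = -D a) (hcyc : CyclicZero fun a => dsq mink (canForm x y) (D a))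
    (hR : ∀ d, contract
      (tmul mink fun a => cross mink (dsq mink (canForm x y) (D a) -
        (tr mink (dsq mink (canForm x y) (D a)) / 4) • mink) (tracelessPart mink K))
      (fun a => Matrix.of fun b c => frameVol o a b c d) =
      2 * o * r * (x * D d 2 3 - y * D d 0 1))
    (hy : y = 0 → ∀ d, D d 2 3 = 0) : SkewFirst D := by
  have hs : ∀ a i j, D a j i = -D a i j := fun a i j => congrFun (congrFun (hD a) i) j
  have hd : ∀ a i, D a i i = 0 := fun a i => by linarith [hs a i i]
  have hr0 : r ≠ 0 := by rw [hr]; positivity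
  have hR' := hR
  simp only [rainich_contract hr hK fun a => (by
    rw [dsq_canForm x y (hD a)]; ext i j; fin_cases i <;> fin_cases j <;> rfl :
      (dsq mink (canForm x y) (D a))ᵀ = dsq mink (canForm x y) (D a))] at hR'
  simp only [CyclicZero, dsq_canForm x y (hD _)] at hcyc hR'
  have hor : o * r ≠ 0 := mul_ne_zero ho hr0
  have R0 := hR' 0; have R1 := hR' 1; have R2 := hR' 2; have R3 := hR' 3
  have c000 := hcyc 0 0 0; have c111 := hcyc 1 1 1; have c222 := hcyc 2 2 2
  have c333 := hcyc 3 3 3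
  have c002 := hcyc 0 0 2; have c003 := hcyc 0 0 3; have c112 := hcyc 1 1 2
  have c113 := hcyc 1 1 3; have c012 := hcyc 0 1 2; have c013 := hcyc 0 1 3
  have c220 := hcyc 2 2 0; have c330 := hcyc 3 3 0; have c230 := hcyc 2 3 0
  have c221 := hcyc 2 2 1; have c331 := hcyc 3 3 1; have c231 := hcyc 2 3 1
  clear hR hR' hcyc
  simp at R0 R1 R2 R3 c000 c111 c222 c333 c002 c003 c112 c113 c012 c013 c220 c330 c230 c221 c331
  simp at c231
  have X0 : D 0 0 1 = 0 := mul_left_cancel₀ hx (by linarith)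
  have X1 : D 1 0 1 = 0 := mul_left_cancel₀ hx (by linarith)
  have Y2 : D 2 2 3 = 0 := by
    by_cases h : y = 0
    · exact hy h 2
    · exact mul_left_cancel₀ h (by linarith)
  have Y3 : D 3 2 3 = 0 := by
    by_cases h : y = 0
    · exact hy h 3
    · exact mul_left_cancel₀ h (by linarith)
  replace R0 : x * D 3 0 2 - y * D 3 1 3 - (x * D 2 0 3 + y * D 2 1 2) = 2 * (x * D 0 2 3) :=
    mul_left_cancel₀ hor (by rw [R0, X0]; ring)
  replace R1 : x * D 3 1 2 - y * D 3 0 3 - (x * D 2 1 3 + y * D 2 0 2) = 2 * (x * D 1 2 3) :=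
    mul_left_cancel₀ hor (by rw [R1, X1]; ring)
  replace R2 : x * D 1 1 3 + y * D 1 0 2 - (x * D 0 0 3 + y * D 0 1 2) = -2 * (y * D 2 0 1) :=
    mul_left_cancel₀ hor (by rw [R2, Y2]; ring)
  replace R3 : x * D 0 0 2 - y * D 0 1 3 - (x * D 1 1 2 - y * D 1 0 3) = -2 * (y * D 3 0 1) :=
    mul_left_cancel₀ hor (by rw [R3, Y3]; ring)
  rw [hr] at hr0
  obtain ⟨p0, v0⟩ := eq_and_eq_of_rotation (a := D 0 1 2) (b := D 0 0 3) (m := D 2 0 1) (n := 0)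
    hr0 (by linarith) (by linarith)
  obtain ⟨u1, q1⟩ := eq_and_eq_of_rotation (a := D 1 0 2) (b := D 1 1 3) (m := -D 2 0 1) (n := 0)
    hr0 (by linarith) (by linarith)
  obtain ⟨u0, q0⟩ := eq_and_eq_of_rotation (a := D 0 0 2) (b := D 0 1 3) (m := 0) (n := D 3 0 1)
    hr0 (by linarith) (by linarith)
  obtain ⟨p1, v1⟩ := eq_and_eq_of_rotation (a := D 1 1 2) (b := D 1 0 3) (m := 0) (n := -D 3 0 1)
    hr0 (by linarith) (by linarith)
  obtain ⟨p2, v2⟩ := eq_and_eq_of_rotation (a := D 2 1 2) (b := D 2 0 3) (m := 0) (n := -D 0 2 3)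
    hr0 (by linarith) (by linarith)
  obtain ⟨u3, q3⟩ := eq_and_eq_of_rotation (a := D 3 0 2) (b := D 3 1 3) (m := D 0 2 3) (n := 0)
    hr0 (by linarith) (by linarith)
  obtain ⟨u2, q2⟩ := eq_and_eq_of_rotation (a := D 2 0 2) (b := D 2 1 3) (m := 0) (n := -D 1 2 3)
    hr0 (by linarith) (by linarith)
  obtain ⟨p3, v3⟩ := eq_and_eq_of_rotation (a := D 3 1 2) (b := D 3 0 3) (m := D 1 2 3) (n := 0)
    hr0 (by linarith) (by linarith)
  intro a b c
  fin_cases a <;> fin_cases b <;> fin_cases c <;>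
    simp [hd, hs _ 0 1, hs _ 0 2, hs _ 0 3, hs _ 1 2, hs _ 1 3, hs _ 2 3, X0, X1, Y2, Y3, p0, p1,
      p2, p3, q0, q1, q2, q3, u0, u1, u2, u3, v0, v1, v2, v3]

end

/-! ### Calculus of matrix-valued functions of the coordinates -/

/-- All components of `F` are smooth at `y`. -/
def MatSmoothAt (F : E4 → Mat4) (y : E4) : Prop := ∀ i j, ContDiffAt ℝ ∞ (fun z => F z i j) y

/-- The partial derivatives of the components of `F`. -/
def pdMat (F : E4 → Mat4) (y : E4) (α : Fin 4) : Mat4 :=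
  Matrix.of fun i j => pd (fun z => F z i j) α y

section Smooth

variable {F H : E4 → Mat4} {y : E4} {f : E4 → ℝ}

theorem MatSmoothAt.congr (hF : MatSmoothAt F y) (h : ∀ᶠ z in 𝓝 y, H z = F z) :
    MatSmoothAt H y := fun i j =>
  (hF i j).congr_of_eventuallyEq (h.mono fun z hz => by simp only [hz])

theorem MatSmoothAt.differentiableAt (hF : MatSmoothAt F y) (i j : Fin 4) :
    DifferentiableAt ℝ (fun z => F z i j) y := (hF i j).differentiableAt (by simp)

theorem MatSmoothAt.mul (hF : MatSmoothAt F y) (hH : MatSmoothAt H y) :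
    MatSmoothAt (fun z => F z * H z) y := fun i j => by
  simp only [Matrix.mul_apply]
  exact ContDiffAt.sum fun k _ => (hF i k).mul (hH k j)

theorem MatSmoothAt.add (hF : MatSmoothAt F y) (hH : MatSmoothAt H y) :
    MatSmoothAt (fun z => F z + H z) y := fun i j => (hF i j).add (hH i j)

theorem MatSmoothAt.sub (hF : MatSmoothAt F y) (hH : MatSmoothAt H y) :
    MatSmoothAt (fun z => F z - H z) y := fun i j => (hF i j).sub (hH i j)

theorem MatSmoothAt.neg (hF : MatSmoothAt F y) : MatSmoothAt (fun z => -F z) y :=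
  fun i j => (hF i j).neg

theorem MatSmoothAt.smul (hf : ContDiffAt ℝ ∞ f y) (hF : MatSmoothAt F y) :
    MatSmoothAt (fun z => f z • F z) y := fun i j => hf.mul (hF i j)

theorem MatSmoothAt.det (hF : MatSmoothAt F y) : ContDiffAt ℝ ∞ (fun z => (F z).det) y := by
  simp only [Matrix.det_apply]
  exact ContDiffAt.sum fun σ _ => (contDiffAt_prod fun i _ => hF _ _).const_smul _

theorem MatSmoothAt.inv (hF : MatSmoothAt F y) (h : IsUnit (F y).det) :
    MatSmoothAt (fun z => (F z)⁻¹) y := fun i j => by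
  simp only [Matrix.inv_def, Matrix.smul_apply, Ring.inverse_eq_inv', smul_eq_mul]
  refine (hF.det.inv h.ne_zero).mul ?_
  simp only [Matrix.adjugate_apply]
  refine MatSmoothAt.det fun k l => ?_
  by_cases hk : k = j
  · subst hk; simp only [Matrix.updateRow_self]; exact contDiffAt_const
  · simp only [Matrix.updateRow_ne hk]; exact hF k l

theorem MatSmoothAt.trace (hF : MatSmoothAt F y) : ContDiffAt ℝ ∞ (fun z => (F z).trace) y := by
  simp only [Matrix.trace, Matrix.diag_apply]
  exact ContDiffAt.sum fun k _ => hF k k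

theorem MatSmoothAt.isUnit_det_eventually (hF : MatSmoothAt F y) (h : IsUnit (F y).det) :
    ∀ᶠ z in 𝓝 y, IsUnit (F z).det :=
  (hF.det.continuousAt.eventually_ne h.ne_zero).mono fun _ hz => isUnit_iff_ne_zero.2 hz

variable {G A B K T : E4 → Mat4}

theorem MatSmoothAt.cross (hG : MatSmoothAt G y) (hu : IsUnit (G y).det) (hA : MatSmoothAt A y)
    (hB : MatSmoothAt B y) : MatSmoothAt (fun z => cross (G z) (A z) (B z)) y :=
  (hA.mul (hG.inv hu)).mul hB

theorem MatSmoothAt.tr (hG : MatSmoothAt G y) (hu : IsUnit (G y).det) (hA : MatSmoothAt A y) :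
    ContDiffAt ℝ ∞ (fun z => tr (G z) (A z)) y := ((hG.inv hu).mul hA).trace

theorem MatSmoothAt.tracelessPart (hG : MatSmoothAt G y) (hu : IsUnit (G y).det)
    (hK : MatSmoothAt K y) : MatSmoothAt (fun z => tracelessPart (G z) (K z)) y :=
  hK.sub (.smul ((hG.tr hu hK).div_const 4) hG)

theorem pd_congr {f h : E4 → ℝ} (H : ∀ᶠ z in 𝓝 y, f z = h z) (α : Fin 4) :
    pd f α y = pd h α y := by
  rw [pd, pd, Filter.EventuallyEq.fderiv_eq H]

theorem pdMat_congr (h : ∀ᶠ z in 𝓝 y, F z = H z) (α : Fin 4) : pdMat F y α = pdMat H y α := by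
  ext i j
  exact pd_congr (h.mono fun z hz => by rw [hz]) α

theorem pd_mul {f h : E4 → ℝ} (hf : DifferentiableAt ℝ f y) (hh : DifferentiableAt ℝ h y)
    (α : Fin 4) : pd (fun z => f z * h z) α y = pd f α y * h y + f y * pd h α y := by
  rw [pd, fderiv_fun_mul hf hh]
  simp [pd]; ring

theorem pd_sum {f : Fin 4 → E4 → ℝ} (hf : ∀ i, DifferentiableAt ℝ (f i) y) (α : Fin 4) :
    pd (fun z => ∑ i, f i z) α y = ∑ i, pd (f i) α y := by
  rw [pd, fderiv_fun_sum fun i _ => hf i]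
  simp [pd]

theorem pdMat_mul (hF : MatSmoothAt F y) (hH : MatSmoothAt H y) (α : Fin 4) :
    pdMat (fun z => F z * H z) y α = pdMat F y α * H y + F y * pdMat H y α := by
  ext i j
  simp only [pdMat, Matrix.of_apply, Matrix.mul_apply, Matrix.add_apply]
  rw [← Finset.sum_add_distrib]
  refine (pd_sum (fun k => (hF.differentiableAt i k).fun_mul (hH.differentiableAt k j)) α).trans ?_
  exact Finset.sum_congr rfl fun k _ => pd_mul (hF.differentiableAt i k) (hH.differentiableAt k j) α

theorem pdMat_smul (hf : ContDiffAt ℝ ∞ f y) (hF : MatSmoothAt F y) (α : Fin 4) :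
    pdMat (fun z => f z • F z) y α = pd f α y • F y + f y • pdMat F y α := by
  ext i j
  exact pd_mul (hf.differentiableAt (by simp)) (hF.differentiableAt i j) α

theorem pdMat_sub (hF : MatSmoothAt F y) (hH : MatSmoothAt H y) (α : Fin 4) :
    pdMat (fun z => F z - H z) y α = pdMat F y α - pdMat H y α := by
  ext i j
  simp only [pdMat, Matrix.of_apply, Matrix.sub_apply, pd]
  rw [fderiv_fun_sub (hF.differentiableAt i j) (hH.differentiableAt i j)]
  rfl

theorem pd_trace (hF : MatSmoothAt F y) (α : Fin 4) :
    pd (fun z => (F z).trace) α y = (pdMat F y α).trace := by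
  simp only [Matrix.trace, Matrix.diag_apply]
  exact pd_sum (fun k => hF.differentiableAt k k) α

theorem pdMat_inv (hF : MatSmoothAt F y) (hu : IsUnit (F y).det) (α : Fin 4) :
    pdMat (fun z => (F z)⁻¹) y α = -((F y)⁻¹ * pdMat F y α * (F y)⁻¹) := by
  have h1 : pdMat (fun z => F z * (F z)⁻¹) y α = 0 := by
    rw [pdMat_congr (H := fun _ => 1) ((hF.isUnit_det_eventually hu).mono fun z hz =>
      Matrix.mul_nonsing_inv _ hz)]
    ext i j
    simp [pdMat, pd]
  rw [pdMat_mul hF (hF.inv hu)] at h1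
  have h2 := congrArg (fun X => (F y)⁻¹ * X) h1
  simp only [mul_add, ← Matrix.mul_assoc, Matrix.nonsing_inv_mul _ hu, one_mul, mul_zero] at h2
  exact eq_neg_of_add_eq_zero_right h2

/-! ### The covariant derivative -/

/-- The matrices of the covariant derivatives `∇_α T`. -/
def cov (G T : E4 → Mat4) (y : E4) (α : Fin 4) : Mat4 :=
  Matrix.of fun β μ => covDeriv G T y α β μ

/-- The connection matrices `(Γ_α)^σ_β = Γ^σ_{αβ}`. -/
def connMat (G : E4 → Mat4) (y : E4) (α : Fin 4) : Mat4 :=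
  Matrix.of fun σ β => christoffel G y σ α β

theorem cov_eq (G T : E4 → Mat4) (y : E4) (α : Fin 4) :
    cov G T y α = pdMat T y α - (connMat G y α)ᵀ * T y - T y * connMat G y α := by
  ext β μ
  simp only [cov, covDeriv, pdMat, connMat, Matrix.sub_apply, Matrix.mul_apply,
    Matrix.transpose_apply, Matrix.of_apply]
  congr 1
  exact Finset.sum_congr rfl fun σ _ => mul_comm _ _

theorem cov_congr (h : ∀ᶠ z in 𝓝 y, A z = B z) (α : Fin 4) : cov G A y α = cov G B y α := by
  rw [cov_eq, cov_eq, pdMat_congr h, h.self_of_nhds]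

theorem cov_transpose (T : E4 → Mat4) (α : Fin 4) :
    cov G (fun z => (T z)ᵀ) y α = (cov G T y α)ᵀ := by
  have : pdMat (fun z => (T z)ᵀ) y α = (pdMat T y α)ᵀ := rfl
  rw [cov_eq, cov_eq, this]
  simp only [Matrix.transpose_sub, Matrix.transpose_mul, Matrix.transpose_transpose]
  abel

theorem cov_neg (T : E4 → Mat4) (α : Fin 4) : cov G (fun z => -T z) y α = -cov G T y α := by
  have : pdMat (fun z => -T z) y α = -pdMat T y α := by
    ext i j
    simp only [pdMat, Matrix.of_apply, Matrix.neg_apply, pd]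
    rw [fderiv_fun_neg]; rfl
  rw [cov_eq, cov_eq, this]
  simp only [mul_neg, neg_mul]
  abel

theorem cov_skew (h : ∀ᶠ z in 𝓝 y, (A z)ᵀ = -A z) (α : Fin 4) :
    (cov G A y α)ᵀ = -cov G A y α := by
  rw [← cov_transpose, ← cov_neg]
  exact cov_congr h α

theorem cov_sub (hA : MatSmoothAt A y) (hB : MatSmoothAt B y) (α : Fin 4) :
    cov G (fun z => A z - B z) y α = cov G A y α - cov G B y α := by
  rw [cov_eq, cov_eq, cov_eq, pdMat_sub hA hB]
  simp only [mul_sub, sub_mul]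
  abel

theorem cov_smul (hf : ContDiffAt ℝ ∞ f y) (hA : MatSmoothAt A y) (α : Fin 4) :
    cov G (fun z => f z • A z) y α = pd f α y • A y + f y • cov G A y α := by
  rw [cov_eq, cov_eq, pdMat_smul hf hA]
  simp only [Matrix.mul_smul, Matrix.smul_mul, smul_sub]
  abel

section Metric

variable (hG : MatSmoothAt G y) (hs : ∀ z, (G z)ᵀ = G z) (hu : IsUnit (G y).det)

include hs hu in
/-- The Levi-Civita connection is metric, `∂_α g = Γ_αᵀ g + g Γ_α`. -/
theorem pdMat_metric (α : Fin 4) :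
    pdMat G y α = (connMat G y α)ᵀ * G y + G y * connMat G y α := by
  have h1 : ∀ ρ β, (G y * connMat G y α) ρ β =
      1 / 2 * (pdMat G y α ρ β + pdMat G y β α ρ - pdMat G y ρ α β) := by
    intro ρ β
    have e : connMat G y α = (G y)⁻¹ * Matrix.of fun ρ β =>
        1 / 2 * (pdMat G y α ρ β + pdMat G y β α ρ - pdMat G y ρ α β) := by
      ext σ β
      simp only [connMat, christoffel, Matrix.of_apply, Matrix.mul_apply, Finset.mul_sum, pdMat]
      exact Finset.sum_congr rfl fun ρ _ => by ring
    rw [e, ← Matrix.mul_assoc, Matrix.mul_nonsing_inv _ hu, one_mul]; rfl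
  have h2 : (connMat G y α)ᵀ * G y = (G y * connMat G y α)ᵀ := by
    rw [Matrix.transpose_mul, hs]
  have h3 : ∀ γ i j, pdMat G y γ i j = pdMat G y γ j i := by
    intro γ i j
    have : ∀ z, G z i j = G z j i := fun z => congrFun (congrFun (hs z) j) i
    simp only [pdMat, Matrix.of_apply, this]
  ext i j
  rw [h2, Matrix.add_apply, Matrix.transpose_apply, h1, h1, h3 α j i]
  ring

include hs hu in
theorem cov_metric (α : Fin 4) : cov G G y α = 0 := by
  rw [cov_eq, pdMat_metric hs hu]
  abel

include hG hs hu

theorem pdMat_inv_metric (α : Fin 4) : pdMat (fun z => (G z)⁻¹) y α =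
    -((G y)⁻¹ * (connMat G y α)ᵀ) - connMat G y α * (G y)⁻¹ := by
  rw [pdMat_inv hG hu, pdMat_metric hs hu, mul_add, add_mul, neg_add]
  simp only [Matrix.mul_assoc, Matrix.mul_nonsing_inv _ hu, mul_one]
  rw [← Matrix.mul_assoc (G y)⁻¹ (G y), Matrix.nonsing_inv_mul _ hu, one_mul, sub_eq_add_neg]

theorem cov_cross (hA : MatSmoothAt A y) (hB : MatSmoothAt B y) (α : Fin 4) :
    cov G (fun z => cross (G z) (A z) (B z)) y α =
      cross (G y) (cov G A y α) (B y) + cross (G y) (A y) (cov G B y α) := by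
  have hcr : pdMat (fun z => cross (G z) (A z) (B z)) y α =
      (pdMat A y α * (G y)⁻¹ + A y * pdMat (fun z => (G z)⁻¹) y α) * B y +
        A y * (G y)⁻¹ * pdMat B y α := by
    rw [← pdMat_mul hA (hG.inv hu)]
    exact pdMat_mul (hA.mul (hG.inv hu)) hB α
  rw [cov_eq, hcr, pdMat_inv_metric hG hs hu, cov_eq, cov_eq]
  simp only [cross]
  noncomm_ring

theorem pd_tr {T : E4 → Mat4} (hT : MatSmoothAt T y) (α : Fin 4) :
    pd (fun z => tr (G z) (T z)) α y = tr (G y) (cov G T y α) := by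
  have h1 : pd (fun z => tr (G z) (T z)) α y = (pdMat (fun z => (G z)⁻¹ * T z) y α).trace :=
    pd_trace ((hG.inv hu).mul hT) α
  rw [h1, pdMat_mul (hG.inv hu) hT, pdMat_inv_metric hG hs hu, cov_eq, tr]
  have h2 : (connMat G y α * ((G y)⁻¹ * T y)).trace = ((G y)⁻¹ * (T y * connMat G y α)).trace := by
    rw [Matrix.trace_mul_comm, Matrix.mul_assoc]
  simp only [sub_mul, mul_sub, Matrix.trace_add, Matrix.trace_sub, neg_mul, Matrix.trace_neg, h2,
    Matrix.mul_assoc]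
  ring

theorem cov_sq (hA : MatSmoothAt A y) (α : Fin 4) :
    cov G (fun z => sq (G z) (A z)) y α = dsq (G y) (A y) (cov G A y α) :=
  cov_cross hG hs hu hA hA α

theorem cov_tracelessPart (hK : MatSmoothAt K y) (α : Fin 4) :
    cov G (fun z => tracelessPart (G z) (K z)) y α =
      cov G K y α - (tr (G y) (cov G K y α) / 4) • G y := by
  have h4 : ContDiffAt ℝ ∞ (fun z => Rainich.tr (G z) (K z) / 4) y := (hG.tr hu hK).div_const 4
  have e : cov G (fun z => tracelessPart (G z) (K z)) y α =
      cov G (fun z => K z - (Rainich.tr (G z) (K z) / 4) • G z) y α := rfl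
  rw [e, cov_sub hK (.smul h4 hG), cov_smul h4 hG, cov_metric hs hu, smul_zero, add_zero,
    ← pd_tr hG hs hu hK]
  congr 2
  simp only [pd, div_eq_mul_inv]
  rw [fderiv_mul_const ((hG.tr hu hK).differentiableAt (by simp))]
  simp [mul_comm]

end Metric

end Smooth

/-! ### The differential of the Rainich index -/

/-- Where `2b = a²` the argument of the arctangent is a quotient by `√0 = 0`, hence zero. -/
theorem rainichIndex_eq_zero {g K : Mat4} (h : tr g K ^ 2 = 2 * tr g (sq g K)) :
    rainichIndex g K = 0 := by
  rw [rainichIndex]; simp [h]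

/-- The differential of the Rainich index is
`-(2b da - a db) / (√(2(2b - a²)) (4b - a²))`. -/
theorem hasDerivAt_index {a b : ℝ → ℝ} {a' b' t : ℝ} (ha : HasDerivAt a a' t)
    (hb : HasDerivAt b b' t) (h : a t ^ 2 < 2 * b t) :
    HasDerivAt (fun t => Real.arctan ((√(4 * b t - a t ^ 2) - a t) / √(2 * (2 * b t - a t ^ 2))))
      (-((2 * b t * a' - a t * b') / (√(2 * (2 * b t - a t ^ 2)) * (4 * b t - a t ^ 2)))) t := by
  have hs0 : 0 < 4 * b t - a t ^ 2 := by nlinarith [sq_nonneg (a t)]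
  have hw0 : 0 < 2 * (2 * b t - a t ^ 2) := by linarith
  have hs := ((hb.const_mul 4).sub (ha.pow 2)).sqrt hs0.ne'
  have hw := (((hb.const_mul 2).sub (ha.pow 2)).const_mul 2).sqrt hw0.ne'
  have := ((hs.sub ha).div hw (Real.sqrt_pos.2 hw0).ne').arctan
  refine this.congr_deriv ?_
  simp only [Pi.sub_apply, Pi.pow_apply, Pi.div_apply, Nat.cast_ofNat, Nat.add_one_sub_one, pow_one]
  set s := √(4 * b t - a t ^ 2) with hsd
  set w := √(2 * (2 * b t - a t ^ 2)) with hwd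
  have hs2 : s ^ 2 = 4 * b t - a t ^ 2 := Real.sq_sqrt hs0.le
  have hw2 : w ^ 2 = 2 * (2 * b t - a t ^ 2) := Real.sq_sqrt hw0.le
  have hsp : 0 < s := Real.sqrt_pos.2 hs0
  have hwp : 0 < w := Real.sqrt_pos.2 hw0
  have hsa : 0 < s - a t := by
    have : a t < s := lt_of_le_of_lt (le_abs_self _) (abs_lt_of_sq_lt_sq (by linarith) hsp.le)
    linarith
  rw [← hs2]
  have e : 1 + ((s - a t) / w) ^ 2 = 2 * s * (s - a t) / w ^ 2 := by
    field_simp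
    rw [hw2]; linear_combination (-1) * hs2
  rw [e]
  have hbt : b t = (s ^ 2 + a t ^ 2) / 4 := by linarith
  -- the relation that makes the quotient rule collapse
  have hw3 : w ^ 2 = (s - a t) * (s + a t) := by rw [hw2, hbt]; ring
  rw [hbt]
  field_simp
  rw [hw3]
  ring

theorem contDiffAt_rainichIndex {G K : E4 → Mat4} {y : E4} (hG : MatSmoothAt G y)
    (hu : IsUnit (G y).det) (hK : MatSmoothAt K y)
    (h : tr (G y) (K y) ^ 2 < 2 * tr (G y) (sq (G y) (K y))) :
    ContDiffAt ℝ ∞ (fun z => rainichIndex (G z) (K z)) y := by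
  have ha := hG.tr hu hK
  have hb : ContDiffAt ℝ ∞ (fun z => tr (G z) (sq (G z) (K z))) y := hG.tr hu (hG.cross hu hK hK)
  have h1 : 0 < 2 * (2 * tr (G y) (sq (G y) (K y)) - tr (G y) (K y) ^ 2) := by linarith
  have h2 : 0 < 4 * tr (G y) (sq (G y) (K y)) - tr (G y) (K y) ^ 2 := by
    nlinarith [sq_nonneg (tr (G y) (K y))]
  exact ((((contDiffAt_const.mul hb).sub (ha.pow 2)).sqrt h2.ne').sub ha).div
    ((contDiffAt_const.mul ((contDiffAt_const.mul hb).sub (ha.pow 2))).sqrt h1.ne')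
    (Real.sqrt_pos.2 h1).ne' |>.arctan

theorem pd_rainichIndex {G K : E4 → Mat4} {y : E4} (hG : MatSmoothAt G y)
    (hs : ∀ z, (G z)ᵀ = G z) (hu : IsUnit (G y).det) (hK : MatSmoothAt K y)
    (h : tr (G y) (K y) ^ 2 < 2 * tr (G y) (sq (G y) (K y))) (α : Fin 4) :
    pd (fun z => rainichIndex (G z) (K z)) α y =
      -((2 * tr (G y) (sq (G y) (K y)) * tr (G y) (cov G K y α) -
        tr (G y) (K y) * tr (G y) (dsq (G y) (K y) (cov G K y α))) /
        (√(2 * (2 * tr (G y) (sq (G y) (K y)) - tr (G y) (K y) ^ 2)) *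
          (4 * tr (G y) (sq (G y) (K y)) - tr (G y) (K y) ^ 2))) := by
  have hsq : MatSmoothAt (fun z => sq (G z) (K z)) y := hG.cross hu hK hK
  have ha := (hG.tr hu hK)
  have hb := (hG.tr hu hsq)
  have ea := pd_tr hG hs hu hK α
  have eb := pd_tr hG hs hu hsq α
  rw [cov_sq hG hs hu hK] at eb
  have hψ := contDiffAt_rainichIndex hG hu hK h
  have line : ∀ {f : E4 → ℝ}, ContDiffAt ℝ ∞ f y →
      HasDerivAt (fun t : ℝ => f (y + t • EuclideanSpace.single α (1 : ℝ))) (pd f α y) 0 :=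
    fun hf => ((hf.differentiableAt (by simp)).hasFDerivAt.hasLineDerivAt _)
  have la := line ha
  have lb := line hb
  have := hasDerivAt_index la lb (by simpa using h)
  simp only [zero_smul, add_zero, ea, eb] at this
  exact (line hψ).unique this

/-! ### The Rainich equation and the Killing-Yano equation in a chart -/

theorem trace_sq_of_canForm (x w : ℝ) :
    tr mink (sq mink (sq mink (canForm x w))) = 2 * (x ^ 4 + w ^ 4) := by
  rw [tr_sq_canonical (sq_canForm x w)]; ring

/-- If the blade of `K` with eigenvalue `-l₂` is degenerate, `l₂ = 0`, then `A³ = ½ (tr A²) A`. -/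
theorem cross_sq_eq_smul {g A : Mat4} (hg : ∃ L, pull L g = mink) (hA : Aᵀ = -A)
    (h : tr g (sq g A) ^ 2 = 2 * tr g (sq g (sq g A))) (hpos : 0 < tr g (sq g A)) :
    cross g A (sq g A) = (tr g (sq g A) / 2) • A := by
  have halg := algebraicAt_sq hg hA (Or.inr ⟨h, hpos⟩)
  have hgt : gᵀ = g := transpose_of_pull_eq_mink hg.choose_spec
  have hKt : (sq g A)ᵀ = sq g A := by
    simp [sq, cross, Matrix.transpose_mul, hA, Matrix.transpose_nonsing_inv, hgt, Matrix.mul_assoc]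
  obtain ⟨L, l1, l2, hL, hLK, h1, h2⟩ := exists_canonical_frame hg hKt halg h.le
  have hu := isUnit_det_frame hL
  have ha : tr g (sq g A) = 2 * (l1 - l2) := by
    rw [← tr_pull hu, hL]; exact tr_canonical hLK
  have hb : tr g (sq g (sq g A)) = 2 * (l1 ^ 2 + l2 ^ 2) := by
    rw [← tr_pull hu, ← sq_pull hu, hL]; exact tr_sq_canonical hLK
  have hl2 : l2 = 0 := by
    rw [ha, hb] at h
    exact (mul_eq_zero.1 (show l1 * l2 = 0 by linarith)).resolve_left h1.ne'
  have hAL : (pull L A)ᵀ = -pull L A := by rw [pull_transpose, hA, pull_neg]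
  have hsq : sq mink (pull L A) = Matrix.diagonal ![-l1, l1, -l2, -l2] := by
    rw [← hLK, ← hL, sq_pull hu]
  obtain ⟨hcan, -, hw⟩ := eq_canForm_of_sq_eq hAL hsq (by linarith)
  rw [hl2] at hw
  rw [pow_eq_zero_iff (by norm_num) |>.1 hw] at hcan
  refine pull_injective hu ?_
  rw [← cross_pull hu, pull_smul, hL, hLK, ha, hl2, hcan]
  ext i j
  rw [cross_mink_apply]
  fin_cases i <;> fin_cases j <;> simp [canForm, mul_comm]

/-- A 2-form `A` near the point with coordinates `y`, with square `K`, together with a frame `L` at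
this point which is canonical for `A`; `G` are the components of the metric. By the field `index`,
the Rainich index is smooth at `y` or vanishes near `y`. The functions are defined on the whole
coordinate space, and of interest near `y` only. -/
structure LocalSquare (G K A : E4 → Mat4) (y : E4) (L : Mat4) (x w : ℝ) : Prop where
  smooth_metric : MatSmoothAt G y
  symm : ∀ z, (G z)ᵀ = G z
  frame : ∀ᶠ z in 𝓝 y, ∃ L, pull L (G z) = mink
  smooth : MatSmoothAt A y
  skew : ∀ᶠ z in 𝓝 y, (A z)ᵀ = -A z
  square : ∀ᶠ z in 𝓝 y, K z = sq (G z) (A z)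
  pull_metric : pull L (G y) = mink
  pull_form : pull L (A y) = canForm x w
  ne_zero : x ≠ 0
  index : tr (G y) (K y) ^ 2 < 2 * tr (G y) (sq (G y) (K y)) ∨
    ∀ᶠ z in 𝓝 y, tr (G z) (K z) ^ 2 = 2 * tr (G z) (sq (G z) (K z)) ∧ 0 < tr (G z) (K z)

namespace LocalSquare

variable {G K A : E4 → Mat4} {y : E4} {L : Mat4} {x w : ℝ} (h : LocalSquare G K A y L x w)

include h

theorem isUnit_frame : IsUnit L.det := isUnit_det_frame h.pull_metric

theorem isUnit_metric : IsUnit (G y).det := isUnit_det_metric h.pull_metric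

theorem smooth_sq : MatSmoothAt K y :=
  (h.smooth_metric.cross h.isUnit_metric h.smooth h.smooth).congr h.square

theorem pull_sq : pull L (K y) = sq mink (canForm x w) := by
  rw [h.square.self_of_nhds, ← sq_pull h.isUnit_frame, h.pull_metric, h.pull_form]

theorem tr_eq : tr (G y) (K y) = 2 * (x ^ 2 - w ^ 2) := by
  rw [← tr_pull h.isUnit_frame, h.pull_metric, h.pull_sq, tr_sq_canForm]

theorem tr_sq_eq : tr (G y) (sq (G y) (K y)) = 2 * (x ^ 4 + w ^ 4) := by
  rw [← tr_pull h.isUnit_frame, ← sq_pull h.isUnit_frame, h.pull_metric, h.pull_sq,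
    trace_sq_of_canForm]

theorem cov_eq_dsq (α : Fin 4) : cov G K y α = dsq (G y) (A y) (cov G A y α) := by
  rw [cov_congr h.square, cov_sq h.smooth_metric h.symm h.isUnit_metric h.smooth]

theorem pull_cov_skew (a : Fin 4) :
    (pull3 L (cov G A y) a)ᵀ = -pull3 L (cov G A y) a := by
  rw [pull3_eq, Matrix.transpose_sum, ← Finset.sum_neg_distrib]
  refine Finset.sum_congr rfl fun α _ => ?_
  rw [Matrix.transpose_smul, pull_transpose, cov_skew h.skew, pull_neg, smul_neg]

theorem pull_cov_sq (a : Fin 4) :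
    pull3 L (cov G K y) a = dsq mink (canForm x w) (pull3 L (cov G A y) a) := by
  have e : ∀ α, pull L (cov G K y α) = cross mink (pull L (cov G A y α)) (canForm x w) +
      cross mink (canForm x w) (pull L (cov G A y α)) := fun α => by
    rw [h.cov_eq_dsq, dsq, pull_add, ← cross_pull h.isUnit_frame, ← cross_pull h.isUnit_frame,
      h.pull_metric, h.pull_form]
  simp only [pull3_eq, dsq, e, cross, Finset.sum_mul, Finset.mul_sum, ← Finset.sum_add_distrib,
    Matrix.smul_mul, Matrix.mul_smul, smul_add]

theorem sum_tr_cov (T : E4 → Mat4) (d : Fin 4) :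
    ∑ δ, L δ d * tr (G y) (cov G T y δ) = tr mink (pull3 L (cov G T y) d) := by
  rw [pull3_eq]
  simp only [tr, Finset.mul_sum, Matrix.trace_sum, Matrix.mul_smul, Matrix.trace_smul, smul_eq_mul]
  refine Finset.sum_congr rfl fun δ _ => ?_
  rw [← tr, ← tr, ← h.pull_metric, tr_pull h.isUnit_frame]

/-- Where `A` is simple on an open set, the component of `∇A` along the degenerate blade vanishes:
it is the component of the derivative of `A³ = ½ (tr A²) A` along this blade. -/
theorem pull_cov_two_three
    (hdeg : ∀ᶠ z in 𝓝 y, tr (G z) (K z) ^ 2 = 2 * tr (G z) (sq (G z) (K z)) ∧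
      0 < tr (G z) (K z)) :
    w = 0 ∧ ∀ d, pull3 L (cov G A y) d 2 3 = 0 := by
  have hw : w = 0 := by
    have := hdeg.self_of_nhds.1
    rw [h.tr_eq, h.tr_sq_eq] at this
    have h2 : (x * w) ^ 2 = 0 := by linarith
    exact (mul_eq_zero.1 (pow_eq_zero_iff (by norm_num) |>.1 h2)).resolve_left h.ne_zero
  refine ⟨hw, fun d => ?_⟩
  have hK := h.smooth_sq
  have htr := h.smooth_metric.tr h.isUnit_metric hK
  have hcube : ∀ᶠ z in 𝓝 y, cross (G z) (A z) (K z) = (tr (G z) (K z) / 2) • A z := by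
    filter_upwards [hdeg, h.square, h.skew, h.frame] with z h1 h2 h3 h4
    rw [h2] at h1 ⊢
    exact cross_sq_eq_smul h4 h3 h1.1 h1.2
  have key : ∀ α, cross (G y) (cov G A y α) (K y) + cross (G y) (A y) (cov G K y α) =
      pd (fun z => tr (G z) (K z) / 2) α y • A y + (tr (G y) (K y) / 2) • cov G A y α := by
    intro α
    rw [← cov_cross h.smooth_metric h.symm h.isUnit_metric h.smooth hK, cov_congr hcube,
      cov_smul (htr.div_const 2) h.smooth]
  have e1 : ∀ α, pull L (cov G A y α) 2 3 = 0 := by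
    intro α
    have := congrArg (pull L) (key α)
    rw [pull_add, pull_add, pull_smul, pull_smul, ← cross_pull h.isUnit_frame,
      ← cross_pull h.isUnit_frame, h.pull_metric, h.pull_sq, h.pull_form,
      ← tr_pull h.isUnit_frame, h.pull_metric, h.pull_sq, tr_sq_canForm, sq_canForm, hw] at this
    have := congrFun (congrFun this 2) 3
    simp only [Matrix.add_apply, Matrix.smul_apply, cross_mink_apply] at this
    simp [canForm] at this
    exact this.resolve_left h.ne_zero
  rw [pull3_eq]
  simp [Matrix.sum_apply, e1]

/-- The Rainich equation in a canonical frame. By `rainich_value_of_skewFirst` the right-hand side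
is the value that the Rainich 1-form has for a Killing-Yano tensor. The hypothesis `hsign` couples `ε`
to the relative sign of the components of `A`: with it, `ε dψ` is, up to orientation, the
differential of the angle of `(x, w)`. -/
theorem rainich_iff {η : Ten4} {o ε : ℝ} (hη : pullVol L η = frameVol o)
    (hε : ε ^ 2 = 1) (hsign : x * w = -(o * ε) * √(x ^ 2 * w ^ 2)) :
    (∀ δ, -2 * pd (fun z => rainichIndex (G z) (K z)) δ y =
      ε * rainichForm G η (fun z => tracelessPart (G z) (K z)) y δ) ↔
    ∀ d, contract
      (tmul mink fun a => cross mink (dsq mink (canForm x w) (pull3 L (cov G A y) a) -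
        (tr mink (dsq mink (canForm x w) (pull3 L (cov G A y) a)) / 4) • mink)
          (tracelessPart mink (sq mink (canForm x w))))
      (fun a => Matrix.of fun b c => frameVol o a b c d) =
      2 * o * (x ^ 2 + w ^ 2) *
        (x * pull3 L (cov G A y) d 2 3 - w * pull3 L (cov G A y) d 0 1) := by
  have hu := h.isUnit_frame
  have hr : x ^ 2 + w ^ 2 ≠ 0 := by have := h.ne_zero; positivity
  have hK := h.smooth_sq
  -- both sides of the equation are contracted with the vectors of the frame
  have hframe : ∀ u v : Fin 4 → ℝ, (∀ δ, u δ = v δ) ↔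
      ∀ d, ∑ δ, L δ d * u δ = ∑ δ, L δ d * v δ := by
    intro u v
    refine ⟨fun H d => by simp only [H], fun H => ?_⟩
    have H' : Lᵀ *ᵥ u = Lᵀ *ᵥ v := funext fun d => H d
    have := congrArg (fun t => (Lᵀ)⁻¹ *ᵥ t) H'
    have hut : IsUnit Lᵀ.det := by rwa [Matrix.det_transpose]
    simp only [Matrix.mulVec_mulVec, Matrix.nonsing_inv_mul _ hut, Matrix.one_mulVec] at this
    exact fun δ => congrFun this δ
  rw [hframe]
  refine forall_congr' fun d => ?_
  have hP : pull3 L (cov G (fun z => tracelessPart (G z) (K z)) y) = fun a =>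
      dsq mink (canForm x w) (pull3 L (cov G A y) a) -
        (tr mink (dsq mink (canForm x w) (pull3 L (cov G A y) a)) / 4) • mink := by
    funext a
    rw [← h.pull_cov_sq, ← h.sum_tr_cov, pull3_eq, pull3_eq, Finset.sum_div, Finset.sum_smul,
      ← Finset.sum_sub_distrib]
    refine Finset.sum_congr rfl fun α _ => ?_
    rw [cov_tracelessPart h.smooth_metric h.symm h.isUnit_metric hK, pull_sub, pull_smul,
      h.pull_metric, smul_sub, smul_smul, mul_div_assoc]
  have hPy : pull L (tracelessPart (G y) (K y)) = tracelessPart mink (sq mink (canForm x w)) := by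
    rw [← tracelessPart_pull hu, h.pull_metric, h.pull_sq]
  have hR : ∑ δ, L δ d * (ε * rainichForm G η (fun z => tracelessPart (G z) (K z)) y δ) =
      ε * rainichFormAt mink (frameVol o) (tracelessPart mink (sq mink (canForm x w)))
        (fun a => dsq mink (canForm x w) (pull3 L (cov G A y) a) -
          (tr mink (dsq mink (canForm x w) (pull3 L (cov G A y) a)) / 4) • mink) d := by
    rw [← hP, ← hPy, ← hη, ← h.pull_metric, rainichFormAt_pull hu, Finset.mul_sum]
    refine Finset.sum_congr rfl fun δ _ => ?_
    rw [rainichForm_eq]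
    exact mul_left_comm _ _ _
  rw [hR, rainichFormAt, mink_inv]
  have hPP : tr mink (sq mink (tracelessPart mink (sq mink (canForm x w)))) =
      (x ^ 2 + w ^ 2) ^ 2 := by
    have := tr_sq_tracelessPart isUnit_det_mink (sq mink (canForm x w))
    rw [trace_sq_of_canForm, tr_sq_canForm] at this
    linarith
  rw [hPP]
  have hD := h.pull_cov_skew d
  have hE := h.pull_cov_sq d
  generalize contract _ _ = C
  set D := pull3 L (cov G A y) d with hDdef
  -- the differential of the index, in terms of the components of `∇A`
  have hLHS : ∑ δ, L δ d * (-2 * pd (fun z => rainichIndex (G z) (K z)) δ y) =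
      2 * o * ε * (x * D 2 3 - w * D 0 1) / (x ^ 2 + w ^ 2) := by
    rcases h.index with hidx | hidx
    · have ha := h.tr_eq
      have hb := h.tr_sq_eq
      have hda : ∑ δ, L δ d * tr (G y) (cov G K y δ) = 4 * (x * D 0 1 - w * D 2 3) := by
        rw [h.sum_tr_cov, hE, dsq_canForm x w hD, tr_mink]; simp; ring
      have hdb : ∑ δ, L δ d * tr (G y) (dsq (G y) (K y) (cov G K y δ)) =
          8 * (x ^ 3 * D 0 1 + w ^ 3 * D 2 3) := by
        have e := h.sum_tr_cov (fun z => sq (G z) (K z)) d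
        simp only [cov_sq h.smooth_metric h.symm h.isUnit_metric hK] at e
        rw [e]
        have e2 : pull3 L (cov G (fun z => sq (G z) (K z)) y) d =
            dsq mink (sq mink (canForm x w)) (pull3 L (cov G K y) d) := by
          have e3 : ∀ α, pull L (cov G (fun z => sq (G z) (K z)) y α) =
              cross mink (pull L (cov G K y α)) (sq mink (canForm x w)) +
                cross mink (sq mink (canForm x w)) (pull L (cov G K y α)) := fun α => by
            rw [cov_sq h.smooth_metric h.symm h.isUnit_metric hK, dsq, pull_add, ← cross_pull hu,
              ← cross_pull hu, h.pull_metric, h.pull_sq]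
          simp only [pull3_eq, dsq, e3, cross, Finset.sum_mul, Finset.mul_sum,
            ← Finset.sum_add_distrib, Matrix.smul_mul, Matrix.mul_smul, smul_add]
        rw [e2, hE, dsq_canForm x w hD, sq_canForm, tr_mink]
        simp only [dsq, Matrix.add_apply, cross_mink_apply]
        simp; ring
      have hpd : ∀ δ, L δ d * (-2 * pd (fun z => rainichIndex (G z) (K z)) δ y) =
          2 / (√(2 * (2 * (2 * (x ^ 4 + w ^ 4)) - (2 * (x ^ 2 - w ^ 2)) ^ 2)) *
            (4 * (2 * (x ^ 4 + w ^ 4)) - (2 * (x ^ 2 - w ^ 2)) ^ 2)) *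
          (2 * (2 * (x ^ 4 + w ^ 4)) * (L δ d * tr (G y) (cov G K y δ)) -
            2 * (x ^ 2 - w ^ 2) * (L δ d * tr (G y) (dsq (G y) (K y) (cov G K y δ)))) := by
        intro δ
        rw [pd_rainichIndex h.smooth_metric h.symm h.isUnit_metric hK hidx, ha, hb]; ring
      simp only [hpd]
      rw [← Finset.mul_sum, Finset.sum_sub_distrib, ← Finset.mul_sum, ← Finset.mul_sum, hda, hdb,
        show 2 * (2 * (2 * (x ^ 4 + w ^ 4)) - (2 * (x ^ 2 - w ^ 2)) ^ 2) =
          4 ^ 2 * (x ^ 2 * w ^ 2) by ring, Real.sqrt_mul (by norm_num),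
        Real.sqrt_sq (by norm_num),
        show 4 * (2 * (x ^ 4 + w ^ 4)) - (2 * (x ^ 2 - w ^ 2)) ^ 2 =
          4 * (x ^ 2 + w ^ 2) ^ 2 by ring]
      have hq : √(x ^ 2 * w ^ 2) ≠ 0 := by
        rw [ha, hb] at hidx
        refine (Real.sqrt_pos.2 ?_).ne'
        linarith
      set q := √(x ^ 2 * w ^ 2)
      field_simp
      linear_combination 16 * (x ^ 2 + w ^ 2) * (w * D 0 1 - x * D 2 3) * hsign
    · obtain ⟨hw, hD0⟩ := h.pull_cov_two_three hidx
      have e0 : ∀ δ, pd (fun z => rainichIndex (G z) (K z)) δ y = 0 := by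
        intro δ
        rw [pd_congr (h := fun _ => 0) (hidx.mono fun z hz => rainichIndex_eq_zero hz.1)]
        simp [pd]
      have hD0' : D 2 3 = 0 := hD0 d
      simp [e0, hw, hD0']
  rw [hLHS]
  have hε0 : ε ≠ 0 := by rintro rfl; norm_num at hε
  constructor
  · intro H
    field_simp at H
    linear_combination -H
  · intro H
    rw [H]; field_simp

/-- The Killing and the Rainich equations for `K = A²` imply the Killing-Yano equation for `A`. -/
theorem skewFirst_cov {η : Ten4} {o ε : ℝ} (hη : pullVol L η = frameVol o) (ho : o ^ 2 = 1)
    (hε : ε ^ 2 = 1) (hsign : x * w = -(o * ε) * √(x ^ 2 * w ^ 2))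
    (hKil : CyclicZero (cov G K y))
    (hR : ∀ δ, -2 * pd (fun z => rainichIndex (G z) (K z)) δ y =
      ε * rainichForm G η (fun z => tracelessPart (G z) (K z)) y δ) :
    SkewFirst (cov G A y) := by
  have hut : IsUnit Lᵀ.det := by rw [Matrix.det_transpose]; exact h.isUnit_frame
  have ho0 : o ≠ 0 := by rintro rfl; norm_num at ho
  refine SkewFirst.of_tmul hut ?_
  refine skewFirst_of_cyclicZero ho0 rfl h.ne_zero (sq_canForm x w) h.pull_cov_skew ?_
    ((h.rainich_iff hη hε hsign).1 hR) ?_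
  · have := hKil.tmul Lᵀ
    intro a b c
    simpa only [h.pull_cov_sq] using this a b c
  · intro hw
    rcases h.index with hidx | hidx
    · exfalso
      rw [h.tr_eq, h.tr_sq_eq, hw] at hidx
      ring_nf at hidx
      exact lt_irrefl _ hidx
    · exact (h.pull_cov_two_three hidx).2

/-- The Killing-Yano equation for `A` implies the Killing and the Rainich equations for `A²`. -/
theorem killing_and_rainich {η : Ten4} {o ε : ℝ} (hη : pullVol L η = frameVol o)
    (hε : ε ^ 2 = 1) (hsign : x * w = -(o * ε) * √(x ^ 2 * w ^ 2))
    (hKY : SkewFirst (cov G A y)) :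
    CyclicZero (cov G K y) ∧ ∀ δ, -2 * pd (fun z => rainichIndex (G z) (K z)) δ y =
      ε * rainichForm G η (fun z => tracelessPart (G z) (K z)) y δ := by
  have hut : IsUnit Lᵀ.det := by rw [Matrix.det_transpose]; exact h.isUnit_frame
  have hKY' := hKY.tmul Lᵀ
  constructor
  · refine CyclicZero.of_tmul hut ?_
    intro a b c
    simpa only [h.pull_cov_sq] using cyclicZero_dsq h.pull_cov_skew hKY' a b c
  · exact (h.rainich_iff hη hε hsign).2
      (rainich_value_of_skewFirst rfl (sq_canForm x w) h.pull_cov_skew hKY')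

end LocalSquare

/-! ### Frames of a vector space -/

section Frames

variable {V : Type*} [AddCommGroup V] [Module ℝ V]

/-- The components of a bilinear form on a family of four vectors. -/
def bilinMat (B : LinearMap.BilinForm ℝ V) (v : Fin 4 → V) : Mat4 :=
  Matrix.of fun i j => B (v i) (v j)

/-- The components of a 4-form on a family of four vectors. -/
def altTen (φ : V [⋀^Fin 4]→ₗ[ℝ] ℝ) (v : Fin 4 → V) : Ten4 :=
  fun i j k l => φ ![v i, v j, v k, v l]

/-- The family of vectors with components the columns of `C`. -/
def combine (C : Mat4) (v : Fin 4 → V) : Fin 4 → V := fun i => ∑ a, C a i • v a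

theorem bilinMat_combine (B : LinearMap.BilinForm ℝ V) (C : Mat4) (v : Fin 4 → V) :
    bilinMat B (combine C v) = pull C (bilinMat B v) := by
  ext i j
  rw [pull_apply]
  simp only [bilinMat, combine, Matrix.of_apply, map_sum, map_smul, LinearMap.sum_apply,
    LinearMap.smul_apply, smul_eq_mul, Finset.mul_sum]
  rw [Finset.sum_comm]
  exact Finset.sum_congr rfl fun a _ => Finset.sum_congr rfl fun b _ => by ring

theorem sum_fin_four_fun (F : (Fin 4 → Fin 4) → ℝ) :
    ∑ r, F r = ∑ a, ∑ b, ∑ c, ∑ d, F ![a, b, c, d] := by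
  have h : ∀ (n : ℕ) (F : (Fin (n + 1) → Fin 4) → ℝ),
      ∑ r, F r = ∑ a, ∑ r : Fin n → Fin 4, F (Matrix.vecCons a r) := by
    intro n F
    rw [← (Fin.consEquiv fun _ => Fin 4).sum_comp, Fintype.sum_prod_type]
    rfl
  rw [h]
  refine Finset.sum_congr rfl fun a _ => ?_
  rw [h]
  refine Finset.sum_congr rfl fun b _ => ?_
  rw [h]
  refine Finset.sum_congr rfl fun c _ => ?_
  rw [h]
  refine Finset.sum_congr rfl fun d _ => ?_
  rw [Fintype.sum_unique]
  congr 4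

theorem altTen_combine (φ : V [⋀^Fin 4]→ₗ[ℝ] ℝ) (C : Mat4) (v : Fin 4 → V) :
    altTen φ (combine C v) = pullVol C (altTen φ v) := by
  funext i j k l
  have e : ![combine C v i, combine C v j, combine C v k, combine C v l] =
      fun m => ∑ a, C a (![i, j, k, l] m) • v a := by
    ext m; fin_cases m <;> rfl
  rw [altTen, e, ← AlternatingMap.coe_multilinearMap, MultilinearMap.map_sum, sum_fin_four_fun]
  refine Finset.sum_congr rfl fun a _ => Finset.sum_congr rfl fun b _ =>
    Finset.sum_congr rfl fun c _ => Finset.sum_congr rfl fun d _ => ?_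
  rw [MultilinearMap.map_smul_univ, Fin.prod_univ_four, smul_eq_mul]
  congr 1
  rw [AlternatingMap.coe_multilinearMap, altTen]
  congr 1
  ext m; fin_cases m <;> rfl

theorem altTen_eq_frameVol (φ : V [⋀^Fin 4]→ₗ[ℝ] ℝ) (v : Fin 4 → V) :
    altTen φ v = frameVol (φ v) := by
  funext i j k l
  exact eq_frameVol φ v i j k l

end Frames

/-! ### Components in charts -/

section Charts

variable {M : Type*} [TopologicalSpace M] [ChartedSpace E4 M]

theorem mdifferentiable_of_mem_maximalAtlas {e : OpenPartialHomeomorph M E4}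
    (he : e ∈ IsManifold.maximalAtlas (𝓡 4) ∞ M) : e.MDifferentiable (𝓡 4) 𝓘(ℝ, E4) :=
  ⟨(contMDiffOn_of_mem_maximalAtlas he).mdifferentiableOn (by simp),
    (contMDiffOn_symm_of_mem_maximalAtlas he).mdifferentiableOn (by simp)⟩

/-- The matrix of the coordinate frame of the chart `e` in the frame `basisAt`. -/
def coordMat (e : OpenPartialHomeomorph M E4) (y : E4) : Mat4 :=
  (basisAt (e.symm y)).toMatrix (coordVec e y)

theorem coordVec_eq (e : OpenPartialHomeomorph M E4) (y : E4) :
    coordVec e y = combine (coordMat e y) (basisAt (e.symm y)) :=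
  funext fun _ => (Module.Basis.sum_toMatrix_smul_self _ _ _).symm

/-- Components in a chart are components in the pointwise frame `basisAt` after a change of frame.
The latter frame is not continuous in the point, so that smoothness is a matter of charts alone. -/
theorem comp_eq_pull (e : OpenPartialHomeomorph M E4) (T : TensorField M) (y : E4) :
    comp e T y = pull (coordMat e y) (matAt T (e.symm y)) := by
  have := bilinMat_combine (T (e.symm y)) (coordMat e y) (basisAt (e.symm y))
  rw [← coordVec_eq] at this
  exact this

theorem volComp_eq_pullVol (e : OpenPartialHomeomorph M E4) (η : FourForm M) (y : E4) :
    volComp e η y = pullVol (coordMat e y) (volAt η (e.symm y)) := by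
  have := altTen_combine (η (e.symm y)) (coordMat e y) (basisAt (e.symm y))
  rw [← coordVec_eq] at this
  exact this

variable [IsManifold (𝓡 4) ∞ M]

/-- The coordinate vector fields of a smooth chart form a frame. -/
theorem isUnit_det_coordMat {e : OpenPartialHomeomorph M E4}
    (he : e ∈ IsManifold.maximalAtlas (𝓡 4) ∞ M) {y : E4} (hy : y ∈ e.target) :
    IsUnit (coordMat e y).det := by
  have : IsManifold (𝓡 4) 1 M := IsManifold.of_le (n := ∞) (by simp)
  let φ : E4 ≃L[ℝ] TangentSpace (𝓡 4) (e.symm y) :=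
    (mdifferentiable_of_mem_maximalAtlas he).symm.mfderiv (x := y) hy
  let b : Module.Basis (Fin 4) ℝ (TangentSpace (𝓡 4) (e.symm y)) :=
    (EuclideanSpace.basisFun (Fin 4) ℝ).toBasis.map φ.toLinearEquiv
  have hb : coordVec e y = b := by
    funext i
    simp only [b, Module.Basis.map_apply, OrthonormalBasis.coe_toBasis,
      EuclideanSpace.basisFun_apply]
    rfl
  rw [coordMat, hb]
  exact (basisAt (e.symm y)).isUnit_det b

end Charts

namespace OrientedSpacetime

variable {M : Type*} [TopologicalSpace M] [ChartedSpace E4 M] (S : OrientedSpacetime M)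

theorem exists_frame (p : M) : ∃ L, pull L (matAt S.g p) = mink := by
  obtain ⟨b, hb⟩ := S.signature p
  refine ⟨(basisAt p).toMatrix b, ?_⟩
  have := bilinMat_combine (S.g p) ((basisAt p).toMatrix b) (basisAt p)
  have e : combine ((basisAt p).toMatrix b) (basisAt p) = b :=
    funext fun _ => Module.Basis.sum_toMatrix_smul_self _ _ _
  rw [e] at this
  refine this.symm.trans ?_
  ext i j
  exact hb i j

theorem isUnit_det_matAt (p : M) : IsUnit (matAt S.g p).det :=
  isUnit_det_metric (S.exists_frame p).choose_spec

theorem matAt_transpose (p : M) : (matAt S.g p)ᵀ = matAt S.g p := by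
  ext i j; exact S.symm p _ _

theorem comp_transpose (e : OpenPartialHomeomorph M E4) (y : E4) :
    (comp e S.g y)ᵀ = comp e S.g y := by
  ext i j; exact S.symm _ _ _

/-- The metric volume element is `±1` on orthonormal frames. -/
theorem exists_frameVol {p : M} {v : Fin 4 → TangentSpace (𝓡 4) p} {L : Mat4}
    (hL : pull L (bilinMat (S.g p) v) = mink) :
    ∃ o : ℝ, pullVol L (altTen (S.η p) v) = frameVol o ∧ o ^ 2 = 1 := by
  refine ⟨S.η p (combine L v), ?_, ?_⟩
  · rw [← altTen_combine, altTen_eq_frameVol]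
  · rw [S.vol_sq]
    have : (Matrix.of fun i j => S.g p (combine L v i) (combine L v j)) = mink := by
      rw [← hL, ← bilinMat_combine]; rfl
    rw [this, mink_det]; norm_num

variable [IsManifold (𝓡 4) ∞ M] {e : OpenPartialHomeomorph M E4} {y : E4}

theorem exists_frame_comp (he : e ∈ IsManifold.maximalAtlas (𝓡 4) ∞ M) (hy : y ∈ e.target) :
    ∃ L, pull L (comp e S.g y) = mink := by
  obtain ⟨L, hL⟩ := S.exists_frame (e.symm y)
  refine ⟨(coordMat e y)⁻¹ * L, ?_⟩
  rw [comp_eq_pull, pull_pull, ← mul_assoc, Matrix.mul_nonsing_inv _ (isUnit_det_coordMat he hy),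
    one_mul, hL]

end OrientedSpacetime

section Smooth

variable {M : Type*} [TopologicalSpace M]

theorem isOpen_coordDom (e : OpenPartialHomeomorph M E4) {W : Set M} (hW : IsOpen W) :
    IsOpen (coordDom e W) := e.symm.isOpen_inter_preimage hW

theorem coordDom_univ (e : OpenPartialHomeomorph M E4) : coordDom e Set.univ = e.target := by
  simp [coordDom]

variable [ChartedSpace E4 M]

theorem SmoothOn.matSmoothAt {T : TensorField M} {W : Set M} (hT : SmoothOn T W) (hW : IsOpen W)
    {e : OpenPartialHomeomorph M E4} (he : e ∈ IsManifold.maximalAtlas (𝓡 4) ∞ M) {y : E4}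
    (hy : y ∈ coordDom e W) : MatSmoothAt (comp e T) y := fun i j =>
  (hT e he i j).contDiffAt ((isOpen_coordDom e hW).mem_nhds hy)

theorem smoothOn_of_matSmoothAt {T : TensorField M} {W : Set M}
    (h : ∀ e ∈ IsManifold.maximalAtlas (𝓡 4) ∞ M, ∀ y ∈ coordDom e W, MatSmoothAt (comp e T) y) :
    SmoothOn T W := fun e he i j y hy => (h e he y hy i j).contDiffWithinAt

theorem SkewOn.matAt_transpose {A : TensorField M} {W : Set M} (hA : SkewOn A W) {p : M}
    (hp : p ∈ W) : (matAt A p)ᵀ = -matAt A p := by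
  ext i j; exact hA p hp _ _

theorem SkewOn.comp_transpose {A : TensorField M} {W : Set M} (hA : SkewOn A W)
    {e : OpenPartialHomeomorph M E4} {y : E4} (hy : y ∈ coordDom e W) :
    (comp e A y)ᵀ = -comp e A y := by
  ext i j; exact hA _ hy.2 _ _

theorem matAt_toBilin (F : M → Mat4) (p : M) :
    matAt (fun p => Matrix.toBilin (basisAt p) (F p)) p = F p := by
  have := LinearMap.BilinForm.toMatrix_toBilin (basisAt p) (F p)
  ext i j
  have := congrFun (congrFun this i) j
  rwa [LinearMap.BilinForm.toMatrix_apply] at this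

theorem apply_eq_matAt (T : TensorField M) (p : M) (x y : TangentSpace (𝓡 4) p) :
    T p x y = ((basisAt p).repr x) ⬝ᵥ matAt T p *ᵥ ((basisAt p).repr y) := by
  have h := LinearMap.BilinForm.apply_eq_dotProduct_toMatrix_mulVec (basisAt p) (T p) x y
  have e : LinearMap.BilinForm.toMatrix (basisAt p) (T p) = matAt T p := by
    ext i j; rw [LinearMap.BilinForm.toMatrix_apply]; rfl
  rwa [e] at h

end Smooth

/-! ### Smoothness of the algebraic constructions -/

section SmoothConstructions

variable {G T K X : E4 → Mat4} {y : E4}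

theorem MatSmoothAt.jordan (hG : MatSmoothAt G y) (hu : IsUnit (G y).det) (hT : MatSmoothAt T y)
    (hX : MatSmoothAt X y) : MatSmoothAt (fun z => jordan (G z) (T z) (X z)) y :=
  (hG.cross hu hT hX).add (hG.cross hu hX hT)

section

variable (hG : MatSmoothAt G y) (hs : ∀ z, (G z)ᵀ = G z) (hu : IsUnit (G y).det)
  (hT : MatSmoothAt T y) (hTt : ∀ z, (T z)ᵀ = T z) (hX : MatSmoothAt X y)
  (hXt : ∀ᶠ z in 𝓝 y, (X z)ᵀ = -X z)
  (htr : 0 < Rainich.tr (G y) (sq (G y) (T y)))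

include hG hs hu hT hTt hX hXt htr

theorem MatSmoothAt.act_Qten :
    MatSmoothAt (fun z => act (G z) (Qten (G z) (T z)) (X z)) y := by
  have hJ := hG.jordan hu hT hX
  have hr : ContDiffAt ℝ ∞ (fun z => (√(Rainich.tr (G z) (sq (G z) (T z))))⁻¹) y :=
    ((hG.tr hu (hG.cross hu hT hT)).sqrt htr.ne').inv (Real.sqrt_pos.2 htr).ne'
  refine (hJ.sub (.smul hr (hG.jordan hu hT hJ))).congr ?_
  filter_upwards [hXt, hG.isUnit_det_eventually hu] with z h1 h2
  exact Rainich.act_Qten (hs z) h2 (hTt z) h1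

theorem MatSmoothAt.Qform : ContDiffAt ℝ ∞ (fun z => Qform (G z) (T z) (X z)) y := by
  have hA := hG.act_Qten hs hu hT hTt hX hXt htr
  refine (contDiffAt_const.mul (hG.tr hu (hG.cross hu hA hX)) :
    ContDiffAt ℝ ∞ (fun z => -(1 / 2) * Rainich.tr (G z) (Rainich.cross (G z)
      (act (G z) (Qten (G z) (T z)) (X z)) (X z))) y).congr_of_eventuallyEq ?_
  filter_upwards [hXt] with z h1
  exact Qform_eq (hs z) h1

theorem MatSmoothAt.Fzero (hQ : 0 < Rainich.Qform (G y) (T y) (X y)) :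
    MatSmoothAt (fun z => Fzero (G z) (T z) (X z)) y := by
  have hq := hG.Qform hs hu hT hTt hX hXt htr
  have h2 : 0 < 2 * Rainich.Qform (G y) (T y) (X y) := by linarith
  exact .smul (((contDiffAt_const.mul hq).sqrt h2.ne').inv (Real.sqrt_pos.2 h2).ne')
    (hG.act_Qten hs hu hT hTt hX hXt htr)

end

theorem MatSmoothAt.hodge {η : E4 → Ten4} (hG : MatSmoothAt G y) (hu : IsUnit (G y).det)
    (hη : ∀ i j k l, ContDiffAt ℝ ∞ (fun z => η z i j k l) y) (hX : MatSmoothAt X y) :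
    MatSmoothAt (fun z => hodge (G z) (η z) (X z)) y := by
  intro α β
  have hr : MatSmoothAt (fun z => raise (G z) (X z)) y := ((hG.inv hu).mul hX).mul (hG.inv hu)
  exact contDiffAt_const.mul (ContDiffAt.sum fun μ _ => ContDiffAt.sum fun ν _ =>
    (hr μ ν).mul (hη μ ν α β))

end SmoothConstructions

/-! ### Canonical frames -/

theorem pull_skew (L : Mat4) {X : Mat4} (hX : Xᵀ = -X) : (pull L X)ᵀ = -pull L X := by
  rw [pull_transpose, hX, pull_neg]

/-- A frame `L` which is orthonormal for `g`, diagonalizes `K`, and on which `η` is `±1`. -/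
structure CanonicalFrame (g : Mat4) (η : Ten4) (K L : Mat4) (l1 l2 o : ℝ) : Prop where
  metric : pull L g = mink
  diag : pull L K = Matrix.diagonal ![-l1, l1, -l2, -l2]
  pos : 0 < l1
  nonneg : 0 ≤ l2
  vol : pullVol L η = frameVol o
  vol_sq : o ^ 2 = 1

namespace CanonicalFrame

variable {g K L : Mat4} {η : Ten4} {l1 l2 o : ℝ} (h : CanonicalFrame g η K L l1 l2 o)

include h

theorem isUnit : IsUnit L.det := isUnit_det_frame h.metric

theorem isUnit_metric : IsUnit g.det := isUnit_det_metric h.metric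

theorem symm : gᵀ = g := transpose_of_pull_eq_mink h.metric

theorem symm_sq : Kᵀ = K := by
  refine pull_injective h.isUnit ?_
  rw [← pull_transpose, h.diag, Matrix.diagonal_transpose]

theorem pull_neg_tracelessPart : pull L (-tracelessPart g K) =
    Matrix.diagonal ![(l1 + l2) / 2, -((l1 + l2) / 2), (l1 + l2) / 2, (l1 + l2) / 2] := by
  rw [pull_neg, ← tracelessPart_pull h.isUnit, h.metric, tracelessPart_canonical h.diag]
  ext i j
  fin_cases i <;> fin_cases j <;> simp

theorem neg_tracelessPart_transpose : (-tracelessPart g K)ᵀ = -tracelessPart g K := by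
  rw [Matrix.transpose_neg, tracelessPart_transpose h.symm h.symm_sq]

theorem tr_sq_neg_tracelessPart_pos :
    0 < tr g (sq g (-tracelessPart g K)) := by
  rw [← tr_pull h.isUnit, ← sq_pull h.isUnit, h.pull_neg_tracelessPart, h.metric, tr_mink]
  have := h.pos
  have := h.nonneg
  simp only [sq, cross_mink_apply]
  simp
  positivity

section

variable {X : Mat4} (hX : Xᵀ = -X)

include hX

theorem Qform_eq : Qform g (-tracelessPart g K) X = 2 * (l1 + l2) * pull L X 0 1 ^ 2 := by
  rw [← Qform_pull h.isUnit h.symm h.isUnit_metric h.neg_tracelessPart_transpose hX, h.metric,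
    Qform_canonical (by linarith [h.pos, h.nonneg]) h.pull_neg_tracelessPart (pull_skew L hX)]

theorem Qform_pos (hQ : Qform g (-tracelessPart g K) X ≠ 0) :
    0 < Qform g (-tracelessPart g K) X := by
  refine lt_of_le_of_ne ?_ hQ.symm
  have := h.pos
  have := h.nonneg
  rw [h.Qform_eq hX]
  positivity

theorem pull_Fzero (hQ : Qform g (-tracelessPart g K) X ≠ 0) :
    ∃ f, pull L (Fzero g (-tracelessPart g K) X) = canForm f 0 ∧ f ^ 2 = l1 + l2 := by
  have hQ' := hQ
  rw [← Qform_pull h.isUnit h.symm h.isUnit_metric h.neg_tracelessPart_transpose hX,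
    h.metric] at hQ'
  rw [← Fzero_pull h.isUnit h.symm h.isUnit_metric h.neg_tracelessPart_transpose hX, h.metric]
  exact Fzero_canonical (by linarith [h.pos, h.nonneg]) h.pull_neg_tracelessPart (pull_skew L hX)
    hQ'

theorem pull_kyForm {ε : ℝ} (hε : ε ^ 2 = 1) (hQ : Qform g (-tracelessPart g K) X ≠ 0) :
    ∃ x y, pull L (kyForm g η K ε X) = canForm x y ∧ x ^ 2 = l1 ∧ y ^ 2 = l2 ∧
      x * y = -(o * ε) * √(l1 * l2) := by
  rw [← Qform_pull h.isUnit h.symm h.isUnit_metric h.neg_tracelessPart_transpose hX,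
    h.metric, pull_neg, ← tracelessPart_pull h.isUnit, h.metric] at hQ
  rw [← kyForm_pull h.isUnit h.symm h.isUnit_metric h.symm_sq hX, h.metric, h.vol]
  exact kyForm_canonical h.diag h.pos h.nonneg h.vol_sq hε (pull_skew L hX) hQ

end

theorem kyForm_skew_and_sq {X : Mat4} {ε : ℝ} (hε : ε ^ 2 = 1) (hX : Xᵀ = -X)
    (hQ : Qform g (-tracelessPart g K) X ≠ 0) :
    (kyForm g η K ε X)ᵀ = -kyForm g η K ε X ∧ K = sq g (kyForm g η K ε X) := by
  obtain ⟨x, y, h1, h2, h3, -⟩ := h.pull_kyForm hX hε hQ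
  constructor
  · refine pull_injective h.isUnit ?_
    rw [← pull_transpose, h1, pull_neg, h1, canForm_transpose]
  · refine pull_injective h.isUnit ?_
    rw [← sq_pull h.isUnit, h.metric, h1, h.diag, sq_canForm, h2, h3]

/-- A 2-form with components `x`, `y` along the blades of a canonical frame is regular if
`x ≠ 0`. -/
theorem regular {A : Mat4} {x y : ℝ} (hA : pull L A = canForm x y) (hx : x ≠ 0) :
    ¬ (tr g (sq g A) = 0 ∧ tr g (cross g A (hodge g η A)) = 0) := by
  rintro ⟨h1, h2⟩
  rw [← tr_pull h.isUnit, ← sq_pull h.isUnit, h.metric, hA, tr_sq_canForm] at h1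
  rw [← tr_pull h.isUnit, ← cross_pull h.isUnit, ← hodge_pull h.isUnit, h.metric, h.vol, hA,
    tr_cross_hodge_canForm] at h2
  have ho : o ≠ 0 := by rintro rfl; simpa using h.vol_sq
  have hy : y = 0 := by simpa [ho, hx] using h2
  rw [hy] at h1
  exact hx (by simpa using h1)

/-- A square root of `K` in a canonical frame. -/
theorem pull_of_sq_eq {A : Mat4} (hA : Aᵀ = -A) (hK : K = sq g A) :
    ∃ x y, pull L A = canForm x y ∧ x ^ 2 = l1 ∧ y ^ 2 = l2 := by
  have := eq_canForm_of_sq_eq (pull_skew L hA)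
    (by rw [← h.diag, hK, ← sq_pull h.isUnit, h.metric]) (by linarith [h.pos, h.nonneg])
  exact ⟨_, _, this⟩

theorem tr_eq : tr g K = 2 * (l1 - l2) := by
  rw [← tr_pull h.isUnit, h.metric]; exact tr_canonical h.diag

theorem tr_sq_eq : tr g (sq g K) = 2 * (l1 ^ 2 + l2 ^ 2) := by
  rw [← tr_pull h.isUnit, ← sq_pull h.isUnit, h.metric]; exact tr_sq_canonical h.diag

end CanonicalFrame

/-! ### The Killing-Yano tensor built from an admissible 2-form -/

theorem matAt_transpose_of_symm {M : Type*} [TopologicalSpace M] [ChartedSpace E4 M]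
    {K : TensorField M} (hK : ∀ p x y, K p x y = K p y x) (p : M) :
    (matAt K p)ᵀ = matAt K p := by
  ext i j; exact hK _ _ _

theorem skewOn_of_matAt {M : Type*} [TopologicalSpace M] [ChartedSpace E4 M] {A : TensorField M}
    {W : Set M} (h : ∀ p ∈ W, (matAt A p)ᵀ = -matAt A p) : SkewOn A W := by
  intro p hp x y
  rw [apply_eq_matAt, apply_eq_matAt, Matrix.dotProduct_mulVec, dotProduct_comm,
    ← Matrix.mulVec_transpose, h p hp, Matrix.neg_mulVec, dotProduct_neg]

theorem comp_transpose_of_symm {M : Type*} [TopologicalSpace M] [ChartedSpace E4 M]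
    {K : TensorField M} (hK : ∀ p x y, K p x y = K p y x) (e : OpenPartialHomeomorph M E4)
    (y : E4) : (comp e K y)ᵀ = comp e K y := by
  ext i j; exact hK _ _ _

namespace OrientedSpacetime

variable {M : Type*} [TopologicalSpace M] [ChartedSpace E4 M] (S : OrientedSpacetime M)
  {K X : TensorField M}

theorem algebraicCond_iff :
    S.AlgebraicCond K ↔ ∀ p, AlgebraicAt (matAt S.g p) (matAt K p) := by
  have h : (∀ p x, S.g p x x < 0 → K p x x < 0) ↔ ∀ p, ∀ x : Fin 4 → ℝ,
      x ⬝ᵥ matAt S.g p *ᵥ x < 0 → x ⬝ᵥ matAt K p *ᵥ x < 0 := by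
    refine forall_congr' fun p => ?_
    rw [(basisAt p).equivFun.toEquiv.forall_congr_left]
    refine forall_congr' fun x => ?_
    rw [apply_eq_matAt, apply_eq_matAt]
    have e : ((basisAt p).repr ((basisAt p).equivFun.toEquiv.symm x) : Fin 4 → ℝ) = x :=
      (basisAt p).equivFun.apply_symm_apply x
    rw [e]
  rw [AlgebraicCond, h, ← forall_and]
  rfl

theorem IndexDefined.indexDefinedAt {S : OrientedSpacetime M} (h : S.IndexDefined K) (p : M) :
    IndexDefinedAt (matAt S.g p) (matAt K p) := h.imp (fun h => h p) fun h => h p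

variable {S} (hK : ∀ p x y, K p x y = K p y x) (halg : S.AlgebraicCond K) (hψ : S.IndexDefined K)

include hK halg hψ in
theorem exists_canonicalFrame (p : M) : ∃ L l1 l2 o,
    CanonicalFrame (matAt S.g p) (volAt S.η p) (matAt K p) L l1 l2 o := by
  obtain ⟨L, l1, l2, h1, h2, h3, h4⟩ := exists_canonical_frame (S.exists_frame p)
    (matAt_transpose_of_symm hK p) (S.algebraicCond_iff.1 halg p) (hψ.indexDefinedAt p).le
  obtain ⟨o, ho, ho2⟩ := S.exists_frameVol (v := basisAt p) h1
  exact ⟨L, l1, l2, o, h1, h2, h3, h4, ho, ho2⟩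

theorem matAt_kyTensor (K X : TensorField M) (ε : ℝ) (p : M) : matAt (S.kyTensor K ε X) p =
    kyForm (matAt S.g p) (volAt S.η p) (matAt K p) ε (matAt X p) := matAt_toBilin _ p

include hK halg hψ in
theorem isSquareOn_kyTensor {W : Set M} (hX : S.Admissible K X W) {ε : ℝ} (hε : ε ^ 2 = 1) {p : M}
    (hp : p ∈ W) : (matAt (S.kyTensor K ε X) p)ᵀ = -matAt (S.kyTensor K ε X) p ∧
      matAt K p = sq (matAt S.g p) (matAt (S.kyTensor K ε X) p) := by
  obtain ⟨L, l1, l2, o, hL⟩ := exists_canonicalFrame hK halg hψ p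
  rw [matAt_kyTensor]
  exact hL.kyForm_skew_and_sq hε (hX.1.matAt_transpose hp) (hX.2.2 p hp)

include hK halg hψ in
/-- A 2-form with square `K` is admissible. -/
theorem admissible_of_isSquareOn {A : TensorField M} {W : Set M} (hA : SkewOn A W)
    (hAs : SmoothOn A W) (hsq : S.IsSquareOn K A W) : S.Admissible K A W := by
  refine ⟨hA, hAs, fun p hp => ?_⟩
  obtain ⟨L, l1, l2, o, hL⟩ := exists_canonicalFrame hK halg hψ p
  have hAt := hA.matAt_transpose hp
  obtain ⟨x, w, hx, hx1, -⟩ := hL.pull_of_sq_eq hAt (hsq p hp)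
  have h1 := hL.pos
  have h2 := hL.nonneg
  have : canForm x w 0 1 ^ 2 = l1 := by rw [← hx1]; simp [canForm]
  rw [hL.Qform_eq hAt, hx, this]
  positivity

variable {e : OpenPartialHomeomorph M E4} {y : E4}
  (he : e ∈ IsManifold.maximalAtlas (𝓡 4) ∞ M) (hKs : SmoothOn K Set.univ)

include he hKs in
theorem matSmoothAt_of_smoothOn_univ (hy : y ∈ e.target) : MatSmoothAt (comp e K) y :=
  hKs.matSmoothAt isOpen_univ he (by rwa [coordDom_univ])

variable [IsManifold (𝓡 4) ∞ M]

section

variable (hy : y ∈ e.target)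

include he hy

theorem tr_comp (T : TensorField M) :
    tr (comp e S.g y) (comp e T y) = tr (matAt S.g (e.symm y)) (matAt T (e.symm y)) := by
  rw [comp_eq_pull, comp_eq_pull, tr_pull (isUnit_det_coordMat he hy)]

theorem tr_sq_comp (T : TensorField M) : tr (comp e S.g y) (sq (comp e S.g y) (comp e T y)) =
    tr (matAt S.g (e.symm y)) (sq (matAt S.g (e.symm y)) (matAt T (e.symm y))) := by
  rw [comp_eq_pull, comp_eq_pull, sq_pull (isUnit_det_coordMat he hy),
    tr_pull (isUnit_det_coordMat he hy)]

theorem isUnit_det_comp : IsUnit (comp e S.g y).det :=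
  isUnit_det_metric (S.exists_frame_comp he hy).choose_spec

include hψ in
theorem IndexDefined.comp : tr (comp e S.g y) (comp e K y) ^ 2 <
      2 * tr (comp e S.g y) (sq (comp e S.g y) (comp e K y)) ∨
    ∀ᶠ z in 𝓝 y, tr (comp e S.g z) (comp e K z) ^ 2 =
      2 * tr (comp e S.g z) (sq (comp e S.g z) (comp e K z)) ∧
        0 < tr (comp e S.g z) (comp e K z) := by
  refine hψ.imp (fun h => ?_) fun h => ?_
  · rw [tr_comp he hy, tr_sq_comp he hy]; exact h _
  · filter_upwards [e.open_target.mem_nhds hy] with z hz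
    rw [tr_comp he hz, tr_sq_comp he hz]; exact h _

include hK halg hψ in
theorem exists_canonicalFrame_comp : ∃ L l1 l2 o,
    CanonicalFrame (Rainich.comp e S.g y) (volComp e S.η y) (Rainich.comp e K y) L l1 l2 o := by
  have hu := isUnit_det_coordMat he hy
  obtain ⟨L, l1, l2, h1, h2, h3, h4⟩ := exists_canonical_frame (S.exists_frame_comp he hy)
    (comp_transpose_of_symm hK e y)
    (by rw [comp_eq_pull, comp_eq_pull]
        exact (S.algebraicCond_iff.1 halg (e.symm y)).pull hu)
    (by rw [tr_comp he hy, tr_sq_comp he hy]; exact (hψ.indexDefinedAt _).le)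
  obtain ⟨o, ho, ho2⟩ := S.exists_frameVol (v := coordVec e y) h1
  exact ⟨L, l1, l2, o, h1, h2, h3, h4, ho, ho2⟩

include hK

/-- The formula for `A` may be evaluated in the frame of any chart. -/
theorem comp_kyTensor (hX : (matAt X (e.symm y))ᵀ = -matAt X (e.symm y)) (ε : ℝ) :
    Rainich.comp e (S.kyTensor K ε X) y = kyForm (Rainich.comp e S.g y) (volComp e S.η y)
      (Rainich.comp e K y) ε (Rainich.comp e X y) := by
  have hu := isUnit_det_coordMat he hy
  rw [comp_eq_pull e (S.kyTensor K ε X), matAt_kyTensor,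
    ← kyForm_pull hu (S.matAt_transpose _) (S.isUnit_det_matAt _) (matAt_transpose_of_symm hK _) hX,
    ← comp_eq_pull, ← comp_eq_pull, ← comp_eq_pull, ← volComp_eq_pullVol]

theorem Qform_comp (hX : (matAt X (e.symm y))ᵀ = -matAt X (e.symm y)) :
    Qform (Rainich.comp e S.g y) (-tracelessPart (Rainich.comp e S.g y) (Rainich.comp e K y))
      (Rainich.comp e X y) = Qform (matAt S.g (e.symm y))
        (-tracelessPart (matAt S.g (e.symm y)) (matAt K (e.symm y))) (matAt X (e.symm y)) := by
  have hu := isUnit_det_coordMat he hy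
  rw [comp_eq_pull, comp_eq_pull, comp_eq_pull, tracelessPart_pull hu, ← pull_neg,
    Qform_pull hu (S.matAt_transpose _) (S.isUnit_det_matAt _) _ hX]
  rw [Matrix.transpose_neg, tracelessPart_transpose (S.matAt_transpose _)
    (matAt_transpose_of_symm hK _)]

end

section

variable {W : Set M} (hW : IsOpen W) (hX : S.Admissible K X W)

include hK halg hψ hW hX

include he hKs in
theorem matSmoothAt_Fzero_comp (hy : y ∈ coordDom e W) :
    MatSmoothAt (fun z => Fzero (Rainich.comp e S.g z)
      (-tracelessPart (Rainich.comp e S.g z) (Rainich.comp e K z)) (Rainich.comp e X z)) y := by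
  obtain ⟨L, l1, l2, o, hL⟩ := exists_canonicalFrame_comp hK halg hψ he hy.1
  have hG := matSmoothAt_of_smoothOn_univ he S.smooth hy.1
  have hKc := matSmoothAt_of_smoothOn_univ he hKs hy.1
  have hXt := hX.1.comp_transpose hy
  refine hG.Fzero (S.comp_transpose e) hL.isUnit_metric (hG.tracelessPart hL.isUnit_metric hKc).neg
    (fun z => ?_) (hX.2.1.matSmoothAt hW he hy) ?_ hL.tr_sq_neg_tracelessPart_pos
    (hL.Qform_pos hXt ?_)
  · rw [Matrix.transpose_neg, tracelessPart_transpose (S.comp_transpose e z)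
      (comp_transpose_of_symm hK e z)]
  · filter_upwards [(isOpen_coordDom e hW).mem_nhds hy] with z hz
    exact hX.1.comp_transpose hz
  · rw [Qform_comp hK he hy.1 (hX.1.matAt_transpose hy.2)]
    exact hX.2.2 _ hy.2

include hKs in
/-- The coefficients `cos ψ` and `sin ψ` are smooth because `ψ` is smooth where `a² < 2b`, and
constant if `a² = 2b` everywhere. -/
theorem smoothOn_kyTensor (ε : ℝ) : SmoothOn (S.kyTensor K ε X) W := by
  refine smoothOn_of_matSmoothAt fun e he y hy => ?_
  obtain ⟨L, l1, l2, o, hL⟩ := exists_canonicalFrame_comp hK halg hψ he hy.1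
  have hG := matSmoothAt_of_smoothOn_univ he S.smooth hy.1
  have hKc := matSmoothAt_of_smoothOn_univ he hKs hy.1
  have hF := matSmoothAt_Fzero_comp hK halg hψ he hKs hW hX hy
  have hv : ∀ i j k l, ContDiffAt ℝ ∞ (fun z => volComp e S.η z i j k l) y := fun i j k l =>
    (S.vol_smooth e he i j k l).contDiffAt (e.open_target.mem_nhds hy.1)
  have hi : ContDiffAt ℝ ∞ (fun z => rainichIndex (Rainich.comp e S.g z) (Rainich.comp e K z)) y :=
    (hψ.comp he hy.1).elim (contDiffAt_rainichIndex hG hL.isUnit_metric hKc) fun h =>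
      (contDiffAt_const (c := 0)).congr_of_eventuallyEq
        (h.mono fun z hz => rainichIndex_eq_zero hz.1)
  refine ((MatSmoothAt.smul hi.cos hF).add (.smul (contDiffAt_const.mul hi.sin)
    (hG.hodge hL.isUnit_metric hv hF))).congr (?_ : ∀ᶠ z in 𝓝 y, _ = kyForm _ _ _ ε _)
  filter_upwards [(isOpen_coordDom e hW).mem_nhds hy] with z hz
  exact comp_kyTensor hK he hz.1 (hX.1.matAt_transpose hz.2) ε

end

/-- In a chart, a 2-form with square `K` is a `LocalSquare`. -/
theorem localSquare {A : TensorField M} (he : e ∈ IsManifold.maximalAtlas (𝓡 4) ∞ M)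
    (hψ : S.IndexDefined K) {W : Set M} (hW : IsOpen W) (hA : SkewOn A W) (hAs : SmoothOn A W)
    (hsq : S.IsSquareOn K A W) (hy : y ∈ coordDom e W) {L : Mat4} {l1 l2 o x w : ℝ}
    (hL : CanonicalFrame (Rainich.comp e S.g y) (volComp e S.η y) (Rainich.comp e K y) L l1 l2 o)
    (hx : pull L (Rainich.comp e A y) = canForm x w) (hx1 : x ^ 2 = l1) :
    LocalSquare (Rainich.comp e S.g) (Rainich.comp e K) (Rainich.comp e A) y L x w where
  smooth_metric := matSmoothAt_of_smoothOn_univ he S.smooth hy.1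
  symm := S.comp_transpose e
  frame := by
    filter_upwards [e.open_target.mem_nhds hy.1] with z hz
    exact S.exists_frame_comp he hz
  smooth := hAs.matSmoothAt hW he hy
  skew := by
    filter_upwards [(isOpen_coordDom e hW).mem_nhds hy] with z hz
    exact hA.comp_transpose hz
  square := by
    filter_upwards [(isOpen_coordDom e hW).mem_nhds hy] with z hz
    rw [comp_eq_pull, comp_eq_pull, comp_eq_pull, sq_pull (isUnit_det_coordMat he hz.1),
      hsq _ hz.2]
  pull_metric := hL.metric
  pull_form := hx
  ne_zero := by
    rintro rfl
    have := hL.pos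
    rw [← hx1] at this
    simp at this
  index := hψ.comp he hy.1

/-- The 2-form built from an admissible 2-form is a regular Killing-Yano tensor with square `K`. -/
theorem isRegularKYOn_kyTensor (hK : ∀ p x y, K p x y = K p y x) (hKs : SmoothOn K Set.univ)
    (hψ : S.IndexDefined K) {ε : ℝ} (hε : ε ^ 2 = 1) (hc : S.CondWith K ε) {W : Set M}
    (hW : IsOpen W) (hX : S.Admissible K X W) :
    S.IsRegularKYOn (S.kyTensor K ε X) W ∧ S.IsSquareOn K (S.kyTensor K ε X) W := by
  obtain ⟨halg, hKil, hR⟩ := hc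
  have hpt : ∀ p ∈ W, _ := fun p hp => isSquareOn_kyTensor hK halg hψ hX hε hp
  have hskew : SkewOn (S.kyTensor K ε X) W := skewOn_of_matAt fun p hp => (hpt p hp).1
  have hsm := smoothOn_kyTensor hK halg hψ hKs hW hX ε
  have hsq : S.IsSquareOn K (S.kyTensor K ε X) W := fun p hp => (hpt p hp).2
  refine ⟨⟨hskew, hsm, ?_, ?_⟩, hsq⟩
  · intro e he y hy
    obtain ⟨L, l1, l2, o, hL⟩ := exists_canonicalFrame_comp hK halg hψ he hy.1
    have hXt := hX.1.matAt_transpose hy.2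
    obtain ⟨x, w, hx, hx1, hx2, hxw⟩ := hL.pull_kyForm (hX.1.comp_transpose hy) hε
      (by rw [Qform_comp hK he hy.1 hXt]; exact hX.2.2 _ hy.2)
    rw [← comp_kyTensor hK he hy.1 hXt] at hx
    exact (localSquare he hψ hW hskew hsm hsq hy hL hx hx1).skewFirst_cov hL.vol hL.vol_sq hε
      (by rw [hxw, hx1, hx2]) (hKil e he y hy.1) (hR e he y hy.1)
  · intro p hp
    obtain ⟨L, l1, l2, o, hL⟩ := exists_canonicalFrame hK halg hψ p
    obtain ⟨x, w, hx, hx1, -⟩ := hL.pull_kyForm (hX.1.matAt_transpose hp) hε (hX.2.2 p hp)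
    rw [← matAt_kyTensor] at hx
    refine hL.regular hx ?_
    rintro rfl
    have := hL.pos
    rw [← hx1] at this
    simp at this

/-! ### The square of a regular Killing-Yano tensor -/

/-- The invariant `A_{αβ} (*A)^{αβ}`, up to a constant factor. -/
def pseudoscalar (S : OrientedSpacetime M) (A : TensorField M) (p : M) : ℝ :=
  tr (matAt S.g p) (cross (matAt S.g p) (matAt A p) (hodge (matAt S.g p) (volAt S.η p) (matAt A p)))

theorem pseudoscalar_symm (he : e ∈ IsManifold.maximalAtlas (𝓡 4) ∞ M) (hy : y ∈ e.target)
    (A : TensorField M) : S.pseudoscalar A (e.symm y) =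
      tr (Rainich.comp e S.g y) (cross (Rainich.comp e S.g y) (Rainich.comp e A y)
        (hodge (Rainich.comp e S.g y) (volComp e S.η y) (Rainich.comp e A y))) := by
  have hu := isUnit_det_coordMat he hy
  rw [comp_eq_pull, comp_eq_pull, volComp_eq_pullVol, hodge_pull hu, cross_pull hu, tr_pull hu,
    pseudoscalar]

theorem continuous_pseudoscalar {A : TensorField M} (hA : SmoothOn A Set.univ) :
    Continuous (S.pseudoscalar A) := by
  rw [continuous_iff_continuousAt]
  intro p
  set e := chartAt E4 p
  have he : e ∈ IsManifold.maximalAtlas (𝓡 4) ∞ M := IsManifold.chart_mem_maximalAtlas p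
  have hp : p ∈ e.source := mem_chart_source E4 p
  have hy : e p ∈ e.target := e.map_source hp
  have hG := matSmoothAt_of_smoothOn_univ he S.smooth hy
  have hu := isUnit_det_comp (S := S) he hy
  have hAc := matSmoothAt_of_smoothOn_univ he hA hy
  have hv : ∀ i j k l, ContDiffAt ℝ ∞ (fun z => volComp e S.η z i j k l) (e p) := fun i j k l =>
    (S.vol_smooth e he i j k l).contDiffAt (e.open_target.mem_nhds hy)
  have hc := (hG.tr hu (hG.cross hu hAc (hG.hodge hu hv hAc))).continuousAt.comp
    (e.continuousAt hp)
  refine hc.congr ?_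
  filter_upwards [e.open_source.mem_nhds hp] with q hq
  have := pseudoscalar_symm (S := S) he (e.map_source hq) A
  rw [e.left_inv hq] at this
  exact this.symm

/-- The square of the pseudoscalar of `A` is `2 (2b - a²)`. Hence the pseudoscalar has no zeros or
vanishes identically, and it does not change its sign on a connected spacetime. -/
theorem exists_sign_pseudoscalar [ConnectedSpace M] (hK : ∀ p x y, K p x y = K p y x)
    (halg : S.AlgebraicCond K) (hψ : S.IndexDefined K) {A : TensorField M}
    (hA : SkewOn A Set.univ) (hAs : SmoothOn A Set.univ) (hsq : S.IsSquareOn K A Set.univ) :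
    ∃ ε : ℝ, (ε = 1 ∨ ε = -1) ∧ ∀ p, ε * S.pseudoscalar A p ≤ 0 := by
  have h0 : ∀ p, S.pseudoscalar A p ^ 2 = 2 * (2 * tr (matAt S.g p) (sq (matAt S.g p) (matAt K p))
      - tr (matAt S.g p) (matAt K p) ^ 2) := by
    intro p
    obtain ⟨L, l1, l2, o, hL⟩ := exists_canonicalFrame hK halg hψ p
    obtain ⟨x, w, hx, hx1, hx2⟩ := hL.pull_of_sq_eq (hA.matAt_transpose (Set.mem_univ p))
      (hsq p (Set.mem_univ p))
    rw [hL.tr_eq, hL.tr_sq_eq, pseudoscalar, ← tr_pull hL.isUnit, ← cross_pull hL.isUnit,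
      ← hodge_pull hL.isUnit, hL.metric, hL.vol, hx, tr_cross_hodge_canForm, ← hx1, ← hx2]
    linear_combination 16 * x ^ 2 * w ^ 2 * hL.vol_sq
  have hcont := continuous_pseudoscalar (S := S) hAs
  by_contra! hcon
  obtain ⟨p, hp⟩ := hcon 1 (Or.inl rfl)
  obtain ⟨q, hq⟩ := hcon (-1) (Or.inr rfl)
  obtain ⟨r, hr⟩ := mem_range_of_exists_le_of_exists_ge hcont
    (⟨q, by linarith⟩ : ∃ q, S.pseudoscalar A q ≤ 0) ⟨p, by linarith⟩
  rcases hψ with h | h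
  · have := h0 r
    rw [hr] at this
    linarith [h r]
  · have := h0 p
    rw [← (h p).1, sub_self, mul_zero] at this
    have : S.pseudoscalar A p = 0 := by simpa using this
    linarith

/-- The conditions hold for the square of a regular Killing-Yano tensor; the sign `ε` in the
Rainich equation is opposite to that of the pseudoscalar. -/
theorem cond_of_isSquareOn [ConnectedSpace M] (hK : ∀ p x y, K p x y = K p y x)
    (hψ : S.IndexDefined K) {A : TensorField M} (hA : S.IsRegularKYOn A Set.univ)
    (hsq : S.IsSquareOn K A Set.univ) : S.Cond K ∧ S.Admissible K A Set.univ := by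
  obtain ⟨hA, hAs, hKY, -⟩ := hA
  have halg : S.AlgebraicCond K := S.algebraicCond_iff.2 fun p => by
    have := hψ.indexDefinedAt p
    rw [hsq p (Set.mem_univ p)] at this ⊢
    exact algebraicAt_sq (S.exists_frame p) (hA.matAt_transpose (Set.mem_univ p)) this
  refine ⟨?_, admissible_of_isSquareOn hK halg hψ hA hAs hsq⟩
  obtain ⟨ε, hε, hs⟩ := exists_sign_pseudoscalar hK halg hψ hA hAs hsq
  have hε2 : ε ^ 2 = 1 := by rcases hε with rfl | rfl <;> norm_num
  have key : ∀ e ∈ IsManifold.maximalAtlas (𝓡 4) ∞ M, ∀ y ∈ e.target,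
      CyclicZero (cov (Rainich.comp e S.g) (Rainich.comp e K) y) ∧ ∀ δ,
        -2 * pd (fun z => rainichIndex (Rainich.comp e S.g z) (Rainich.comp e K z)) δ y =
          ε * rainichForm (Rainich.comp e S.g) (volComp e S.η y)
            (fun z => tracelessPart (Rainich.comp e S.g z) (Rainich.comp e K z)) y δ := by
    intro e he y hy
    have hy' : y ∈ coordDom e Set.univ := by rwa [coordDom_univ]
    have hu := isUnit_det_coordMat he hy
    obtain ⟨L, l1, l2, o, hL⟩ := exists_canonicalFrame_comp hK halg hψ he hy
    obtain ⟨x, w, hx, hx1, hx2⟩ := hL.pull_of_sq_eq (hA.comp_transpose hy')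
      (by rw [comp_eq_pull, comp_eq_pull, comp_eq_pull, sq_pull hu, hsq _ (Set.mem_univ _)])
    have hs' := hs (e.symm y)
    rw [pseudoscalar_symm he hy, ← tr_pull hL.isUnit, ← cross_pull hL.isUnit,
      ← hodge_pull hL.isUnit, hL.metric, hL.vol, hx, tr_cross_hodge_canForm] at hs'
    have hsign : x * w = -(o * ε) * √(x ^ 2 * w ^ 2) := by
      have h1 : √(x ^ 2 * w ^ 2) = -(o * ε * (x * w)) := by
        rw [show x ^ 2 * w ^ 2 = (-(o * ε * (x * w))) ^ 2 by
          linear_combination (-(ε ^ 2 * x ^ 2 * w ^ 2)) * hL.vol_sq - x ^ 2 * w ^ 2 * hε2]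
        exact Real.sqrt_sq (by linarith)
      rw [h1]
      linear_combination (-(ε ^ 2 * x * w)) * hL.vol_sq - x * w * hε2
    exact (localSquare he hψ isOpen_univ hA hAs hsq hy' hL hx hx1).killing_and_rainich hL.vol hε2
      hsign (hKY e he y hy')
  exact ⟨ε, hε, halg, fun e he y hy => (key e he y hy).1, fun e he y hy => (key e he y hy).2⟩

end OrientedSpacetime

/-! ### Local existence of admissible 2-forms -/

section ConstantForm

variable {M : Type*} [TopologicalSpace M] [ChartedSpace E4 M]

/-- The matrix of an endomorphism of the model space. -/
def derivMat (f : E4 →L[ℝ] E4) : Mat4 :=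
  LinearMap.toMatrix (EuclideanSpace.basisFun (Fin 4) ℝ).toBasis
    (EuclideanSpace.basisFun (Fin 4) ℝ).toBasis f

theorem derivMat_apply (f : E4 →L[ℝ] E4) (i j : Fin 4) :
    derivMat f i j = f (EuclideanSpace.single j 1) i := by
  simp [derivMat, LinearMap.toMatrix_apply]

theorem derivMat_comp (f g : E4 →L[ℝ] E4) : derivMat (f.comp g) = derivMat f * derivMat g :=
  LinearMap.toMatrix_comp _ _ _ _ _

/-- The derivative of the inverse of a chart, the tangent spaces being identified with the model
space, as they are by `basisAt`. -/
def symmDeriv (e : OpenPartialHomeomorph M E4) (y : E4) : E4 →L[ℝ] E4 :=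
  mfderiv 𝓘(ℝ, E4) (𝓡 4) e.symm y

theorem coordMat_eq_derivMat (e : OpenPartialHomeomorph M E4) (y : E4) :
    coordMat e y = derivMat (symmDeriv e y) := by
  ext i j
  exact (derivMat_apply (symmDeriv e y) i j).symm

/-- The field of 2-tensors with constant components `X₀` in the chart `e₀`. -/
def constField (e₀ : OpenPartialHomeomorph M E4) (X₀ : Mat4) : TensorField M := fun q =>
  Matrix.toBilin (basisAt q) (pull (coordMat e₀ (e₀ q))⁻¹ X₀)

theorem matAt_constField (e₀ : OpenPartialHomeomorph M E4) (X₀ : Mat4) (q : M) :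
    matAt (constField e₀ X₀) q = pull (coordMat e₀ (e₀ q))⁻¹ X₀ := matAt_toBilin _ q

variable {e₀ e : OpenPartialHomeomorph M E4}
  (he₀ : e₀ ∈ IsManifold.maximalAtlas (𝓡 4) ∞ M) (he : e ∈ IsManifold.maximalAtlas (𝓡 4) ∞ M)

include he₀ he in
theorem matSmoothAt_derivMat {y : E4} (hy : y ∈ coordDom e e₀.source) :
    MatSmoothAt (fun z => derivMat (fderiv ℝ (e₀ ∘ e.symm) z)) y := by
  have h1 : ContMDiffAt 𝓘(ℝ, E4) 𝓘(ℝ, E4) ∞ (e₀ ∘ e.symm) y :=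
    ContMDiffAt.comp y ((contMDiffOn_of_mem_maximalAtlas he₀).contMDiffAt
      (e₀.open_source.mem_nhds hy.2)) ((contMDiffOn_symm_of_mem_maximalAtlas he).contMDiffAt
      (e.open_target.mem_nhds hy.1))
  have h2 : ContDiffAt ℝ ∞ (fderiv ℝ (e₀ ∘ e.symm)) y := h1.contDiffAt.fderiv_right (by simp)
  intro i j
  simp only [derivMat_apply]
  have h3 := h2.clm_apply (contDiffAt_const (c := EuclideanSpace.single j (1 : ℝ)))
  exact (EuclideanSpace.proj (𝕜 := ℝ) i).contDiff.contDiffAt.comp y h3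

include he₀ he in
/-- The change of coordinates formula for coordinate frames. -/
theorem coordMat_eq_mul {y : E4} (hy : y ∈ coordDom e e₀.source) :
    coordMat e y = coordMat e₀ (e₀ (e.symm y)) * derivMat (fderiv ℝ (e₀ ∘ e.symm) y) := by
  have hd := (mdifferentiable_of_mem_maximalAtlas he).mdifferentiableAt_symm hy.1
  have hd₀ := (mdifferentiable_of_mem_maximalAtlas he₀).mdifferentiableAt hy.2
  have hd₁ := (mdifferentiable_of_mem_maximalAtlas he₀).mdifferentiableAt_symm
    (e₀.map_source hy.2)
  have h1 : mfderiv 𝓘(ℝ, E4) (𝓡 4) e.symm y =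
      mfderiv 𝓘(ℝ, E4) (𝓡 4) (e₀.symm ∘ (e₀ ∘ e.symm)) y := by
    refine Filter.EventuallyEq.mfderiv_eq ?_
    filter_upwards [(isOpen_coordDom e e₀.open_source).mem_nhds hy] with z hz
    exact (e₀.left_inv hz.2).symm
  have h2 := h1.trans (mfderiv_comp (I := 𝓘(ℝ, E4)) (I' := 𝓘(ℝ, E4)) (I'' := 𝓡 4) y
    (g := e₀.symm) (f := e₀ ∘ e.symm) hd₁ (hd₀.comp y hd))
  rw [mfderiv_eq_fderiv] at h2
  have h3 : symmDeriv e y =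
    (symmDeriv e₀ (e₀ (e.symm y))).comp (fderiv ℝ (e₀ ∘ e.symm) y) := h2
  rw [coordMat_eq_derivMat, coordMat_eq_derivMat, h3, derivMat_comp]

variable [IsManifold (𝓡 4) ∞ M]

theorem comp_constField_self (he₀ : e₀ ∈ IsManifold.maximalAtlas (𝓡 4) ∞ M) {X₀ : Mat4} {y : E4}
    (hy : y ∈ e₀.target) : comp e₀ (constField e₀ X₀) y = X₀ := by
  rw [comp_eq_pull, matAt_constField, e₀.right_inv hy, pull_pull,
    Matrix.nonsing_inv_mul _ (isUnit_det_coordMat he₀ hy), pull_one]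

include he₀ in
/-- In another chart the components are those of `X₀` multiplied by Jacobian matrices. -/
theorem smoothOn_constField (X₀ : Mat4) : SmoothOn (constField e₀ X₀) e₀.source := by
  refine smoothOn_of_matSmoothAt fun e he y hy => ?_
  have hJ := matSmoothAt_derivMat he₀ he hy
  have hJt : MatSmoothAt (fun z => (derivMat (fderiv ℝ (e₀ ∘ e.symm) z))ᵀ) y := fun i j => hJ j i
  refine ((hJt.mul (H := fun _ => X₀) fun i j => contDiffAt_const).mul hJ).congr ?_
  filter_upwards [(isOpen_coordDom e e₀.open_source).mem_nhds hy] with z hz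
  rw [comp_eq_pull, matAt_constField, pull_pull, coordMat_eq_mul he₀ he hz, ← mul_assoc,
    Matrix.nonsing_inv_mul _ (isUnit_det_coordMat he₀ (e₀.map_source hz.2)), one_mul, pull]

end ConstantForm

namespace OrientedSpacetime

variable {M : Type*} [TopologicalSpace M] [ChartedSpace E4 M] [IsManifold (𝓡 4) ∞ M]
  {S : OrientedSpacetime M} {K : TensorField M}

/-- Near any point, the form `e⁰ ∧ e¹` of a frame which is canonical at this point, extended with
constant components, is admissible. -/
theorem exists_admissible (hK : ∀ p x y, K p x y = K p y x) (hKs : SmoothOn K Set.univ)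
    (halg : S.AlgebraicCond K) (hψ : S.IndexDefined K) (p : M) :
    ∃ W : Set M, IsOpen W ∧ p ∈ W ∧ ∃ X, S.Admissible K X W := by
  set e := chartAt E4 p
  have he : e ∈ IsManifold.maximalAtlas (𝓡 4) ∞ M := IsManifold.chart_mem_maximalAtlas p
  have hp : p ∈ e.source := mem_chart_source E4 p
  have hy : e p ∈ e.target := e.map_source hp
  obtain ⟨L, l1, l2, o, hL⟩ := exists_canonicalFrame_comp hK halg hψ he hy
  set X₀ := pull L⁻¹ (canForm 1 0)
  have hX₀ : X₀ᵀ = -X₀ := pull_skew _ (canForm_transpose 1 0)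
  have hXt : ∀ q, (matAt (constField e X₀) q)ᵀ = -matAt (constField e X₀) q := fun q => by
    rw [matAt_constField]; exact pull_skew _ hX₀
  have hQ : ∀ q ∈ e.source, Qform (comp e S.g (e q))
      (-tracelessPart (comp e S.g (e q)) (comp e K (e q))) X₀ =
      Qform (matAt S.g q) (-tracelessPart (matAt S.g q) (matAt K q))
        (matAt (constField e X₀) q) := fun q hq => by
    have := Qform_comp (S := S) hK he (e.map_source hq) (hXt _)
    rwa [comp_constField_self he (e.map_source hq), e.left_inv hq] at this
  have hG := matSmoothAt_of_smoothOn_univ he S.smooth hy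
  have hKc := matSmoothAt_of_smoothOn_univ he hKs hy
  have hc := (hG.Qform (X := fun _ => X₀) (S.comp_transpose e) hL.isUnit_metric
    (hG.tracelessPart hL.isUnit_metric hKc).neg (fun z => by
      rw [Matrix.transpose_neg, tracelessPart_transpose (S.comp_transpose e z)
        (comp_transpose_of_symm hK e z)]) (fun i j => contDiffAt_const)
    (Eventually.of_forall fun _ => hX₀) hL.tr_sq_neg_tracelessPart_pos).continuousAt.comp
      (e.continuousAt hp)
  have h0 : Qform (comp e S.g (e p)) (-tracelessPart (comp e S.g (e p)) (comp e K (e p))) X₀ ≠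
      0 := by
    have h1 := hL.pos
    have h2 := hL.nonneg
    rw [hL.Qform_eq hX₀, pull_pull, Matrix.nonsing_inv_mul _ hL.isUnit, pull_one]
    simp [canForm]
    linarith
  obtain ⟨W, hW, hWo, hpW⟩ := eventually_nhds_iff.1
    ((hc.eventually_ne h0).and (e.open_source.mem_nhds hp))
  refine ⟨W, hWo, hpW, constField e X₀, skewOn_of_matAt fun q _ => hXt q, ?_, fun q hq => ?_⟩
  · exact fun e' he' i j => (smoothOn_constField he X₀ e' he' i j).mono
      fun z hz => ⟨hz.1, (hW _ hz.2).2⟩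
  · rw [← hQ q (hW q hq).2]
    exact (hW q hq).1

end OrientedSpacetime

/-! ### Global existence of admissible 2-forms on simply connected spacetimes -/

/-- A cocycle of locally constant signs on a simply connected space is a coboundary: the double
covering that it defines has a section. -/
theorem exists_section_of_sign_cocycle {B : Type*} [TopologicalSpace B] [SimplyConnectedSpace B]
    [LocallyPathConnectedSpace B] {W : B → Set B} (hW : ∀ i, IsOpen (W i)) (hmem : ∀ p, p ∈ W p)
    (s : B → B → B → ℤˣ) (hself : ∀ i, ∀ x ∈ W i, s i i x = 1)
    (hloc : ∀ i j, ∀ x ∈ W i ∩ W j, ∀ᶠ z in 𝓝 x, s i j z = s i j x)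
    (hcomp : ∀ i j k, ∀ x ∈ W i ∩ W j ∩ W k, s j k x * s i j x = s i k x) :
    ∃ σ : B → ℤˣ, ∀ p, ∀ᶠ q in 𝓝 p, s q p q * σ q = σ p := by
  let Z : FiberBundleCore B B ℤˣ :=
    { baseSet := W
      isOpen_baseSet := hW
      indexAt := id
      mem_baseSet_at := hmem
      coordChange := fun i j x v => s i j x * v
      coordChange_self := fun i x hx v => by rw [hself i x hx, one_mul]
      continuousOn_coordChange := fun i j => by
        rintro ⟨x, v⟩ ⟨hx, -⟩
        refine ContinuousAt.continuousWithinAt ?_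
        have h1 : ContinuousAt (fun z => s i j z) x :=
          continuousAt_const.congr ((hloc i j x hx).mono fun z hz => hz.symm)
        exact (ContinuousAt.comp (f := Prod.fst) (x := (x, v)) h1 continuousAt_fst).mul
          continuousAt_snd
      coordChange_comp := fun i j k x hx v => by rw [← mul_assoc, hcomp i j k x hx] }
  have hcov : IsCoveringMap (Bundle.TotalSpace.proj : Z.TotalSpace → B) :=
    FiberBundle.isCoveringMap (F := ℤˣ) (E := Z.Fiber)
  obtain ⟨p₀⟩ : Nonempty B := inferInstance
  obtain ⟨F, ⟨-, hF⟩, -⟩ := hcov.existsUnique_continuousMap_lifts (ContinuousMap.id B) p₀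
    (⟨p₀, (1 : ℤˣ)⟩ : Z.TotalSpace) rfl
  have hF' : ∀ q, (F q).1 = q := fun q => congrFun hF q
  refine ⟨fun q => (F q).2, fun p => ?_⟩
  have hsrc : F p ∈ (Z.localTriv p).source := by
    rw [Z.mem_localTriv_source, ← Z.baseSet_at, hF']; exact hmem p
  have hc : ContinuousAt (fun q => (Z.localTriv p (F q)).2) p :=
    continuousAt_snd.comp (((Z.localTriv p).continuousAt hsrc).comp F.continuous.continuousAt)
  let τ : B → ℤˣ := fun q => (F q).2
  have hval : ∀ q, (Z.localTriv p (F q)).2 = s q p q * τ q := fun q => by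
    rw [Z.localTriv_apply]
    change s (F q).1 p (F q).1 * τ q = _
    rw [hF']
  have hd : ∀ᶠ q in 𝓝 p, (Z.localTriv p (F q)).2 = (Z.localTriv p (F p)).2 :=
    hc.eventually (eventually_nhds_iff.2 ⟨{_}, fun _ h => h, isOpen_discrete _, rfl⟩)
  filter_upwards [hd] with q hq
  rw [hval, hval, hself p p (hmem p), one_mul] at hq
  exact hq

namespace OrientedSpacetime

variable {M : Type*} [TopologicalSpace M] [ChartedSpace E4 M]

/-- The simple 2-form `A° = F°[-P]`. -/
def simpleForm (S : OrientedSpacetime M) (K X : TensorField M) : TensorField M := fun p =>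
  Matrix.toBilin (basisAt p) (Fzero (matAt S.g p) (-tracelessPart (matAt S.g p) (matAt K p))
    (matAt X p))

variable {S : OrientedSpacetime M} {K X Y : TensorField M}

theorem matAt_simpleForm (K X : TensorField M) (p : M) : matAt (S.simpleForm K X) p =
    Fzero (matAt S.g p) (-tracelessPart (matAt S.g p) (matAt K p)) (matAt X p) :=
  matAt_toBilin _ p

section

variable (hK : ∀ p x y, K p x y = K p y x) (halg : S.AlgebraicCond K) (hψ : S.IndexDefined K)
  {W V : Set M} (hX : S.Admissible K X W) {p : M} (hp : p ∈ W)

include hK halg hψ hX hp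

theorem simpleForm_skew :
    (matAt (S.simpleForm K X) p)ᵀ = -matAt (S.simpleForm K X) p := by
  obtain ⟨L, l1, l2, o, hL⟩ := exists_canonicalFrame hK halg hψ p
  obtain ⟨f, hf, -⟩ := hL.pull_Fzero (hX.1.matAt_transpose hp) (hX.2.2 p hp)
  rw [matAt_simpleForm]
  refine pull_injective hL.isUnit ?_
  rw [← pull_transpose, hf, pull_neg, hf, canForm_transpose]

theorem Qform_smul_simpleForm {c : ℝ} (hc : c ≠ 0) :
    Qform (matAt S.g p) (-tracelessPart (matAt S.g p) (matAt K p))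
      (c • matAt (S.simpleForm K X) p) ≠ 0 := by
  have hsk := simpleForm_skew hK halg hψ hX hp
  obtain ⟨L, l1, l2, o, hL⟩ := exists_canonicalFrame hK halg hψ p
  obtain ⟨f, hf, hf2⟩ := hL.pull_Fzero (hX.1.matAt_transpose hp) (hX.2.2 p hp)
  rw [← matAt_simpleForm] at hf
  have h1 := hL.pos
  have h2 := hL.nonneg
  have e : canForm f 0 0 1 = f := by simp [canForm]
  rw [hL.Qform_eq (by rw [Matrix.transpose_smul, hsk, smul_neg]), pull_smul, hf,
    Matrix.smul_apply, smul_eq_mul, mul_pow, e, hf2]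
  positivity

theorem tr_sq_simpleForm_pos :
    0 < tr (matAt S.g p) (sq (matAt S.g p) (matAt (S.simpleForm K X) p)) := by
  obtain ⟨L, l1, l2, o, hL⟩ := exists_canonicalFrame hK halg hψ p
  obtain ⟨f, hf, hf2⟩ := hL.pull_Fzero (hX.1.matAt_transpose hp) (hX.2.2 p hp)
  rw [← matAt_simpleForm] at hf
  rw [← tr_pull hL.isUnit, ← sq_pull hL.isUnit, hL.metric, hf, tr_sq_canForm]
  linarith [hL.pos, hL.nonneg]

/-- The 2-form `A°` is unique up to a sign. -/
theorem simpleForm_eq_or_eq_neg (hY : S.Admissible K Y V) (hp' : p ∈ V) :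
    matAt (S.simpleForm K X) p = matAt (S.simpleForm K Y) p ∨
      matAt (S.simpleForm K X) p = -matAt (S.simpleForm K Y) p := by
  obtain ⟨L, l1, l2, o, hL⟩ := exists_canonicalFrame hK halg hψ p
  obtain ⟨f, hf, hf2⟩ := hL.pull_Fzero (hX.1.matAt_transpose hp) (hX.2.2 p hp)
  obtain ⟨h, hh, hh2⟩ := hL.pull_Fzero (hY.1.matAt_transpose hp') (hY.2.2 p hp')
  rw [← matAt_simpleForm] at hf hh
  refine (sq_eq_sq_iff_eq_or_eq_neg.1 (hf2.trans hh2.symm)).imp (fun e => ?_) fun e => ?_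
  · refine pull_injective hL.isUnit ?_
    rw [hf, hh, e]
  · refine pull_injective hL.isUnit ?_
    rw [pull_neg, hf, hh, e, ← neg_one_smul ℝ (canForm h 0), smul_canForm]
    simp

end

variable [IsManifold (𝓡 4) ∞ M]

theorem comp_simpleForm {e : OpenPartialHomeomorph M E4}
    (he : e ∈ IsManifold.maximalAtlas (𝓡 4) ∞ M) {y : E4} (hy : y ∈ e.target)
    (hK : ∀ p x y, K p x y = K p y x)
    (hX : (matAt X (e.symm y))ᵀ = -matAt X (e.symm y)) :
    comp e (S.simpleForm K X) y = Fzero (comp e S.g y)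
      (-tracelessPart (comp e S.g y) (comp e K y)) (comp e X y) := by
  have hu := isUnit_det_coordMat he hy
  have hP : (-tracelessPart (matAt S.g (e.symm y)) (matAt K (e.symm y)))ᵀ =
      -tracelessPart (matAt S.g (e.symm y)) (matAt K (e.symm y)) := by
    rw [Matrix.transpose_neg, tracelessPart_transpose (S.matAt_transpose _)
      (matAt_transpose_of_symm hK _)]
  rw [comp_eq_pull e (S.simpleForm K X), matAt_simpleForm,
    ← Fzero_pull hu (S.matAt_transpose _) (S.isUnit_det_matAt _) hP hX, pull_neg,
    ← tracelessPart_pull hu, ← comp_eq_pull, ← comp_eq_pull, ← comp_eq_pull]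

theorem continuousAt_tr_cross {A B : TensorField M} {W : Set M} (hW : IsOpen W) {p : M}
    (hp : p ∈ W) (hA : SmoothOn A W) (hB : SmoothOn B W) :
    ContinuousAt (fun q => tr (matAt S.g q) (cross (matAt S.g q) (matAt A q) (matAt B q))) p := by
  set e := chartAt E4 p
  have he : e ∈ IsManifold.maximalAtlas (𝓡 4) ∞ M := IsManifold.chart_mem_maximalAtlas p
  have hps : p ∈ e.source := mem_chart_source E4 p
  have hy : e p ∈ coordDom e W := ⟨e.map_source hps, by simpa [e.left_inv hps] using hp⟩
  have hu := isUnit_det_comp (S := S) he hy.1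
  have hG := matSmoothAt_of_smoothOn_univ he S.smooth hy.1
  have hc := (hG.tr hu (hG.cross hu (hA.matSmoothAt hW he hy)
    (hB.matSmoothAt hW he hy))).continuousAt.comp (e.continuousAt hps)
  refine hc.congr ?_
  filter_upwards [e.open_source.mem_nhds hps] with q hq
  have hu := isUnit_det_coordMat he (e.map_source hq)
  change tr (comp e S.g (e q)) (cross (comp e S.g (e q)) (comp e A (e q)) (comp e B (e q))) = _
  rw [comp_eq_pull, comp_eq_pull, comp_eq_pull, cross_pull hu, tr_pull hu, e.left_inv hq]

section

variable (hK : ∀ p x y, K p x y = K p y x) (hKs : SmoothOn K Set.univ)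
  (halg : S.AlgebraicCond K) (hψ : S.IndexDefined K)

include hK hKs halg hψ

theorem smoothOn_simpleForm {W : Set M} (hW : IsOpen W) (hX : S.Admissible K X W) :
    SmoothOn (S.simpleForm K X) W :=
  smoothOn_of_matSmoothAt fun e he y hy =>
    (matSmoothAt_Fzero_comp hK halg hψ he hKs hW hX hy).congr <| by
      filter_upwards [(isOpen_coordDom e hW).mem_nhds hy] with z hz
      exact comp_simpleForm he hz.1 hK (hX.1.matAt_transpose hz.2)

/-- The relative sign of two forms `A°` is locally constant. -/
theorem eventually_simpleForm_eq_iff {W V : Set M} (hW : IsOpen W) (hV : IsOpen V)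
    (hX : S.Admissible K X W) (hY : S.Admissible K Y V) {p : M} (hp : p ∈ W ∩ V) :
    ∀ᶠ q in 𝓝 p, matAt (S.simpleForm K X) q = matAt (S.simpleForm K Y) q ↔
      matAt (S.simpleForm K X) p = matAt (S.simpleForm K Y) p := by
  have hc := continuousAt_tr_cross (S := S) (hW.inter hV) hp
    (fun e he i j => (smoothOn_simpleForm hK hKs halg hψ hW hX e he i j).mono
      fun z hz => ⟨hz.1, hz.2.1⟩)
    (fun e he i j => (smoothOn_simpleForm hK hKs halg hψ hV hY e he i j).mono
      fun z hz => ⟨hz.1, hz.2.2⟩)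
  -- the two forms agree where the trace of their product is positive
  have hiff : ∀ q ∈ W ∩ V, (matAt (S.simpleForm K X) q = matAt (S.simpleForm K Y) q →
      0 < tr (matAt S.g q) (cross (matAt S.g q) (matAt (S.simpleForm K X) q)
        (matAt (S.simpleForm K Y) q))) ∧
      (matAt (S.simpleForm K X) q ≠ matAt (S.simpleForm K Y) q →
      tr (matAt S.g q) (cross (matAt S.g q) (matAt (S.simpleForm K X) q)
        (matAt (S.simpleForm K Y) q)) < 0) := by
    intro q hq
    have hpos := tr_sq_simpleForm_pos hK halg hψ hY hq.2
    refine ⟨fun h => by rw [h]; exact hpos, fun h => ?_⟩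
    rw [(simpleForm_eq_or_eq_neg hK halg hψ hX hq.1 hY hq.2).resolve_left h]
    simpa [sq, cross, tr] using hpos
  have hWV := (hW.inter hV).mem_nhds hp
  by_cases h : matAt (S.simpleForm K X) p = matAt (S.simpleForm K Y) p
  · filter_upwards [hWV, hc.eventually (lt_mem_nhds ((hiff p hp).1 h))] with q hq h1
    refine iff_of_true ?_ h
    by_contra h2
    exact lt_asymm h1 ((hiff q hq).2 h2)
  · filter_upwards [hWV, hc.eventually (gt_mem_nhds ((hiff p hp).2 h))] with q hq h1
    exact iff_of_false (fun h2 => lt_asymm h1 ((hiff q hq).1 h2)) h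

/-- The signs of local forms `A°` can be chosen consistently, which yields a global form `A°`; it is
itself admissible. -/
theorem exists_admissible_univ [SimplyConnectedSpace M] : ∃ X, S.Admissible K X Set.univ := by
  classical
  have : LocallyPathConnectedSpace M := ChartedSpace.locallyPathConnectedSpace E4 M
  choose W hW hmem X hX using exists_admissible hK hKs halg hψ
  let A : M → TensorField M := fun i => S.simpleForm K (X i)
  -- the relative sign of the forms `A i` and `A j`
  let s : M → M → M → ℤˣ := fun i j q => if matAt (A i) q = matAt (A j) q then 1 else -1
  have hs : ∀ i j, ∀ q ∈ W i ∩ W j, matAt (A i) q = (((s i j q : ℤˣ) : ℤ) : ℝ) • matAt (A j) q := by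
    intro i j q hq
    by_cases h : matAt (A i) q = matAt (A j) q
    · simp [s, h]
    · simpa [s, h] using
        (simpleForm_eq_or_eq_neg hK halg hψ (hX i) hq.1 (hX j) hq.2).resolve_left h
  have hne : ∀ i, ∀ q ∈ W i, matAt (A i) q ≠ 0 := by
    intro i q hq h
    have := tr_sq_simpleForm_pos hK halg hψ (hX i) hq
    change 0 < tr _ (sq _ (matAt (A i) q)) at this
    rw [h] at this
    simp [tr, sq, cross] at this
  obtain ⟨σ, hσ⟩ := exists_section_of_sign_cocycle hW hmem s (fun i x _ => if_pos rfl)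
    (fun i j x hx => by
      filter_upwards [eventually_simpleForm_eq_iff hK hKs halg hψ (hW i) (hW j) (hX i) (hX j) hx]
        with z hz
      exact if_congr hz rfl rfl)
    (fun i j k x hx => by
      have h := hs i k x ⟨hx.1.1, hx.2⟩
      rw [hs i j x hx.1, hs j k x ⟨hx.1.2, hx.2⟩, smul_smul] at h
      have h' := smul_left_injective ℝ (hne k x hx.2) h
      have h'' : ((s i j x : ℤˣ) : ℤ) * ((s j k x : ℤˣ) : ℤ) = ((s i k x : ℤˣ) : ℤ) := by
        exact_mod_cast h'
      rw [mul_comm]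
      exact Units.ext (by simpa using h''))
  -- the indices of the local forms are points, so that `A q` is available at `q`
  let X' : TensorField M := fun q => (((σ q : ℤˣ) : ℤ) : ℝ) • A q q
  have hX' : ∀ q, matAt X' q = (((σ q : ℤˣ) : ℤ) : ℝ) • matAt (A q) q := fun q => rfl
  have hloc : ∀ p, ∀ᶠ q in 𝓝 p, matAt X' q = (((σ p : ℤˣ) : ℤ) : ℝ) • matAt (A p) q := by
    intro p
    filter_upwards [hσ p, (hW p).mem_nhds (hmem p)] with q hq hqp
    rw [hX', hs q p q ⟨hmem q, hqp⟩, smul_smul, ← hq]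
    push_cast
    rw [mul_comm]
  refine ⟨X', skewOn_of_matAt fun q _ => ?_, smoothOn_of_matSmoothAt fun e he y hy => ?_,
    fun q _ => ?_⟩
  · rw [hX', Matrix.transpose_smul, simpleForm_skew hK halg hψ (hX q) (hmem q), smul_neg]
  · have h1 := (smoothOn_simpleForm hK hKs halg hψ (hW (e.symm y)) (hX _)).matSmoothAt (hW _) he
      (y := y) ⟨hy.1, hmem _⟩
    refine (MatSmoothAt.smul
      (contDiffAt_const (c := (((σ (e.symm y) : ℤˣ) : ℤ) : ℝ))) h1).congr ?_
    filter_upwards [(e.continuousAt_symm hy.1).eventually (hloc (e.symm y))] with z hz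
    rw [comp_eq_pull, hz, comp_eq_pull, pull_smul]
  · rw [hX']
    refine Qform_smul_simpleForm hK halg hψ (hX q) (hmem q) ?_
    exact_mod_cast (σ q).ne_zero

end

end OrientedSpacetime

end Rainich

end

theorem mainTheorem1 {M : Type*} [TopologicalSpace M] [ChartedSpace Rainich.E4 M]
    [IsManifold (𝓡 4) ∞ M] [T2Space M] [ConnectedSpace M]
    (S : Rainich.OrientedSpacetime M) (K : Rainich.TensorField M)
    (hKsymm : ∀ p x y, K p x y = K p y x)
    (hKsmooth : Rainich.SmoothOn K Set.univ)
    (hψ : S.IndexDefined K) :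
    -- K is the square of a regular KY tensor iff it satisfies the conditions and A° exists globally
    ((∃ A, S.IsRegularKYOn A Set.univ ∧ S.IsSquareOn K A Set.univ) ↔
      S.Cond K ∧ ∃ X, S.Admissible K X Set.univ) ∧
    -- on a simply connected spacetime A° always exists globally
    (SimplyConnectedSpace M →
      ((∃ A, S.IsRegularKYOn A Set.univ ∧ S.IsSquareOn K A Set.univ) ↔ S.Cond K)) ∧
    -- locally A° always exists
    (S.Cond K → ∀ p : M, ∃ W : Set M, IsOpen W ∧ p ∈ W ∧ ∃ X, S.Admissible K X W) ∧
    -- explicit construction of the KY tensor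
    (∀ ε : ℝ, (ε = 1 ∨ ε = -1) → S.CondWith K ε →
      ∀ W : Set M, IsOpen W → ∀ X, S.Admissible K X W →
        S.IsRegularKYOn (S.kyTensor K ε X) W ∧ S.IsSquareOn K (S.kyTensor K ε X) W) := by
  have hε2 : ∀ {ε : ℝ}, ε = 1 ∨ ε = -1 → ε ^ 2 = 1 := by
    rintro ε (rfl | rfl) <;> norm_num
  have h1 : (∃ A, S.IsRegularKYOn A Set.univ ∧ S.IsSquareOn K A Set.univ) ↔
      S.Cond K ∧ ∃ X, S.Admissible K X Set.univ := by
    constructor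
    · rintro ⟨A, hA, hsq⟩
      have h := Rainich.OrientedSpacetime.cond_of_isSquareOn hKsymm hψ hA hsq
      exact ⟨h.1, A, h.2⟩
    · rintro ⟨⟨ε, hε, hc⟩, X, hX⟩
      exact ⟨_, Rainich.OrientedSpacetime.isRegularKYOn_kyTensor hKsymm hKsmooth hψ (hε2 hε) hc
        isOpen_univ hX⟩
  refine ⟨h1, fun _ => h1.trans (and_iff_left_of_imp ?_), ?_, ?_⟩
  · rintro ⟨ε, -, hc⟩
    exact Rainich.OrientedSpacetime.exists_admissible_univ hKsymm hKsmooth hc.1 hψ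
  · rintro ⟨ε, -, hc⟩
    exact Rainich.OrientedSpacetime.exists_admissible hKsymm hKsmooth hc.1 hψ
  · exact fun ε hε hc W hW X hX =>
      Rainich.OrientedSpacetime.isRegularKYOn_kyTensor hKsymm hKsmooth hψ (hε2 hε) hc hW hX
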